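/- Let $h\neq 0$ be the lattice spacing and consider real functions $f(n,x)$, $n\in\mathbb Z$, $x\in\mathbb R$. Let $E f(n,x)=f(n+1,x)$, $\Delta=E-1$, and $\Delta^{-1}f(n,x)=\sum_{j<n}f(j,x)$. Pseudo-difference operators $\sum_{j\le M}p_j\Delta^j$ are multiplied by means of $\Delta^s g=\sum_{i\ge0}\binom{s}{i}(\Delta^iE^{s-i}g)\Delta^{s-i}$, $s\in\mathbb Z$; $(P)_{\ge1}$ is the part of $P$ with powers $\Delta^j$, $j\ge1$; $P_x$ is the operator with $x$-differentiated coefficients. Call a function rapidly decreasing if it is $C^\infty$ in the continuous variables and, with all their derivatives, decreases faster than any power of $|n|$ as $n\to-\infty$, locally uniformly in the continuous variables. The potentials are the rapidly decreasing $\tilde v(n,x)$ for which $\bar v=1+h\tilde v$ has no zero. For a potential $\tilde v$ put $\bar A_1=h^{-1}\bar v\Delta$, and let $\bar L=h^{-1}\bar v\Delta+\bar v_0+h\bar v_1\Delta^{-1}+h^2\bar v_2\Delta^{-2}+\cdots$ be the unique operator of this form with rapidly decreasing $\bar v_i$ and $\bar L_x=[\bar A_1,\bar L]$. For $m\ge1$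 let $\bar A_m=(\bar L^m)_{\ge1}$ and $$\bar K_m=(\bar A_{m,x}-[\bar A_1,\bar A_m])\Delta^{-1}.$$ For $m\ge2$ let $\bar B_m=\sum_{j=1}^m b_j\Delta^j$ be the unique operator whose coefficients differ by rapidly decreasing functions from those of $h^{-(m-1)}x\Delta^m+h^{-(m-1)}(x+nh)\Delta^{m-1}$ and for which $[\bar B_m,\bar L]+h\bar L^m+\bar L^{m-1}$ has order at most $1$, and let $$\bar\sigma_m=(\bar B_{m,x}+[\bar B_m,\bar A_1])\Delta^{-1}.$$ These are functions, well defined for every potential: $\bar L$, $\bar B_m$ exist and are unique, $\bar A_{m,x}-[\bar A_1,\bar A_m]=\bar K_m\Delta$ and $\bar B_{m,x}+[\bar B_m,\bar A_1]=\bar\sigma_m\Delta$; moreover the derivative of $\bar L$ along $\bar K_m$ is $[\bar A_m,\bar L]$, and along $\bar\sigma_m$ it is $[\bar B_m,\bar L]+h\bar L^m+\bar L^{m-1}$. For functionals $F,G$ of $\tilde v$ let $F'[g]=\frac{d}{d\varepsilon}F(\tilde v+\varepsilon g)\big|_{\varepsilon=0}$ and $⟦F,G⟧=F'[G]-G'[F]$.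 A functional $\omega$, which may depend explicitly on $t$, is a symmetry of $\tilde v_t=K(\tilde v)$ if $\omega_t=K'[\omega]$ (with the total $t$-derivative) along all solutions $\tilde v(n,x,t)$, on open sets of times, that are rapidly decreasing with respect to the continuous variables $(x,t)$ and have $1+h\tilde v\ne0$. **Theorem.** For every $k\ge1$ the equation $\tilde v_{t_k}=\bar K_k(\tilde v)$ has the two sets of symmetries $$\{\bar K_s\}_{s\ge1},\qquad \{\bar\tau^k_m=k\,t_k\,(h\bar K_{m+k-1}+\bar K_{m+k-2})+\bar\sigma_m\}_{m\ge2}.$$ For each value of $t_k$, their real linear span (as functionals on the space of potentials) is a Lie algebra under $⟦\cdot,\cdot⟧$, all Gâteaux derivatives involved being defined, and on the space of potentials $$⟦\bar K_s,\bar K_m⟧=0\quad(s,m\ge1),$$ $$⟦\bar K_s,\bar\tau^k_m⟧=s\,(h\bar K_{m+s-1}+\bar K_{m+s-2})\quad(s\ge1,\ m\ge2),$$ $$⟦\bar\tau^k_s,\bar\tau^k_m⟧=(s-m)\,(h\bar\tau^k_{m+s-1}+\bar\tau^k_{m+s-2})\quad(s,m\ge2).$$ -/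

import Mathlib

open scoped ContDiff

noncomputable section

namespace DDmKP

/-! ## Lattice functions -/

/-- Functions `f(n, x)` of a lattice variable `n ∈ ℤ` and a continuous variable `x ∈ ℝ`. -/
abbrev Fn := ℤ → ℝ → ℝ

/-- The shift `E^k`. -/
def shift (k : ℤ) (f : Fn) : Fn := fun n x => f (n + k) x

/-- The forward difference `Δ = E - 1`. -/
def diff (f : Fn) : Fn := shift 1 f - f

/-- The derivative with respect to `x`. -/
def dx (f : Fn) : Fn := fun n x => deriv (f n) x

/-- The inverse difference `Δ⁻¹`, summation from `-∞`: `(Δ⁻¹ f)(n) = ∑_{j < n} f(j)`. -/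
def invDiff (f : Fn) : Fn := fun n x => ∑' k : ℕ, f (n - 1 - k) x

/-- A family `f(n, z)` with parameter `z ∈ Ω` (an open subset of a normed space) which is `C^∞` in
`z` and, together with all its derivatives in `z`, decreases faster than every power of `|n|` as
`n → -∞`, locally uniformly in `z`. -/
def RapidlyDecreasing {P : Type*} [NormedAddCommGroup P] [NormedSpace ℝ P]
    (Ω : Set P) (f : ℤ → P → ℝ) : Prop :=
  (∀ n, ContDiffOn ℝ ∞ (f n) Ω) ∧
  ∀ C ⊆ Ω, IsCompact C → ∀ p k : ℕ, ∃ M : ℝ, ∀ n : ℤ, n ≤ 0 → ∀ z ∈ C,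
    |(n : ℝ)| ^ p * ‖iteratedFDeriv ℝ k (f n) z‖ ≤ M

/-- `v̄ = 1 + h ṽ`. -/
def vbar (h : ℝ) (v : Fn) : Fn := fun n x => 1 + h * v n x

/-- The phase space: smooth, rapidly decreasing potentials `ṽ` with `v̄ = 1 + h ṽ` nowhere zero. -/
def Admissible (h : ℝ) (v : Fn) : Prop :=
  RapidlyDecreasing Set.univ v ∧ ∀ n x, vbar h v n x ≠ 0

/-! ## Pseudo-difference operators -/

/-- A (formal) pseudo-difference operator `∑_j P_j Δ^j`, given by its coefficients `P_j`, `j ∈ ℤ`.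
All operators used below have coefficients that vanish for large `j`. -/
abbrev Op := ℤ → Fn

/-- Multiplication of pseudo-difference operators, from the extended Leibniz rule
`Δ^a g = ∑_{i ≥ 0} C(a, i) (Δ^i E^{a-i} g) Δ^{a-i}`. For operators of bounded order the sums are
finite. -/
def opMul (P Q : Op) : Op := fun k =>
  ∑ᶠ a : ℤ, ∑ᶠ i : ℕ, Ring.choose a i • (P a * diff^[i] (shift (a - i) (Q (k - a + i))))

/-- Powers of an operator. -/
def opPow (P : Op) : ℕ → Op
  | 0 => Pi.single 0 (1 : Fn)
  | m + 1 => opMul (opPow P m) P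

/-- The commutator `[P, Q] = PQ - QP`. -/
def comm (P Q : Op) : Op := opMul P Q - opMul Q P

/-- The part `(P)_{≥ 1} = ∑_{j ≥ 1} P_j Δ^j`. -/
def geOne (P : Op) : Op := fun j => if 1 ≤ j then P j else 0

/-- The operator `P_x`, whose coefficients are differentiated with respect to `x`. -/
def opDx (P : Op) : Op := fun j => dx (P j)

/-- `Ā₁ = h⁻¹ v̄ Δ`. -/
def opA1 (h : ℝ) (v : Fn) : Op := Pi.single 1 (h⁻¹ • vbar h v)

/-! ## The Lax operator -/

/-- The integrating factor `π_j`, `j ∈ ℤ`, with `π_0 = 1` and `π_{j+1} = π_j · E^j v̄`. -/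
def weight (h : ℝ) (v : Fn) (j : ℤ) : Fn := fun n x =>
  (∏ i ∈ Finset.range j.toNat, vbar h v (n + i) x) /
    ∏ i ∈ Finset.range (-j).toNat, vbar h v (n - 1 - i) x

/-- The operator `h⁻¹ v̄ Δ + ∑_{i < s} L_{-i} Δ^{-i}`; the coefficient of `Δ^{-s}` is obtained from
the preceding ones by integrating the coefficient of `Δ^{1-s}` in `L_x = [Ā₁, L]`, that is,
`h⁻¹ (v̄ · E L_{-s} - L_{-s} · E^{-s} v̄) = (T_x - [Ā₁, T])_{1-s}`, with `L_{-s} → 0` as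
`n → -∞`. -/
def laxTrunc (h : ℝ) (v : Fn) : ℕ → Op
  | 0 => opA1 h v
  | s + 1 =>
    let T := laxTrunc h v s
    let f : Fn := (opDx T - comm (opA1 h v) T) (1 - s)
    T + Pi.single (-(s : ℤ)) (weight h v (-s) * invDiff (h • f / weight h v (1 - s)))

/-- The Lax operator `L̄ = h⁻¹ v̄ Δ + v̄₀ + h v̄₁ Δ⁻¹ + h² v̄₂ Δ⁻² + ⋯` of the potential `ṽ`. -/
def lax (h : ℝ) (v : Fn) : Op := fun j => laxTrunc h v (1 - j).toNat j

/-- The characterization of the Lax operator: `L = h⁻¹ v̄ Δ + v̄₀ + h v̄₁ Δ⁻¹ + ⋯` with rapidly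
decreasing `v̄₀, v̄₁, …` and `L_x = [Ā₁, L]`. -/
structure IsLax (h : ℝ) (v : Fn) (L : Op) : Prop where
  order : ∀ j : ℤ, 1 < j → L j = 0
  leading : L 1 = h⁻¹ • vbar h v
  decay : ∀ j : ℤ, j ≤ 0 → RapidlyDecreasing Set.univ (L j)
  eqn : opDx L = comm (opA1 h v) L

/-! ## The isospectral flows -/

/-- Functionals `ṽ ↦ F(ṽ)` with values in lattice functions. -/
abbrev Functional := Fn → Fn

/-- `Ā_m = (L̄^m)_{≥ 1}`. -/
def opA (h : ℝ) (m : ℕ) (v : Fn) : Op := geOne (opPow (lax h v) m)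

/-- The isospectral flow `K̄_m = (Ā_{m,x} - [Ā₁, Ā_m]) Δ⁻¹`: the operator in parentheses is
`K̄_m Δ`, so `K̄_m` is its coefficient of `Δ`. -/
def flowK (h : ℝ) (m : ℕ) : Functional := fun v =>
  (opDx (opA h m v) - comm (opA1 h v) (opA h m v)) 1

/-! ## The nonisospectral flows -/

/-- The operator `h^{-(m-1)} x Δ^m + h^{-(m-1)} (x + n h) Δ^{m-1}`, for `m ≥ 2`. -/
def backgroundB (h : ℝ) (m : ℕ) : Op :=
  Pi.single (m : ℤ) (fun _ x => (h ^ (m - 1))⁻¹ * x) +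
    Pi.single ((m : ℤ) - 1) (fun (n : ℤ) (x : ℝ) => (h ^ (m - 1))⁻¹ * (x + (n : ℝ) * h))

/-- The right-hand side `[B, L̄] + h L̄^m + L̄^{m-1}` of the nonisospectral Lax equation. -/
def nonisoRhs (h : ℝ) (m : ℕ) (v : Fn) (B : Op) : Op :=
  comm B (lax h v) + h • opPow (lax h v) m + opPow (lax h v) (m - 1)

/-- The part of `B̄_m` with the `r` highest coefficients, those of `Δ^m, …, Δ^{m-r+1}`. The
coefficient `b_j` of `Δ^j` is obtained from the preceding ones by integrating the condition that the
coefficient of `Δ^{j+1}` in `[B̄_m, L̄] + h L̄^m + L̄^{m-1}` vanishes, that is,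
`h⁻¹ (v̄ · E b_j - b_j · E^j v̄) = f` below, with `b_j` asymptotic to the coefficient of
`backgroundB` as `n → -∞`. -/
def truncB (h : ℝ) (m : ℕ) (v : Fn) : ℕ → Op
  | 0 => 0
  | r + 1 =>
    let T := truncB h m v r
    let j : ℤ := m - r
    let f : Fn := nonisoRhs h m v T (j + 1)
    let b : Fn := backgroundB h m j
    T + Pi.single j (weight h v j * (b + invDiff (h • f / weight h v (j + 1) - diff b)))

/-- The difference operator `B̄_m`, for `m ≥ 2`. -/
def opB (h : ℝ) (m : ℕ) (v : Fn) : Op := truncB h m v m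

/-- The characterization of `B̄_m`: a difference operator `∑_{1 ≤ j ≤ m} B_j Δ^j`, with coefficients
that differ from those of the background operator by rapidly decreasing functions, such that
`[B, L̄] + h L̄^m + L̄^{m-1}` has order at most one, as `∂L̄/∂t_m` has. -/
structure IsOpB (h : ℝ) (m : ℕ) (v : Fn) (B : Op) : Prop where
  form : ∀ j : ℤ, j < 1 ∨ (m : ℤ) < j → B j = 0
  asymptotics : ∀ j : ℤ, RapidlyDecreasing Set.univ (B j - backgroundB h m j)
  eqn : ∀ j : ℤ, 2 ≤ j → nonisoRhs h m v B j = 0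

/-- The nonisospectral flow `σ̄_m = (B̄_{m,x} + [B̄_m, Ā₁]) Δ⁻¹`, for `m ≥ 2`: the operator in
parentheses is `σ̄_m Δ`, so `σ̄_m` is its coefficient of `Δ`. -/
def flowSigma (h : ℝ) (m : ℕ) : Functional := fun v =>
  (opDx (opB h m v) + comm (opB h m v) (opA1 h v)) 1

/-- The functionals `τ̄_m^k = k t (h K̄_{m+k-1} + K̄_{m+k-2}) + σ̄_m`, depending on the time `t`. -/
def flowTau (h : ℝ) (k m : ℕ) (t : ℝ) : Functional :=
  ((k : ℝ) * t) • (h • flowK h (m + k - 1) + flowK h (m + k - 2)) + flowSigma h m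

/-! ## Gateaux derivative, Lie product, symmetries -/

/-- The Gateaux derivative `F'(v)[g] = d/dε F(v + ε g)` at `ε = 0`. -/
def gateaux (F : Functional) (v g : Fn) : Fn := fun n x =>
  deriv (fun ε : ℝ => F (v + ε • g) n x) 0

/-- Existence of the Gateaux derivative `F'(v)[g]`. -/
def GateauxDiff (F : Functional) (v g : Fn) : Prop :=
  ∀ n x, DifferentiableAt ℝ (fun ε : ℝ => F (v + ε • g) n x) 0

/-- The Lie product `⟦F, G⟧ = F'[G] - G'[F]`. -/
def lieProd (F G : Functional) : Functional := fun v =>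
  gateaux F v (G v) - gateaux G v (F v)

/-- `v = v(t)`, `t ∈ I`, is a smooth, rapidly decreasing solution of `v_t = K(v)`, with
`1 + h v` nowhere zero. -/
structure IsSolution (h : ℝ) (K : Functional) (I : Set ℝ) (v : ℝ → Fn) : Prop where
  smooth : RapidlyDecreasing (I ×ˢ (Set.univ : Set ℝ)) (fun n (p : ℝ × ℝ) => v p.1 n p.2)
  ne_zero : ∀ t ∈ I, ∀ n x, vbar h (v t) n x ≠ 0
  eqn : ∀ t ∈ I, ∀ n x, HasDerivAt (fun s => v s n x) (K (v t) n x) t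

/-- `W = W(t, v)` is a symmetry of `v_t = K(v)`: along every solution `v`, on any open set of times,
`d/dt W(t, v(t)) = K'(v)[W]`, all derivatives being defined. -/
def IsSymmetry (h : ℝ) (K : Functional) (W : ℝ → Functional) : Prop :=
  ∀ (I : Set ℝ) (v : ℝ → Fn), IsOpen I → IsSolution h K I v → ∀ t ∈ I,
    GateauxDiff K (v t) (W t (v t)) ∧
    ∀ n x, HasDerivAt (fun s => W s (v s) n x) (gateaux K (v t) (W t (v t)) n x) t

/-- The restriction of a functional to the phase space. -/
def restrict (h : ℝ) (F : Functional) : {v : Fn // Admissible h v} → Fn := fun v => F v.1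

/-- The real span of the set `G` of functionals, as functions on the phase space, is a Lie algebra
under the Lie product `⟦·, ·⟧`, all the Gateaux derivatives involved being defined. -/
def ComposeLieAlgebra (h : ℝ) (G : Set Functional) : Prop :=
  (∀ F₁ ∈ Submodule.span ℝ G, ∀ F₂ ∈ Submodule.span ℝ G, ∀ v, Admissible h v →
    GateauxDiff F₁ v (F₂ v)) ∧
  ∃ (𝔤 : Type) (_ : LieRing 𝔤) (_ : LieAlgebra ℝ 𝔤)
    (ρ : 𝔤 →ₗ[ℝ] ({v : Fn // Admissible h v} → Fn)),
    Function.Injective ρ ∧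
    LinearMap.range ρ = Submodule.span ℝ (restrict h '' G) ∧
    ∀ F₁ ∈ Submodule.span ℝ G, ∀ F₂ ∈ Submodule.span ℝ G, ∀ a b : 𝔤,
      ρ a = restrict h F₁ → ρ b = restrict h F₂ → ρ ⁅a, b⁆ = restrict h (lieProd F₁ F₂)

/-- At `v`, the operators `L̄`, `B̄_m` are the unique ones with their defining properties, the zero
curvature equations define `K̄_m`, `σ̄_m`, and the Lax equations `L̄_t = [Ā_m, L̄]` along `K̄_m` and
`L̄_t = [B̄_m, L̄] + h L̄^m + L̄^{m-1}` along `σ̄_m` hold. -/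
structure HierarchyWellDefined (h : ℝ) (v : Fn) : Prop where
  lax_unique : ∀ L : Op, IsLax h v L ↔ L = lax h v
  opB_unique : ∀ m : ℕ, 2 ≤ m → ∀ B : Op, IsOpB h m v B ↔ B = opB h m v
  zero_curvature_K : ∀ m : ℕ, 1 ≤ m →
    opDx (opA h m v) - comm (opA1 h v) (opA h m v) = Pi.single 1 (flowK h m v)
  zero_curvature_sigma : ∀ m : ℕ, 2 ≤ m →
    opDx (opB h m v) + comm (opB h m v) (opA1 h v) = Pi.single 1 (flowSigma h m v)
  lax_eqn_K : ∀ m : ℕ, 1 ≤ m → ∀ j : ℤ,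
    GateauxDiff (fun u => lax h u j) v (flowK h m v) ∧
    gateaux (fun u => lax h u j) v (flowK h m v) = comm (opA h m v) (lax h v) j
  lax_eqn_sigma : ∀ m : ℕ, 2 ≤ m → ∀ j : ℤ,
    GateauxDiff (fun u => lax h u j) v (flowSigma h m v) ∧
    gateaux (fun u => lax h u j) v (flowSigma h m v) = nonisoRhs h m v (opB h m v) j

end DDmKP

end

/-! Write `z` for the symbol of `h⁻¹Δ`. Every flow is labelled by a symbol, a pair of polynomials
`(p, q)` in `z`: its generator `P` is a polynomial in `Δ` without constant term, asymptotic as `n →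
-∞` to the background operator `p(h⁻¹Δ) + G q(h⁻¹Δ)` with `G = xΔ + (x + nh)`, and `[P, L̄] + ((1 +
hz)q)(L̄)` has order at most one (`IsFlow`). `K̄_m` has symbol `(z^m, 0)` and `σ̄_m` has symbol `(0,
z^(m-1))`. The theorem amounts to the statement that the Lie product of two flows is the flow whose
symbol is the commutator of the symbols; the relations are then identities between polynomials.

The commutator of symbols is found at the background. Since `[h⁻¹Δ, G] = 1 + h(h⁻¹Δ)`, commutation
with `G` acts on polynomials in `z` as the vector field `(1 + hz) d/dz`, and the background
operators close under commutators (`bg_comm`).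

Everything else rests on one rigidity principle. If `W` has decaying coefficients and top term `g
Δ^j`, the top coefficient of `[Ā₁, W]` is `h⁻¹(v̄ · E g - g · E^j v̄)`. Dividing `g` by the
integrating factor `weight` turns this into a multiple of `E c - c`, which vanishes for decaying `c`
only if `c = 0`. Descending through the orders, `eq_zero_of_comm` annihilates `W`. It yields
uniqueness of `L̄`, uniqueness for the linearized Lax equation, the zero curvature equations, and
the fact that a generator is determined by its symbol (`IsFlow.eq`). Existence comes from solving
the same first-order difference equations by summation from `-∞`.

Let the potential move with the velocity of the flow of `Q`. Differentiating `L̄_x = [Ā₁, L̄]` gives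
a linearized equation which is also solved by the right-hand side of the Lax equation of `Q`, so the
Lax equation holds (`Jet.opδ_lax`). For two flows with generators `P` and `Q`, the operator made of
the derivative of `P` along `Q`, minus the derivative of `Q` along `P`, plus `[P, Q]`, is again a
generator. Its symbol is the commutator and its flow is the Lie product (`Jet.isFlow_bracket`); by
uniqueness it is the expected combination of the `K̄` and `σ̄`.

The algebra is carried out over an abstract ring of lattice functions (`LatticeDiff`, `Jet`),
realized by families `f(n, s, x)` of at most polynomial growth as `n → -∞`, with the rapidly
decreasing ones as ideal and `d/ds` at `s = 0` as jet. A line `v + εg` may leave the phase space for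
every `ε ≠ 0`. But the value of a flow at a point depends only on `v` for bounded-above `n` over a
neighbourhood of `x`, so the line can be replaced by an admissible family that agrees with it there
(`exists_family_of_velocity`).

For the symmetries, `τ̄ = t F₁ + σ̄_m` with `F₁ = ⟦K̄_k, σ̄_m⟧`, and `F₁` commutes with `K̄_k`; so
the explicit `t`-derivative supplies exactly the difference between `K̄_k'[τ̄]` and `τ̄'[K̄_k]`. The
Lie algebra is that of symbols modulo the ideal of symbols whose flow vanishes on the phase space,
so linear independence of the flows is not needed. -/

noncomputable section

namespace PseudoDiff

variable {R : Type*} [CommRing R] [Algebra ℝ R]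

/-! ## The extended Leibniz rule -/

/-- The difference operator `E - 1`. -/
def delta (E : R ≃ₐ[ℝ] R) : Module.End ℝ R := E.toLinearMap - 1

/-- The shift `E^a` as a linear map. -/
def shiftEnd (E : R ≃ₐ[ℝ] R) (a : ℤ) : Module.End ℝ R := (E ^ a).toLinearMap

lemma shiftEnd_apply (E : R ≃ₐ[ℝ] R) (a : ℤ) (f : R) : shiftEnd E a f = (E ^ a) f := rfl

lemma delta_apply (E : R ≃ₐ[ℝ] R) (f : R) : delta E f = E f - f := rfl

lemma shiftEnd_add (E : R ≃ₐ[ℝ] R) (a b : ℤ) :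
    shiftEnd E (a + b) = shiftEnd E a * shiftEnd E b := by
  ext f
  simp [shiftEnd_apply, zpow_add]

lemma shiftEnd_natCast (E : R ≃ₐ[ℝ] R) (n : ℕ) : shiftEnd E n = E.toLinearMap ^ n := by
  induction n with
  | zero => ext; simp [shiftEnd_apply]
  | succ n ih =>
    rw [Nat.cast_succ, shiftEnd_add, ih, pow_succ]
    congr 1

lemma delta_eq (E : R ≃ₐ[ℝ] R) : delta E = shiftEnd E 1 - 1 := by
  ext f; simp [shiftEnd_apply, delta_apply]

lemma commute_delta_shiftEnd (E : R ≃ₐ[ℝ] R) (a : ℤ) : Commute (delta E) (shiftEnd E a) := by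
  rw [delta_eq]
  refine Commute.sub_left ?_ (Commute.one_left _)
  rw [Commute, SemiconjBy, ← shiftEnd_add, ← shiftEnd_add, add_comm]

/-- The coefficient operators in `Δ^a g = ∑_i (leibnizCoeff a i g) Δ^(a-i)`. -/
def leibnizCoeff (E : R ≃ₐ[ℝ] R) (a : ℤ) (i : ℕ) : Module.End ℝ R :=
  Ring.choose a i • (delta E ^ i * shiftEnd E (a - i))

lemma leibnizCoeff_apply (E : R ≃ₐ[ℝ] R) (a : ℤ) (i : ℕ) (f : R) :
    leibnizCoeff E a i f = Ring.choose a i • (delta E ^ i) ((E ^ (a - i)) f) := rfl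

lemma leibnizCoeff_zero (E : R ≃ₐ[ℝ] R) (a : ℤ) (f : R) : leibnizCoeff E a 0 f = (E ^ a) f := by
  simp [leibnizCoeff_apply]

/-- Vandermonde's identity for generalized binomial coefficients; the powers of `delta` and of the
shift commute and their exponents add up. This is the compatibility of the Leibniz rule with
`Δ^(a+b) = Δ^a Δ^b`. -/
lemma leibnizCoeff_add (E : R ≃ₐ[ℝ] R) (a b : ℤ) (n : ℕ) :
    leibnizCoeff E (a + b) n =
      ∑ p ∈ Finset.HasAntidiagonal.antidiagonal n, leibnizCoeff E a p.1 * leibnizCoeff E b p.2 := by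
  rw [leibnizCoeff, Ring.add_choose_eq n (Commute.all a b), Finset.sum_smul]
  refine Finset.sum_congr rfl fun p hp => ?_
  rw [Finset.HasAntidiagonal.mem_antidiagonal] at hp
  rw [leibnizCoeff, leibnizCoeff, smul_mul_smul_comm]
  congr 1
  have : a + b - (n : ℤ) = (a - p.1) + (b - p.2) := by rw [← hp]; push_cast; ring
  rw [this, shiftEnd_add, ← hp, pow_add, mul_assoc, mul_assoc]
  congr 1
  rw [← mul_assoc, ← mul_assoc, ((commute_delta_shiftEnd E (a - p.1)).pow_left p.2).eq]

-- On `R ⊗ R`, followed by multiplication, the difference of a product is `Δ ⊗ 1 + E ⊗ Δ`. The two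
-- summands commute, so the binomial theorem gives all powers.
open TensorProduct in
lemma delta_pow_mul (E : R ≃ₐ[ℝ] R) (n : ℕ) (q r : R) :
    (delta E ^ n) (q * r) = ∑ p ∈ Finset.HasAntidiagonal.antidiagonal n,
      n.choose p.1 • ((delta E ^ p.1) ((E ^ (p.2 : ℤ)) q) * (delta E ^ p.2) r) := by
  let μ : R ⊗[ℝ] R →ₗ[ℝ] R := LinearMap.mul' ℝ R
  let x : Module.End ℝ (R ⊗[ℝ] R) := TensorProduct.map (delta E) 1
  let y : Module.End ℝ (R ⊗[ℝ] R) := TensorProduct.map (shiftEnd E 1) (delta E)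
  have hμ : ∀ t, delta E (μ t) = μ ((x + y) t) := by
    intro t
    induction t with
    | zero => simp
    | add a b ha hb => simp only [map_add, ha, hb]
    | tmul a b =>
      simp [μ, x, y, delta_apply, shiftEnd_apply]
      ring
  have hμn : ∀ k t, (delta E ^ k) (μ t) = μ (((x + y) ^ k) t) := by
    intro k
    induction k with
    | zero => simp
    | succ k ih => intro t; rw [pow_succ, pow_succ, Module.End.mul_apply, hμ, ih]; rfl
  have hc : Commute x y := by
    rw [Commute, SemiconjBy]
    change TensorProduct.map _ _ ∘ₗ TensorProduct.map _ _ =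
      TensorProduct.map _ _ ∘ₗ TensorProduct.map _ _
    rw [← TensorProduct.map_comp, ← TensorProduct.map_comp]
    congr 1
    exact (commute_delta_shiftEnd E 1).eq
  have := hμn n (q ⊗ₜ r)
  rw [hc.add_pow'] at this
  simp only [LinearMap.sum_apply, map_sum] at this
  rw [show q * r = μ (q ⊗ₜ r) from rfl, this]
  refine Finset.sum_congr rfl fun p _ => ?_
  rw [LinearMap.smul_apply, map_nsmul]
  congr 1
  have hx : x ^ p.1 = TensorProduct.map (delta E ^ p.1) 1 := by
    have := TensorProduct.map_pow (delta E) (1 : Module.End ℝ R) p.1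
    rwa [one_pow] at this
  have hy : y ^ p.2 = TensorProduct.map (shiftEnd E p.2) (delta E ^ p.2) := by
    have := TensorProduct.map_pow (shiftEnd E 1) (delta E) p.2
    rw [shiftEnd_natCast, show E.toLinearMap = shiftEnd E 1 by ext; simp [shiftEnd_apply], ← this]
  rw [hx, hy]
  simp [μ, shiftEnd_apply]

/-- Combine `delta_pow_mul` with `C(a, n) C(n, i) = C(a, i) C(a - i, n - i)`. This is the
compatibility of the Leibniz rule with `Δ^a (q r) = (Δ^a q) r`. -/
lemma leibnizCoeff_mul (E : R ≃ₐ[ℝ] R) (a : ℤ) (n : ℕ) (q r : R) :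
    leibnizCoeff E a n (q * r) = ∑ p ∈ Finset.HasAntidiagonal.antidiagonal n,
      leibnizCoeff E a p.1 q * leibnizCoeff E (a - p.1) p.2 r := by
  rw [leibnizCoeff_apply, map_mul, delta_pow_mul, Finset.smul_sum]
  refine Finset.sum_congr rfl fun p hp => ?_
  rw [Finset.HasAntidiagonal.mem_antidiagonal] at hp
  have h1 := Ring.choose_smul_choose a (n := n) (k := p.1) (by omega)
  have h2 : n - p.1 = p.2 := by omega
  rw [h2] at h1
  have h3 : (E ^ (p.2 : ℤ)) ((E ^ (a - n)) q) = (E ^ (a - p.1)) q := by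
    rw [← AlgEquiv.mul_apply, ← zpow_add]
    congr 2; rw [← hp]; push_cast; ring
  have h4 : a - p.1 - p.2 = a - (n : ℤ) := by rw [← hp]; push_cast; ring
  rw [leibnizCoeff_apply, leibnizCoeff_apply, h3, h4, smul_mul_smul_comm, ← h1, smul_assoc,
    smul_comm]

lemma leibnizCoeff_algebraMap (E : R ≃ₐ[ℝ] R) (a : ℤ) {i : ℕ} (hi : i ≠ 0) (c : ℝ) :
    leibnizCoeff E a i (algebraMap ℝ R c) = 0 := by
  obtain ⟨j, rfl⟩ := Nat.exists_eq_succ_of_ne_zero hi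
  rw [leibnizCoeff_apply, AlgEquiv.commutes, pow_succ, Module.End.mul_apply, delta_apply,
    AlgEquiv.commutes, sub_self, map_zero, smul_zero]

lemma leibnizCoeff_zero_left (E : R ≃ₐ[ℝ] R) {i : ℕ} (hi : i ≠ 0) (f : R) :
    leibnizCoeff E 0 i f = 0 := by
  rw [leibnizCoeff_apply, Ring.choose_zero_pos ℤ (Nat.pos_of_ne_zero hi), zero_smul]

lemma choose_natCast_of_lt {a i : ℕ} (h : a < i) : Ring.choose (a : ℤ) i = 0 := by
  rw [Ring.choose_natCast, Nat.choose_eq_zero_of_lt h, Nat.cast_zero]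

/-! ## The ring of pseudo-difference operators -/

/-- Pseudo-difference operators `∑_{j ≤ M} p_j Δ^j` with coefficients in `R`. -/
@[ext] structure PDO (E : R ≃ₐ[ℝ] R) where
  coeff : ℤ → R
  bdd : ∃ M : ℤ, ∀ j, M < j → coeff j = 0

variable {E : R ≃ₐ[ℝ] R}

namespace PDO

instance : CoeFun (PDO E) (fun _ => ℤ → R) := ⟨PDO.coeff⟩

lemma ext' {P Q : PDO E} (h : ∀ j, P j = Q j) : P = Q := PDO.ext (funext h)

/-- `P` has order at most `k`. -/
def OrdLE (P : PDO E) (k : ℤ) : Prop := ∀ j, k < j → P j = 0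

lemma OrdLE.mono {P : PDO E} {k l : ℤ} (h : P.OrdLE k) (hkl : k ≤ l) : P.OrdLE l :=
  fun j hj => h j (by omega)

lemma exists_ordLE (P : PDO E) : ∃ M, P.OrdLE M := P.bdd

instance : Zero (PDO E) := ⟨⟨0, 0, fun _ _ => rfl⟩⟩
instance : Add (PDO E) := ⟨fun P Q => ⟨P.coeff + Q.coeff, by
  obtain ⟨M, hM⟩ := P.bdd
  obtain ⟨N, hN⟩ := Q.bdd
  refine ⟨max M N, fun j hj => ?_⟩
  simp [hM j (by omega), hN j (by omega)]⟩⟩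
instance : Neg (PDO E) := ⟨fun P => ⟨-P.coeff, by
  obtain ⟨M, hM⟩ := P.bdd
  exact ⟨M, fun j hj => by simp [hM j hj]⟩⟩⟩
instance : Sub (PDO E) := ⟨fun P Q => ⟨P.coeff - Q.coeff, by
  obtain ⟨M, hM⟩ := P.bdd
  obtain ⟨N, hN⟩ := Q.bdd
  refine ⟨max M N, fun j hj => ?_⟩
  simp [hM j (by omega), hN j (by omega)]⟩⟩
instance {S : Type*} [SMulZeroClass S R] : SMul S (PDO E) := ⟨fun c P => ⟨c • P.coeff, by
  obtain ⟨M, hM⟩ := P.bdd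
  exact ⟨M, fun j hj => by simp [hM j hj]⟩⟩⟩

instance : AddCommGroup (PDO E) :=
  Function.Injective.addCommGroup PDO.coeff (fun _ _ h => PDO.ext h) rfl (fun _ _ => rfl)
    (fun _ => rfl) (fun _ _ => rfl) (fun _ _ => rfl) (fun _ _ => rfl)

/-- The coefficient sequence, as an additive map. -/
def coeffHom : PDO E →+ (ℤ → R) where
  toFun := PDO.coeff
  map_zero' := rfl
  map_add' _ _ := rfl

instance : Module ℝ (PDO E) :=
  Function.Injective.module ℝ coeffHom (fun _ _ h => PDO.ext h) (fun _ _ => rfl)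

@[simp] lemma zero_coeff (j : ℤ) : (0 : PDO E) j = 0 := rfl
@[simp] lemma add_coeff (P Q : PDO E) (j : ℤ) : (P + Q) j = P j + Q j := rfl
@[simp] lemma sub_coeff (P Q : PDO E) (j : ℤ) : (P - Q) j = P j - Q j := rfl
@[simp] lemma neg_coeff (P : PDO E) (j : ℤ) : (-P) j = -P j := rfl
@[simp] lemma smul_coeff (c : ℝ) (P : PDO E) (j : ℤ) : (c • P) j = c • P j := rfl

lemma sum_coeff {ι : Type*} (s : Finset ι) (P : ι → PDO E) (j : ℤ) :
    (∑ i ∈ s, P i) j = ∑ i ∈ s, P i j := by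
  have := congrFun (map_sum (coeffHom (E := E)) P s) j
  rw [Finset.sum_apply] at this
  exact this

lemma OrdLE.add {P Q : PDO E} {k : ℤ} (hP : P.OrdLE k) (hQ : Q.OrdLE k) : (P + Q).OrdLE k :=
  fun j hj => by simp [hP j hj, hQ j hj]
lemma OrdLE.sub {P Q : PDO E} {k : ℤ} (hP : P.OrdLE k) (hQ : Q.OrdLE k) : (P - Q).OrdLE k :=
  fun j hj => by simp [hP j hj, hQ j hj]
lemma OrdLE.smul {P : PDO E} {k : ℤ} (c : ℝ) (hP : P.OrdLE k) : (c • P).OrdLE k :=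
  fun j hj => by simp [hP j hj]
lemma ordLE_zero (k : ℤ) : (0 : PDO E).OrdLE k := fun _ _ => rfl

/-- The operator `p Δ^a`. -/
def single (a : ℤ) (p : R) : PDO E :=
  ⟨Pi.single a p, a, fun j hj => Pi.single_eq_of_ne (M := fun _ => R) (show j ≠ a by omega) p⟩

lemma single_coeff (a : ℤ) (p : R) (j : ℤ) :
    (single a p : PDO E) j = if j = a then p else 0 := by
  simp [single, Pi.single_apply]

@[simp] lemma single_coeff_self (a : ℤ) (p : R) : (single a p : PDO E) a = p := by
  simp [single_coeff]

lemma single_coeff_ne {a j : ℤ} (p : R) (h : j ≠ a) : (single a p : PDO E) j = 0 := by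
  simp [single_coeff, h]

lemma ordLE_single (a : ℤ) (p : R) : (single a p : PDO E).OrdLE a :=
  fun _ hj => single_coeff_ne p (by omega)

lemma single_add (a : ℤ) (p q : R) : (single a (p + q) : PDO E) = single a p + single a q :=
  ext' fun j => by simp only [single_coeff, add_coeff]; split_ifs <;> simp

lemma single_sub (a : ℤ) (p q : R) : (single a (p - q) : PDO E) = single a p - single a q :=
  ext' fun j => by simp only [single_coeff, sub_coeff]; split_ifs <;> simp

@[simp] lemma single_zero (a : ℤ) : (single a 0 : PDO E) = 0 :=
  ext' fun j => by simp [single_coeff]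

lemma smul_single (c : ℝ) (a : ℤ) (p : R) : c • (single a p : PDO E) = single a (c • p) :=
  ext' fun j => by simp only [single_coeff, smul_coeff]; split_ifs <;> simp

/-- The coefficients of the product of the operators with coefficients `P` and `Q`. -/
def mulCoeff (E : R ≃ₐ[ℝ] R) (P Q : ℤ → R) (k : ℤ) : R :=
  ∑ᶠ a : ℤ, ∑ᶠ i : ℕ, P a * leibnizCoeff E a i (Q (k - a + i))

/-- A nonzero term needs `a ≤ p` and `k - a + i ≤ q`, hence `k - q ≤ a ≤ p` and `i ≤ p + q - k`. The
index set `A` and the bound `N` are left free so that different products can be expanded over a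
common range. -/
lemma mulCoeff_eq_sum {P Q : ℤ → R} {k p q : ℤ} (hP : ∀ j, p < j → P j = 0)
    (hQ : ∀ j, q < j → Q j = 0) {A : Finset ℤ} (hA : Finset.Icc (k - q) p ⊆ A) {N : ℕ}
    (hN : p + q - k < N) :
    mulCoeff E P Q k =
      ∑ a ∈ A, ∑ i ∈ Finset.range N, P a * leibnizCoeff E a i (Q (k - a + i)) := by
  have h0 : ∀ (a : ℤ) (i : ℕ), a ≤ p → N ≤ i → Q (k - a + i) = 0 := fun a i ha hi =>
    hQ _ (by omega)
  rw [mulCoeff, finsum_eq_sum_of_support_subset (s := A)]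
  · refine Finset.sum_congr rfl fun a _ => ?_
    rw [finsum_eq_sum_of_support_subset (s := Finset.range N)]
    intro i hi
    by_contra hi'
    simp only [Finset.coe_range, Set.mem_Iio, not_lt] at hi'
    apply hi
    by_cases ha : a ≤ p
    · simp [h0 a i ha hi']
    · simp [hP a (by omega)]
  · intro a ha
    by_contra hA'
    apply ha
    have : ∀ i : ℕ, P a * leibnizCoeff E a i (Q (k - a + i)) = 0 := by
      intro i
      by_cases h1 : p < a
      · simp [hP a h1]
      · have : a ∉ Finset.Icc (k - q) p := fun h => hA' (hA h)
        rw [Finset.mem_Icc] at this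
        rw [hQ _ (by omega)]; simp
    simp [this]

lemma mulCoeff_eq_zero {P Q : ℤ → R} {k p q : ℤ} (hP : ∀ j, p < j → P j = 0)
    (hQ : ∀ j, q < j → Q j = 0) (hk : p + q < k) : mulCoeff E P Q k = 0 := by
  rw [mulCoeff_eq_sum hP hQ (A := ∅) (N := 0) (by rw [Finset.Icc_eq_empty (by omega)])
    (by push_cast; omega)]
  simp

instance : Mul (PDO E) := ⟨fun P Q => ⟨mulCoeff E P Q, by
  obtain ⟨p, hp⟩ := P.bdd
  obtain ⟨q, hq⟩ := Q.bdd
  exact ⟨p + q, fun j hj => mulCoeff_eq_zero hp hq hj⟩⟩⟩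

lemma mul_coeff (P Q : PDO E) (k : ℤ) : (P * Q) k = mulCoeff E P Q k := rfl

lemma OrdLE.mul {P Q : PDO E} {p q : ℤ} (hP : P.OrdLE p) (hQ : Q.OrdLE q) :
    (P * Q).OrdLE (p + q) := fun _ hj => mulCoeff_eq_zero hP hQ hj

lemma mul_coeff_eq_sum {P Q : PDO E} {p q : ℤ} (hP : P.OrdLE p) (hQ : Q.OrdLE q) (k : ℤ) {N : ℕ}
    (hN : p + q - k < N) :
    (P * Q) k = ∑ a ∈ Finset.Icc (k - q) p, ∑ i ∈ Finset.range N,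
      P a * leibnizCoeff E a i (Q (k - a + i)) :=
  mulCoeff_eq_sum hP hQ subset_rfl hN

lemma mul_coeff_top {P Q : PDO E} {p q : ℤ} (hP : P.OrdLE p) (hQ : Q.OrdLE q) :
    (P * Q) (p + q) = P p * (E ^ p) (Q q) := by
  rw [mul_coeff_eq_sum hP hQ (p + q) (N := 1) (by omega)]
  simp [leibnizCoeff_zero]

instance : NonUnitalNonAssocRing (PDO E) where
  zero_mul P := ext' fun k => by simp [mul_coeff, mulCoeff]
  mul_zero P := ext' fun k => by simp [mul_coeff, mulCoeff]
  left_distrib P Q S := ext' fun k => by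
    obtain ⟨p, hp⟩ := P.exists_ordLE
    obtain ⟨q, hq⟩ := Q.exists_ordLE
    obtain ⟨s, hs⟩ := S.exists_ordLE
    have hq := hq.mono (le_max_left q s)
    have hs := hs.mono (le_max_right q s)
    have hN : p + max q s - k < (p + max q s - k + 1).toNat := by omega
    rw [add_coeff, mul_coeff_eq_sum hp (hq.add hs) k hN, mul_coeff_eq_sum hp hq k hN,
      mul_coeff_eq_sum hp hs k hN]
    simp only [add_coeff, map_add, mul_add, Finset.sum_add_distrib]
  right_distrib P Q S := ext' fun k => by
    obtain ⟨p, hp⟩ := P.exists_ordLE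
    obtain ⟨q, hq⟩ := Q.exists_ordLE
    obtain ⟨s, hs⟩ := S.exists_ordLE
    have hp := hp.mono (le_max_left p q)
    have hq := hq.mono (le_max_right p q)
    have hN : max p q + s - k < (max p q + s - k + 1).toNat := by omega
    rw [add_coeff, mul_coeff_eq_sum (hp.add hq) hs k hN, mul_coeff_eq_sum hp hs k hN,
      mul_coeff_eq_sum hq hs k hN]
    simp only [add_coeff, add_mul, Finset.sum_add_distrib]

/-- A finite sum of monomials approximates an operator up to arbitrarily low order. -/
lemma exists_sum_single (P : PDO E) (T : ℤ) :
    ∃ s : Finset ℤ, (P - ∑ a ∈ s, single a (P a)).OrdLE T := by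
  obtain ⟨M, hM⟩ := P.exists_ordLE
  refine ⟨Finset.Ioc T M, fun j hj => ?_⟩
  rw [sub_coeff, sum_coeff]
  by_cases h : j ∈ Finset.Ioc T M
  · rw [Finset.sum_eq_single j (fun b _ hb => single_coeff_ne _ hb.symm) (fun h' => absurd h h')]
    simp
  · rw [Finset.sum_eq_zero]
    · rw [Finset.mem_Ioc] at h
      simp [hM j (by omega)]
    · intro a ha
      exact single_coeff_ne _ (by rintro rfl; exact h ha)

/-- An additive map which is bounded with respect to the order and vanishes on monomials is zero. -/
lemma eq_zero_of_single {E' : R ≃ₐ[ℝ] R} (φ : PDO E →+ PDO E') (c : ℤ)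
    (hφ : ∀ (k : ℤ) (P : PDO E), P.OrdLE k → (φ P).OrdLE (k + c))
    (h : ∀ (a : ℤ) (p : R), φ (single a p) = 0) (P : PDO E) : φ P = 0 := by
  refine ext' fun k => ?_
  obtain ⟨s, hs⟩ := P.exists_sum_single (k - c - 1)
  have h1 := hφ _ _ hs k (by omega)
  rw [map_sub, map_sum, Finset.sum_eq_zero fun a _ => h a _, sub_zero] at h1
  simpa using h1

lemma single_mul_coeff (a : ℤ) (p : R) {Q : PDO E} {q : ℤ} (hQ : Q.OrdLE q) (k : ℤ) {N : ℕ}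
    (hN : a + q - k < N) :
    (single a p * Q : PDO E) k = ∑ i ∈ Finset.range N, p * leibnizCoeff E a i (Q (k - a + i)) := by
  rw [mul_coeff, mulCoeff_eq_sum (ordLE_single a p) hQ
    (Finset.subset_insert a (Finset.Icc (k - q) a)) hN]
  rw [Finset.sum_eq_single a]
  · simp
  · intro b _ hb
    simp [single_coeff_ne p hb]
  · simp

lemma single_mul_single_coeff (a b : ℤ) (p q : R) (i : ℕ) :
    (single a p * single b q : PDO E) (a + b - i) = p * leibnizCoeff E a i q := by
  rw [single_mul_coeff a p (ordLE_single b q) (N := i + 1) _ (by push_cast; omega),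
    Finset.sum_eq_single i]
  · rw [show a + b - (i : ℤ) - a + i = b by ring, single_coeff_self]
  · intro j _ hj
    rw [single_coeff_ne q (by omega)]; simp
  · simp

lemma single_mul_single_ordLE (a b : ℤ) (p q : R) :
    (single a p * single b q : PDO E).OrdLE (a + b) :=
  (ordLE_single a p).mul (ordLE_single b q)

/-- At order `a + b + c - n` the left side is expanded by `leibnizCoeff_add` and the right side by
`leibnizCoeff_mul`; the same terms appear, grouped differently. -/
lemma single_assoc (a b c : ℤ) (p q r : R) :
    (single a p * single b q * single c r : PDO E) = single a p * (single b q * single c r) := by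
  have h1 : (single a p * single b q * single c r : PDO E).OrdLE (a + b + c) :=
    (single_mul_single_ordLE a b p q).mul (ordLE_single c r)
  have h2 : (single a p * (single b q * single c r) : PDO E).OrdLE (a + b + c) :=
    ((ordLE_single a p).mul (single_mul_single_ordLE b c q r)).mono (by omega)
  refine ext' fun k => ?_
  by_cases hk : a + b + c < k
  · rw [h1 k hk, h2 k hk]
  obtain ⟨n, rfl⟩ : ∃ n : ℕ, k = a + b + c - n := ⟨(a + b + c - k).toNat, by omega⟩
  have hL : (single a p * single b q * single c r : PDO E) (a + b + c - n) =
      ∑ x ∈ Finset.HasAntidiagonal.antidiagonal n,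
        p * leibnizCoeff E a x.1 q * leibnizCoeff E (a + b - x.1) x.2 r := by
    have he : Function.Injective (fun i : ℕ => a + b - (i : ℤ)) := fun i j h => by
      simpa using h
    rw [mul_coeff, mulCoeff_eq_sum (single_mul_single_ordLE a b p q) (ordLE_single c r)
      (A := (Finset.range (n + 1)).image (fun i : ℕ => a + b - (i : ℤ)))
      (N := n + 1) ?_ (by push_cast; omega), Finset.sum_image he.injOn,
      Finset.Nat.sum_antidiagonal_eq_sum_range_succ_mk]
    · refine Finset.sum_congr rfl fun i hi => ?_
      rw [Finset.mem_range] at hi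
      rw [Finset.sum_eq_single (n - i)]
      · rw [single_mul_single_coeff,
          show (a + b + c - n - (a + b - i) + ((n - i : ℕ) : ℤ)) = c by omega, single_coeff_self]
      · intro j _ hj
        rw [single_coeff_ne r (by omega)]; simp
      · intro h; exact absurd (Finset.mem_range.2 (by omega)) h
    · intro j hj
      rw [Finset.mem_Icc] at hj
      rw [Finset.mem_image]
      exact ⟨(a + b - j).toNat, by rw [Finset.mem_range]; omega, by omega⟩
  rw [hL, single_mul_coeff a p (single_mul_single_ordLE b c q r) (N := n + 1) _
    (by push_cast; omega)]
  have hR : ∀ i ∈ Finset.range (n + 1),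
      p * leibnizCoeff E a i ((single b q * single c r : PDO E) (a + b + c - n - a + i)) =
      ∑ y ∈ Finset.HasAntidiagonal.antidiagonal i, p * (leibnizCoeff E a y.1 q *
        leibnizCoeff E (a - y.1) y.2 (leibnizCoeff E b (n - i) r)) := by
    intro i hi
    rw [Finset.mem_range] at hi
    rw [show (a + b + c - n - a + i : ℤ) = b + c - ((n - i : ℕ) : ℤ) by omega,
      single_mul_single_coeff, leibnizCoeff_mul, Finset.mul_sum]
  rw [Finset.sum_congr rfl hR,
    ← Finset.Nat.sum_antidiagonal_eq_sum_range_succ_mk (fun x => ∑ y ∈ Finset.HasAntidiagonal.antidiagonal x.1,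
      p * (leibnizCoeff E a y.1 q * leibnizCoeff E (a - y.1) y.2 (leibnizCoeff E b x.2 r)))]
  have hA : ∀ x ∈ Finset.HasAntidiagonal.antidiagonal n,
      p * leibnizCoeff E a x.1 q * leibnizCoeff E (a + b - x.1) x.2 r =
      ∑ y ∈ Finset.HasAntidiagonal.antidiagonal x.2, p * (leibnizCoeff E a x.1 q *
        leibnizCoeff E (a - x.1) y.1 (leibnizCoeff E b y.2 r)) := by
    intro x _
    rw [show a + b - (x.1 : ℤ) = a - x.1 + b by ring, leibnizCoeff_add, LinearMap.sum_apply,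
      Finset.mul_sum]
    simp only [Module.End.mul_apply, mul_assoc]
  rw [Finset.sum_congr rfl hA, Finset.sum_sigma', Finset.sum_sigma']
  -- Triples `(i, k, l)` with sum `n`, grouped as `i + (k + l)` on the left and as `(i + k) + l` on
  -- the right.
  refine Finset.sum_nbij' (fun x => ⟨(x.1.1 + x.2.1, x.2.2), (x.1.1, x.2.1)⟩)
    (fun x => ⟨(x.2.1, x.2.2 + x.1.2), (x.2.2, x.1.2)⟩) ?_ ?_ ?_ ?_ ?_
  · rintro ⟨⟨i, j⟩, ⟨k, l⟩⟩ h
    simp only [Finset.mem_sigma, Finset.HasAntidiagonal.mem_antidiagonal] at h ⊢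
    exact ⟨by omega, by trivial⟩
  · rintro ⟨⟨i, j⟩, ⟨k, l⟩⟩ h
    simp only [Finset.mem_sigma, Finset.HasAntidiagonal.mem_antidiagonal] at h ⊢
    exact ⟨by omega, by trivial⟩
  · rintro ⟨⟨i, j⟩, ⟨k, l⟩⟩ h
    simp only [Finset.mem_sigma, Finset.HasAntidiagonal.mem_antidiagonal] at h
    obtain ⟨_, rfl⟩ := h
    rfl
  · rintro ⟨⟨i, j⟩, ⟨k, l⟩⟩ h
    simp only [Finset.mem_sigma, Finset.HasAntidiagonal.mem_antidiagonal] at h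
    obtain ⟨_, rfl⟩ := h
    rfl
  · rintro ⟨⟨i, j⟩, ⟨k, l⟩⟩ h
    rfl

/-- The associator is additive in each argument and shifts orders by a bounded amount, so
`eq_zero_of_single` reduces one argument after another to monomials. -/
lemma mul_assoc_aux (P Q S : PDO E) : P * Q * S = P * (Q * S) := by
  have ord : ∀ {P Q S : PDO E} {p q s : ℤ}, P.OrdLE p → Q.OrdLE q → S.OrdLE s →
      (associator P Q S).OrdLE (p + q + s) := fun hP hQ hS =>
    ((hP.mul hQ).mul hS).sub ((hP.mul (hQ.mul hS)).mono (by omega))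
  have h1 : ∀ (a b : ℤ) (p q : R) (S : PDO E), associator (single a p) (single b q) S = 0 := by
    intro a b p q
    refine eq_zero_of_single (AddMonoidHom.associator (single a p) (single b q)) (a + b)
      (fun k P hP => ?_) fun c r => ?_
    · exact (ord (ordLE_single a p) (ordLE_single b q) hP).mono (by omega)
    · exact sub_eq_zero.2 (single_assoc a b c p q r)
  have h2 : ∀ (a : ℤ) (p : R) (Q S : PDO E), associator (single a p) Q S = 0 := by
    intro a p Q S
    obtain ⟨s, hs⟩ := S.exists_ordLE
    refine eq_zero_of_single ((AddMonoidHom.associator (single a p)).flip S) (a + s)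
      (fun k P hP => ?_) (fun b q => h1 a b p q S) Q
    exact (ord (ordLE_single a p) hP hs).mono (by omega)
  obtain ⟨s, hs⟩ := S.exists_ordLE
  obtain ⟨q, hq⟩ := Q.exists_ordLE
  refine sub_eq_zero.1 (eq_zero_of_single
    ((AddMonoidHom.associator (R := PDO E)).flip Q |>.flip S) (q + s)
    (fun k P hP => ?_) (fun b p => h2 b p Q S) P)
  exact (ord hP hq hs).mono (by omega)

instance : One (PDO E) := ⟨single 0 1⟩

lemma one_def : (1 : PDO E) = single 0 1 := rfl

lemma single_zero_mul_coeff (p : R) (Q : PDO E) (k : ℤ) : (single 0 p * Q : PDO E) k = p * Q k := by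
  obtain ⟨q, hq⟩ := Q.exists_ordLE
  rw [single_mul_coeff 0 p hq (N := (0 + q - k + 1).toNat + 1) k (by omega), Finset.sum_eq_single 0]
  · simp [leibnizCoeff_zero]
  · intro i _ hi
    rw [leibnizCoeff_zero_left E hi, mul_zero]
  · simp

lemma single_mul_single_const (a b : ℤ) (p : R) (c : ℝ) :
    (single a p * single b (algebraMap ℝ R c) : PDO E) = single (a + b) (c • p) := by
  refine ext' fun k => ?_
  by_cases hk : a + b < k
  · rw [single_mul_single_ordLE a b _ _ k hk, single_coeff_ne _ (by omega)]
  obtain ⟨n, rfl⟩ : ∃ n : ℕ, k = a + b - n := ⟨(a + b - k).toNat, by omega⟩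
  rw [single_mul_single_coeff]
  by_cases hn : n = 0
  · subst hn
    simp [leibnizCoeff_zero, Algebra.smul_def, mul_comm]
  · rw [leibnizCoeff_algebraMap E a hn, single_coeff_ne _ (by omega), mul_zero]

instance : Ring (PDO E) :=
  { (inferInstance : NonUnitalNonAssocRing (PDO E)), (inferInstance : One (PDO E)) with
  mul_assoc := mul_assoc_aux
  one_mul P := ext' fun k => by rw [one_def, single_zero_mul_coeff, one_mul]
  mul_one P := by
    obtain ⟨q, hq⟩ := P.exists_ordLE
    have := eq_zero_of_single (AddMonoidHom.mulRight (1 : PDO E) - AddMonoidHom.id _) 0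
      (fun k P hP => ((hP.mul (ordLE_single 0 1)).sub (hP.mono (by omega))))
      (fun a p => by
        have := single_mul_single_const (E := E) a 0 p 1
        rw [map_one, one_smul, add_zero, ← one_def] at this
        simp [this]) P
    simpa [sub_eq_zero] using this }

instance : Algebra ℝ (PDO E) := Algebra.ofModule
  (fun c P Q => ext' fun k => by
    have : c • P = single 0 (c • (1 : R)) * P :=
      ext' fun j => by rw [single_zero_mul_coeff]; simp
    have h2 : c • (P * Q) = single 0 (c • (1 : R)) * (P * Q) :=
      ext' fun j => by rw [single_zero_mul_coeff]; simp
    rw [this, h2, mul_assoc])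
  (fun c P Q => ext' fun k => by
    rw [smul_coeff, mul_coeff, mul_coeff]
    obtain ⟨p, hp⟩ := P.exists_ordLE
    obtain ⟨q, hq⟩ := Q.exists_ordLE
    have hN : p + q - k < (p + q - k + 1).toNat := by omega
    rw [← mul_coeff, ← mul_coeff, mul_coeff_eq_sum hp hq k hN,
      mul_coeff_eq_sum hp (hq.smul c) k hN]
    simp only [smul_coeff, map_smul, mul_smul_comm, Finset.smul_sum])

/-! ### Subspaces of operators -/

/-- All coefficients of `P` lie in the ideal `I`. -/
def CoeffIn (I : Ideal R) (P : PDO E) : Prop := ∀ j, P j ∈ I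

/-- `P` is a polynomial in `Δ` without constant term. -/
def PosPart (P : PDO E) : Prop := ∀ j, j < 1 → P j = 0

section CoeffIn
variable {I : Ideal R} {P Q : PDO E}

lemma CoeffIn.add (hP : P.CoeffIn I) (hQ : Q.CoeffIn I) : (P + Q).CoeffIn I :=
  fun j => I.add_mem (hP j) (hQ j)
lemma CoeffIn.sub (hP : P.CoeffIn I) (hQ : Q.CoeffIn I) : (P - Q).CoeffIn I :=
  fun j => I.sub_mem (hP j) (hQ j)
lemma CoeffIn.smul (c : ℝ) (hP : P.CoeffIn I) : (c • P).CoeffIn I :=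
  fun j => by rw [smul_coeff, Algebra.smul_def]; exact I.mul_mem_left _ (hP j)
lemma coeffIn_zero : (0 : PDO E).CoeffIn I := fun _ => I.zero_mem

lemma coeffIn_single {a : ℤ} {p : R} (h : p ∈ I) : (single a p : PDO E).CoeffIn I := fun j => by
  rw [single_coeff]; split_ifs
  exacts [h, I.zero_mem]

lemma CoeffIn.mul_right (hP : P.CoeffIn I) (Q : PDO E) : (P * Q).CoeffIn I := fun k => by
  obtain ⟨p, hp⟩ := P.exists_ordLE
  obtain ⟨q, hq⟩ := Q.exists_ordLE
  rw [mul_coeff_eq_sum hp hq k (N := (p + q - k + 1).toNat) (by omega)]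
  exact I.sum_mem fun a _ => I.sum_mem fun i _ => I.mul_mem_right _ (hP a)

lemma leibnizCoeff_mem (hE : ∀ f ∈ I, E f ∈ I) (hE' : ∀ f ∈ I, E.symm f ∈ I) (a : ℤ) (i : ℕ)
    {f : R} (hf : f ∈ I) : leibnizCoeff E a i f ∈ I := by
  have h1 : ∀ n : ℕ, ∀ f ∈ I, (E ^ (n : ℤ)) f ∈ I ∧ (E ^ (-n : ℤ)) f ∈ I := by
    intro n
    induction n with
    | zero => simp
    | succ n ih =>
      intro f hf
      constructor
      · rw [Nat.cast_succ, zpow_add_one, AlgEquiv.mul_apply]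
        exact (ih _ (hE f hf)).1
      · rw [Nat.cast_succ, neg_add, ← sub_eq_add_neg, zpow_sub_one, AlgEquiv.mul_apply]
        exact (ih _ (hE' f hf)).2
  have h2 : ∀ (b : ℤ), ∀ f ∈ I, (E ^ b) f ∈ I := by
    intro b f hf
    obtain ⟨n, rfl | rfl⟩ := b.eq_nat_or_neg
    exacts [(h1 n f hf).1, (h1 n f hf).2]
  have h3 : ∀ n : ℕ, ∀ f ∈ I, (delta E ^ n) f ∈ I := by
    intro n
    induction n with
    | zero => simp
    | succ n ih =>
      intro f hf
      rw [pow_succ, Module.End.mul_apply, delta_apply]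
      exact ih _ (I.sub_mem (hE f hf) hf)
  rw [leibnizCoeff_apply]
  exact zsmul_mem (h3 i _ (h2 _ f hf)) _

lemma CoeffIn.mul_left (hE : ∀ f ∈ I, E f ∈ I) (hE' : ∀ f ∈ I, E.symm f ∈ I) (P : PDO E)
    (hQ : Q.CoeffIn I) : (P * Q).CoeffIn I := fun k => by
  obtain ⟨p, hp⟩ := P.exists_ordLE
  obtain ⟨q, hq⟩ := Q.exists_ordLE
  rw [mul_coeff_eq_sum hp hq k (N := (p + q - k + 1).toNat) (by omega)]
  exact I.sum_mem fun a _ => I.sum_mem fun i _ =>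
    I.mul_mem_left _ (leibnizCoeff_mem hE hE' a i (hQ _))

lemma PosPart.add (hP : P.PosPart) (hQ : Q.PosPart) : (P + Q).PosPart :=
  fun j hj => by simp [hP j hj, hQ j hj]
lemma PosPart.sub (hP : P.PosPart) (hQ : Q.PosPart) : (P - Q).PosPart :=
  fun j hj => by simp [hP j hj, hQ j hj]
lemma PosPart.smul (c : ℝ) (hP : P.PosPart) : (c • P).PosPart :=
  fun j hj => by simp [hP j hj]
lemma posPart_single {a : ℤ} (ha : 1 ≤ a) (p : R) : (single a p : PDO E).PosPart :=
  fun j hj => single_coeff_ne p (by omega)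

/-- For `a ≥ 1` the coefficient `C(a, i)` vanishes when `i > a`, so moving `Δ^a` past a coefficient
of `Δ^b` never lowers the exponent below `b`. -/
lemma PosPart.mul (hP : P.PosPart) (hQ : Q.PosPart) : (P * Q).PosPart := fun k hk => by
  obtain ⟨p, hp⟩ := P.exists_ordLE
  obtain ⟨q, hq⟩ := Q.exists_ordLE
  rw [mul_coeff_eq_sum hp hq k (N := (p + q - k + 1).toNat) (by omega)]
  refine Finset.sum_eq_zero fun a _ => Finset.sum_eq_zero fun i _ => ?_
  by_cases ha : a < 1
  · rw [hP a ha, zero_mul]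
  by_cases hi : a < i
  · lift a to ℕ using by omega
    rw [leibnizCoeff_apply, choose_natCast_of_lt (by omega), zero_smul, mul_zero]
  · rw [hQ _ (by omega), map_zero, mul_zero]

/-- The part of `P` with the powers `Δ^j`, `j ≥ k`. -/
def hiPart (k : ℤ) (P : PDO E) : PDO E := ⟨fun j => if k ≤ j then P j else 0, by
  obtain ⟨p, hp⟩ := P.exists_ordLE
  exact ⟨p, fun j hj => by simp [hp j hj]⟩⟩

lemma hiPart_coeff (k : ℤ) (P : PDO E) (j : ℤ) : hiPart k P j = if k ≤ j then P j else 0 := rfl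

lemma posPart_hiPart (P : PDO E) : (hiPart 1 P).PosPart := fun j hj => by
  rw [hiPart_coeff, if_neg (by omega)]

lemma sub_hiPart_ordLE {k l : ℤ} (hkl : k = l + 1) (P : PDO E) : (P - hiPart k P).OrdLE l :=
  fun j hj => by rw [sub_coeff, hiPart_coeff, if_pos (by omega), sub_self]

end CoeffIn

/-! ### Coefficientwise maps -/

section Map
variable {R' : Type*} [CommRing R'] [Algebra ℝ R'] {E' : R' ≃ₐ[ℝ] R'}

/-- Apply an additive map to all coefficients. -/
def mapC (E' : R' ≃ₐ[ℝ] R') (φ : R →ₗ[ℝ] R') (P : PDO E) : PDO E' :=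
  ⟨fun j => φ (P j), by
    obtain ⟨p, hp⟩ := P.exists_ordLE
    exact ⟨p, fun j hj => by rw [hp j hj, map_zero]⟩⟩

@[simp] lemma mapC_coeff (φ : R →ₗ[ℝ] R') (P : PDO E) (j : ℤ) : mapC E' φ P j = φ (P j) := rfl

lemma OrdLE.map (φ : R →ₗ[ℝ] R') {P : PDO E} {k : ℤ} (hP : P.OrdLE k) : (mapC E' φ P).OrdLE k :=
  fun j hj => by rw [mapC_coeff, hP j hj, map_zero]

lemma PosPart.map (φ : R →ₗ[ℝ] R') {P : PDO E} (hP : P.PosPart) : (mapC E' φ P).PosPart :=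
  fun j hj => by rw [mapC_coeff, hP j hj, map_zero]

lemma mapC_single (φ : R →ₗ[ℝ] R') (a : ℤ) (p : R) :
    mapC E' φ (single a p : PDO E) = single a (φ p) :=
  ext' fun j => by simp only [mapC_coeff, single_coeff]; split_ifs <;> simp

lemma mapC_add (φ : R →ₗ[ℝ] R') (P Q : PDO E) : mapC E' φ (P + Q) = mapC E' φ P + mapC E' φ Q :=
  ext' fun j => by simp
lemma mapC_smul (φ : R →ₗ[ℝ] R') (c : ℝ) (P : PDO E) : mapC E' φ (c • P) = c • mapC E' φ P :=
  ext' fun j => by simp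

lemma mapC_leibnizCoeff (φ : R →ₗ[ℝ] R') (hφ : ∀ f, φ (E f) = E' (φ f)) (a : ℤ) (i : ℕ) (f : R) :
    φ (leibnizCoeff E a i f) = leibnizCoeff E' a i (φ f) := by
  have h0 : ∀ f, φ (E.symm f) = E'.symm (φ f) := fun f => by
    rw [AlgEquiv.eq_symm_apply, ← hφ, AlgEquiv.apply_symm_apply]
  have h1 : ∀ (b : ℤ) (f : R), φ ((E ^ b) f) = (E' ^ b) (φ f) := by
    intro b
    induction b using Int.induction_on with
    | zero => simp
    | succ n ih => intro f; rw [zpow_add_one, zpow_add_one, AlgEquiv.mul_apply, ih, hφ]; rfl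
    | pred n ih =>
      intro f
      rw [zpow_sub_one, zpow_sub_one, AlgEquiv.mul_apply, ih]
      exact congrArg _ (h0 f)
  have h2 : ∀ (n : ℕ) (f : R), φ ((delta E ^ n) f) = (delta E' ^ n) (φ f) := by
    intro n
    induction n with
    | zero => simp
    | succ n ih =>
      intro f
      rw [pow_succ, pow_succ, Module.End.mul_apply, Module.End.mul_apply, ih, delta_apply,
        delta_apply, map_sub, hφ]
  rw [leibnizCoeff_apply, leibnizCoeff_apply, map_zsmul, h2, h1]

/-- A derivation along an algebra homomorphism, compatible with the shifts, acts coefficientwise as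
a derivation. -/
lemma mapC_mul_of_leibniz (δ φ ψ : R →ₗ[ℝ] R') (hφ : ∀ f, φ (E f) = E' (φ f))
    (hδ : ∀ f, δ (E f) = E' (δ f))
    (h : ∀ f g, δ (f * g) = δ f * φ g + ψ f * δ g) (P Q : PDO E) :
    mapC E' δ (P * Q) = mapC E' δ P * mapC E' φ Q + mapC E' ψ P * mapC E' δ Q := by
  refine ext' fun k => ?_
  obtain ⟨p, hp⟩ := P.exists_ordLE
  obtain ⟨q, hq⟩ := Q.exists_ordLE
  have hN : p + q - k < (p + q - k + 1).toNat := by omega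
  rw [mapC_coeff, add_coeff, mul_coeff_eq_sum hp hq k hN, mul_coeff_eq_sum (hp.map δ) (hq.map φ) k hN,
    mul_coeff_eq_sum (hp.map ψ) (hq.map δ) k hN]
  simp only [map_sum, h, mapC_leibnizCoeff φ hφ, mapC_leibnizCoeff δ hδ, Finset.sum_add_distrib,
    mapC_coeff]

/-- Coefficientwise application of a linear map. -/
def mapLin (E' : R' ≃ₐ[ℝ] R') (φ : R →ₗ[ℝ] R') : PDO E →ₗ[ℝ] PDO E' where
  toFun := mapC E' φ
  map_add' := mapC_add _
  map_smul' := mapC_smul _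

/-- A homomorphism of coefficient algebras compatible with the shifts induces a homomorphism. -/
def mapHom (E' : R' ≃ₐ[ℝ] R') (φ : R →ₐ[ℝ] R') (hφ : ∀ f, φ (E f) = E' (φ f)) :
    PDO E →ₐ[ℝ] PDO E' :=
  AlgHom.ofLinearMap (mapLin E' φ.toLinearMap)
    (by
      change mapC E' φ.toLinearMap 1 = 1
      rw [one_def, mapC_single]; simp [one_def])
    (fun P Q => by
      refine ext' fun k => ?_
      obtain ⟨p, hp⟩ := P.exists_ordLE
      obtain ⟨q, hq⟩ := Q.exists_ordLE
      have hN : p + q - k < (p + q - k + 1).toNat := by omega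
      have h := mapC_leibnizCoeff (E := E) (E' := E') φ.toLinearMap hφ
      change mapC E' φ.toLinearMap (P * Q) k = (mapC E' φ.toLinearMap P * mapC E' φ.toLinearMap Q) k
      rw [mapC_coeff, mul_coeff_eq_sum hp hq k hN, mul_coeff_eq_sum (hp.map _) (hq.map _) k hN]
      simp only [map_sum, ← h, mapC_coeff]
      simp)

end Map

end PDO
end PseudoDiff

namespace PseudoDiff
open PDO Polynomial

/-! ## Abstract lattice differential algebras -/

/-- An algebra of lattice functions: a shift `E`, a commuting derivation `d`, and an ideal `I` of
decaying functions on which `E - 1` is bijective, together with coordinates `X`, `N` on the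
continuous and on the discrete line. -/
structure LatticeDiff (R : Type*) [CommRing R] [Algebra ℝ R] where
  E : R ≃ₐ[ℝ] R
  d : R →ₗ[ℝ] R
  I : Ideal R
  dInv : R → R
  xCoord : R
  nCoord : R
  d_mul : ∀ f g, d (f * g) = d f * g + f * d g
  d_E : ∀ f, d (E f) = E (d f)
  E_mem : ∀ f ∈ I, E f ∈ I
  E_symm_mem : ∀ f ∈ I, E.symm f ∈ I
  d_mem : ∀ f ∈ I, d f ∈ I
  dInv_mem : ∀ f ∈ I, dInv f ∈ I
  E_dInv : ∀ f ∈ I, E (dInv f) = dInv f + f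
  eq_zero : ∀ f ∈ I, E f = f → f = 0
  E_X : E xCoord = xCoord
  E_N : E nCoord = nCoord + 1
  d_X : d xCoord = 1
  d_N : d nCoord = 0

namespace LatticeDiff

variable {R : Type*} [CommRing R] [Algebra ℝ R] (Λ : LatticeDiff R)

lemma d_one : Λ.d 1 = 0 := by
  have := Λ.d_mul 1 1
  simpa using this

lemma d_algebraMap (c : ℝ) : Λ.d (algebraMap ℝ R c) = 0 := by
  rw [Algebra.algebraMap_eq_smul_one, map_smul, d_one, smul_zero]

lemma smul_mem (c : ℝ) {f : R} (hf : f ∈ Λ.I) : c • f ∈ Λ.I := by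
  rw [Algebra.smul_def]; exact Λ.I.mul_mem_left _ hf

lemma zpow_E_mem (a : ℤ) {f : R} (hf : f ∈ Λ.I) : (Λ.E ^ a) f ∈ Λ.I := by
  rw [← leibnizCoeff_zero]
  exact leibnizCoeff_mem Λ.E_mem Λ.E_symm_mem a 0 hf

lemma coeffIn_mul_left (P : PDO Λ.E) {Q : PDO Λ.E} (hQ : Q.CoeffIn Λ.I) : (P * Q).CoeffIn Λ.I :=
  CoeffIn.mul_left Λ.E_mem Λ.E_symm_mem P hQ

/-- The ideal of operators with coefficients in `I` is compatible with products. -/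
lemma coeffIn_mul_sub {P P' Q Q' : PDO Λ.E} (hP : (P - P').CoeffIn Λ.I)
    (hQ : (Q - Q').CoeffIn Λ.I) : (P * Q - P' * Q').CoeffIn Λ.I := by
  have : P * Q - P' * Q' = (P - P') * Q + P' * (Q - Q') := by noncomm_ring
  rw [this]
  exact (hP.mul_right Q).add (Λ.coeffIn_mul_left P' hQ)

lemma coeffIn_pow_sub {P P' : PDO Λ.E} (hP : (P - P').CoeffIn Λ.I) (n : ℕ) :
    (P ^ n - P' ^ n).CoeffIn Λ.I := by
  induction n with
  | zero => simpa using coeffIn_zero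
  | succ n ih =>
    rw [pow_succ, pow_succ]
    exact Λ.coeffIn_mul_sub ih hP

/-- The derivative of an operator with respect to the continuous variable. -/
def opD : PDO Λ.E →ₗ[ℝ] PDO Λ.E := mapLin Λ.E Λ.d

@[simp] lemma opD_coeff (P : PDO Λ.E) (j : ℤ) : Λ.opD P j = Λ.d (P j) := rfl

lemma opD_mul (P Q : PDO Λ.E) : Λ.opD (P * Q) = Λ.opD P * Q + P * Λ.opD Q := by
  have := mapC_mul_of_leibniz (E := Λ.E) (E' := Λ.E) Λ.d LinearMap.id LinearMap.id (fun _ => rfl)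
    Λ.d_E (by simpa using Λ.d_mul) P Q
  exact this

lemma opD_single (a : ℤ) (p : R) : Λ.opD (single a p) = single a (Λ.d p) := mapC_single _ _ _

lemma opD_ordLE {P : PDO Λ.E} {k : ℤ} (h : P.OrdLE k) : (Λ.opD P).OrdLE k := h.map _

lemma opD_coeffIn {P : PDO Λ.E} (h : P.CoeffIn Λ.I) : (Λ.opD P).CoeffIn Λ.I :=
  fun j => Λ.d_mem _ (h j)

/-! ### Integrating factors -/

/-- The units congruent to `1` modulo the decaying functions. -/
def IsPotential (u : Rˣ) : Prop := (u : R) - 1 ∈ Λ.I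

/-- The shift acting on units. -/
def shiftUnit (a : ℤ) : Rˣ →* Rˣ := Units.map ((Λ.E ^ a : R ≃ₐ[ℝ] R) : R →* R)

lemma coe_shiftUnit (a : ℤ) (u : Rˣ) : (Λ.shiftUnit a u : R) = (Λ.E ^ a) u := rfl

/-- The integrating factor: `weight (j + 1) = weight j * E^j u`, `weight 0 = 1`. -/
def weight (u : Rˣ) : ℤ → Rˣ
  | Int.ofNat n => ∏ i ∈ Finset.range n, Λ.shiftUnit i u
  | Int.negSucc n => (∏ i ∈ Finset.range (n + 1), Λ.shiftUnit (-1 - i) u)⁻¹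

lemma weight_zero (u : Rˣ) : Λ.weight u 0 = 1 := by
  change ∏ i ∈ Finset.range 0, _ = _
  simp

lemma weight_natCast (u : Rˣ) (n : ℕ) :
    Λ.weight u n = ∏ i ∈ Finset.range n, Λ.shiftUnit i u := rfl

lemma weight_neg_natCast (u : Rˣ) (n : ℕ) :
    Λ.weight u (-n) = (∏ i ∈ Finset.range n, Λ.shiftUnit (-1 - i) u)⁻¹ := by
  cases n with
  | zero => simp [weight_zero]
  | succ n => rfl

lemma weight_succ (u : Rˣ) (j : ℤ) : Λ.weight u (j + 1) = Λ.weight u j * Λ.shiftUnit j u := by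
  obtain ⟨n, rfl | rfl⟩ := j.eq_nat_or_neg
  · rw [← Nat.cast_succ, weight_natCast, weight_natCast, Finset.prod_range_succ]
  · cases n with
    | zero =>
      have := Λ.weight_natCast u 1
      simp only [Nat.cast_one, Finset.prod_range_one, Nat.cast_zero] at this
      simp [weight_zero, this]
    | succ n =>
      rw [weight_neg_natCast, Finset.prod_range_succ, mul_inv, mul_assoc,
        show (-((n + 1 : ℕ) : ℤ)) = -1 - n by push_cast; ring, inv_mul_cancel, mul_one,
        ← weight_neg_natCast]
      congr 1; ring

/-- A factor `u` can be split off at either end of the product. Having both recursions is what makes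
the integrating factor work in `weight_conj`. -/
lemma weight_succ' (u : Rˣ) (j : ℤ) : Λ.weight u (j + 1) = u * Λ.shiftUnit 1 (Λ.weight u j) := by
  have hs : ∀ i : ℤ, Λ.shiftUnit 1 (Λ.shiftUnit i u) = Λ.shiftUnit (i + 1) u := fun i => by
    ext
    rw [coe_shiftUnit, coe_shiftUnit, coe_shiftUnit, add_comm, zpow_add]
    rfl
  induction j using Int.induction_on with
  | zero =>
    rw [weight_succ, weight_zero, map_one, one_mul, mul_one]
    ext; simp [coe_shiftUnit]
  | succ n ih =>
    rw [weight_succ]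
    conv_rhs => rw [weight_succ, map_mul, hs, ← mul_assoc, ← ih]
  | pred n ih =>
    have h1 := Λ.weight_succ u (-(n : ℤ) - 1)
    rw [sub_add_cancel] at h1
    have h2 : Λ.shiftUnit 1 (Λ.weight u (-n)) =
        Λ.shiftUnit 1 (Λ.weight u (-(n : ℤ) - 1)) * Λ.shiftUnit (-n) u := by
      rw [h1, map_mul, hs, sub_add_cancel]
    rw [weight_succ, h2, ← mul_assoc] at ih
    rw [sub_add_cancel]
    exact mul_right_cancel ih

lemma isPotential_mul {u v : Rˣ} (hu : Λ.IsPotential u) (hv : Λ.IsPotential v) :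
    Λ.IsPotential (u * v) := by
  have : ((u * v : Rˣ) : R) - 1 = (u - 1 : R) * v + (v - 1) := by push_cast; ring
  rw [IsPotential, this]
  exact Λ.I.add_mem (Λ.I.mul_mem_right _ hu) hv

lemma isPotential_one : Λ.IsPotential 1 := by simp [IsPotential]

lemma isPotential_inv {u : Rˣ} (hu : Λ.IsPotential u) : Λ.IsPotential u⁻¹ := by
  have : ((u⁻¹ : Rˣ) : R) - 1 = -((u - 1 : R) * (u⁻¹ : Rˣ)) := by
    rw [sub_mul, Units.mul_inv]; ring
  rw [IsPotential, this]
  exact Λ.I.neg_mem (Λ.I.mul_mem_right _ hu)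

lemma isPotential_shiftUnit {u : Rˣ} (hu : Λ.IsPotential u) (a : ℤ) :
    Λ.IsPotential (Λ.shiftUnit a u) := by
  have : (Λ.shiftUnit a u : R) - 1 = (Λ.E ^ a) ((u : R) - 1) := by
    rw [map_sub, map_one, coe_shiftUnit]
  rw [IsPotential, this]
  exact Λ.zpow_E_mem a hu

lemma isPotential_weight {u : Rˣ} (hu : Λ.IsPotential u) (j : ℤ) :
    Λ.IsPotential (Λ.weight u j) := by
  have hp : ∀ (n : ℕ) (g : ℕ → ℤ),
      Λ.IsPotential (∏ i ∈ Finset.range n, Λ.shiftUnit (g i) u) := by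
    intro n g
    induction n with
    | zero => simpa using Λ.isPotential_one
    | succ n ih =>
      rw [Finset.prod_range_succ]
      exact Λ.isPotential_mul ih (Λ.isPotential_shiftUnit hu _)
  obtain ⟨n, rfl | rfl⟩ := j.eq_nat_or_neg
  · exact hp _ _
  · rw [weight_neg_natCast]; exact Λ.isPotential_inv (hp _ _)

/-- Multiplication by the integrating factor conjugates the homogeneous equation to `E c - c`. -/
lemma weight_conj (u : Rˣ) (j : ℤ) (c : R) :
    (u : R) * Λ.E (Λ.weight u j * c) - Λ.weight u j * c * (Λ.E ^ j) u =
      Λ.weight u (j + 1) * (Λ.E c - c) := by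
  have h1 := congrArg (Units.val) (Λ.weight_succ u j)
  have h2 := congrArg (Units.val) (Λ.weight_succ' u j)
  simp only [Units.val_mul, coe_shiftUnit, zpow_one] at h1 h2
  rw [map_mul, mul_sub]
  nth_rewrite 1 [h2]
  rw [h1]
  ring

/-- With `g = weight u j * c` the equation becomes `E c = c`, and `c` is again decaying. -/
lemma eq_zero_of_conj (u : Rˣ) (j : ℤ) {g : R} (hg : g ∈ Λ.I)
    (h : (u : R) * Λ.E g - g * (Λ.E ^ j) u = 0) : g = 0 := by
  have hc : g = Λ.weight u j * ((Λ.weight u j)⁻¹ : Rˣ) * g := by simp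
  rw [mul_assoc] at hc
  rw [hc, weight_conj, Units.mul_right_eq_zero, sub_eq_zero] at h
  rw [hc, Λ.eq_zero _ (Λ.I.mul_mem_left _ hg) h, mul_zero]

/-! ### The Lax operator -/

variable (h : ℝ)

/-- `A₁ = h⁻¹ u Δ`. -/
def opA1 (u : R) : PDO Λ.E := single 1 (h⁻¹ • u)

lemma opA1_ordLE (u : R) : (Λ.opA1 h u).OrdLE 1 := ordLE_single _ _

/-- The top coefficient of the commutator with `A₁`. -/
lemma comm_opA1_top (u : R) {W : PDO Λ.E} {k : ℤ} (hW : W.OrdLE k) :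
    (Λ.opA1 h u * W - W * Λ.opA1 h u) (k + 1) = h⁻¹ • (u * Λ.E (W k) - W k * (Λ.E ^ k) u) := by
  have h1 := mul_coeff_top (Λ.opA1_ordLE h u) hW
  have h2 := mul_coeff_top hW (Λ.opA1_ordLE h u)
  rw [add_comm] at h1
  rw [sub_coeff, h1, h2, opA1, single_coeff_self, zpow_one, map_smul, smul_mul_assoc,
    mul_smul_comm, smul_sub]

lemma comm_opA1_ordLE (u : R) {W : PDO Λ.E} {k : ℤ} (hW : W.OrdLE k) :
    (Λ.opA1 h u * W - W * Λ.opA1 h u).OrdLE (k + 1) :=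
  (((Λ.opA1_ordLE h u).mul hW).mono (by omega)).sub (hW.mul (Λ.opA1_ordLE h u))

variable {h}

/-- A decaying operator vanishes if the top coefficients of its commutator with `A₁` do. -/
lemma eq_zero_of_comm (hh : h ≠ 0) (u : Rˣ) {W : PDO Λ.E} (hW : W.CoeffIn Λ.I)
    (hc : ∀ k, W.OrdLE k → W k = 0 ∨ (Λ.opA1 h u * W - W * Λ.opA1 h u) (k + 1) = 0) : W = 0 := by
  obtain ⟨M, hM⟩ := W.exists_ordLE
  -- The order is lowered without end: at order `M - n` the coefficient either vanishes by
  -- assumption or solves the homogeneous equation of `eq_zero_of_conj`.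
  have key : ∀ n : ℕ, W.OrdLE (M - n) := by
    intro n
    induction n with
    | zero => simpa using hM
    | succ n ih =>
      intro j hj
      rcases eq_or_ne j (M - n) with rfl | hne
      · rcases hc _ ih with h0 | h0
        · exact h0
        · rw [Λ.comm_opA1_top h u ih, smul_eq_zero_iff_right (inv_ne_zero hh)] at h0
          exact Λ.eq_zero_of_conj u _ (hW _) h0
      · exact ih j (by push_cast at hj; omega)
  exact ext' fun j => key (M - j + 1).toNat j (by omega)

variable (h)

/-- Characterization of the Lax operator. -/
structure IsLax (u : R) (L : PDO Λ.E) : Prop where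
  order : L.OrdLE 1
  leading : L 1 = h⁻¹ • u
  decay : ∀ j : ℤ, j ≤ 0 → L j ∈ Λ.I
  eqn : Λ.opD L = Λ.opA1 h u * L - L * Λ.opA1 h u

/-- The truncations of the Lax operator. -/
def laxTrunc (u : Rˣ) : ℕ → PDO Λ.E
  | 0 => Λ.opA1 h u
  | s + 1 =>
    let T := laxTrunc u s
    let f := (Λ.opD T - (Λ.opA1 h u * T - T * Λ.opA1 h u)) (1 - s)
    T + single (-(s : ℤ)) (Λ.weight u (-s) * Λ.dInv (h • f * ((Λ.weight u (1 - s))⁻¹ : Rˣ)))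

lemma laxTrunc_coeff_of_ne (u : Rˣ) (s : ℕ) {j : ℤ} (hj : j ≠ -s) :
    Λ.laxTrunc h u (s + 1) j = Λ.laxTrunc h u s j := by
  simp only [laxTrunc, add_coeff]
  rw [single_coeff_ne _ hj, add_zero]

lemma laxTrunc_coeff_of_gt (u : Rˣ) {s : ℕ} {j : ℤ} (hj : 1 - (s : ℤ) ≤ j) :
    Λ.laxTrunc h u s j = Λ.laxTrunc h u (1 - j).toNat j := by
  obtain ⟨n, rfl⟩ : ∃ n, s = (1 - j).toNat + n := ⟨s - (1 - j).toNat, by omega⟩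
  induction n with
  | zero => rfl
  | succ n ih => rw [← add_assoc, laxTrunc_coeff_of_ne _ _ _ _ (by push_cast; omega), ih (by omega)]

lemma laxTrunc_ordLE (u : Rˣ) (s : ℕ) : (Λ.laxTrunc h u s).OrdLE 1 := by
  induction s with
  | zero => exact Λ.opA1_ordLE h u
  | succ s ih => exact ih.add ((ordLE_single _ _).mono (by omega))

/-- The Lax operator of `u`. -/
def lax (u : Rˣ) : PDO Λ.E := ⟨fun j => Λ.laxTrunc h u (1 - j).toNat j,
  1, fun j hj => Λ.laxTrunc_ordLE h u _ j hj⟩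

lemma lax_coeff (u : Rˣ) (j : ℤ) : Λ.lax h u j = Λ.laxTrunc h u (1 - j).toNat j := rfl

variable {h}

/-- The defect of the Lax equation for an operator asymptotic to `A₁` is decaying. -/
lemma laxDefect_coeffIn {u : Rˣ} (hu : Λ.IsPotential u) {T : PDO Λ.E}
    (hT : (T - Λ.opA1 h u).CoeffIn Λ.I) :
    (Λ.opD T - (Λ.opA1 h u * T - T * Λ.opA1 h u)).CoeffIn Λ.I := by
  have hA : (Λ.opD (Λ.opA1 h u)).CoeffIn Λ.I := by
    rw [opA1, opD_single, map_smul]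
    refine coeffIn_single (Λ.smul_mem _ ?_)
    have := Λ.d_mem _ hu
    rwa [map_sub, d_one, sub_zero] at this
  have : Λ.opD T - (Λ.opA1 h u * T - T * Λ.opA1 h u) = Λ.opD (T - Λ.opA1 h u) +
      Λ.opD (Λ.opA1 h u) - (Λ.opA1 h u * (T - Λ.opA1 h u) - (T - Λ.opA1 h u) * Λ.opA1 h u) := by
    rw [map_sub]; noncomm_ring
  rw [this]
  exact ((Λ.opD_coeffIn hT).add hA).sub ((Λ.coeffIn_mul_left _ hT).sub (hT.mul_right _))

/-- Adding a term of order `-s` changes the defect of the Lax equation at order `1 - s` only through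
the top coefficient of its commutator with `A₁`, and the recursion chooses the term so that this
cancels. The first assertion guarantees that the source is decaying and can be summed. -/
lemma laxTrunc_spec (hh : h ≠ 0) {u : Rˣ} (hu : Λ.IsPotential u) (s : ℕ) :
    (Λ.laxTrunc h u s - Λ.opA1 h u).CoeffIn Λ.I ∧
    (Λ.opD (Λ.laxTrunc h u s) - (Λ.opA1 h u * Λ.laxTrunc h u s - Λ.laxTrunc h u s * Λ.opA1 h u)).OrdLE
      (1 - s) := by
  induction s with
  | zero =>
    refine ⟨by simpa [laxTrunc] using coeffIn_zero, ?_⟩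
    simpa [laxTrunc] using Λ.opD_ordLE (Λ.opA1_ordLE h u)
  | succ s ih =>
    obtain ⟨h1, h2⟩ := ih
    set T := Λ.laxTrunc h u s with hT
    set A := Λ.opA1 h u
    set f := (Λ.opD T - (A * T - T * A)) (1 - s) with hf
    have hfI : f ∈ Λ.I := Λ.laxDefect_coeffIn hu h1 _
    set w' : Rˣ := (Λ.weight u (1 - s))⁻¹ with hw'
    have hfI' : h • f * (w' : R) ∈ Λ.I := Λ.I.mul_mem_right _ (Λ.smul_mem h hfI)
    set c := Λ.dInv (h • f * (w' : R)) with hc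
    have hcI : c ∈ Λ.I := Λ.dInv_mem _ hfI'
    have hT' : Λ.laxTrunc h u (s + 1) = T + single (-(s : ℤ)) (Λ.weight u (-s) * c) := rfl
    have hg : (single (-(s : ℤ)) (Λ.weight u (-s) * c) : PDO Λ.E).CoeffIn Λ.I :=
      coeffIn_single (Λ.I.mul_mem_left _ hcI)
    set g : PDO Λ.E := single (-(s : ℤ)) (Λ.weight u (-s) * c) with hgdef
    rw [hT']
    constructor
    · rw [add_sub_right_comm]; exact h1.add hg
    · have hsum : Λ.opD (T + g) - (A * (T + g) - (T + g) * A) =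
          (Λ.opD T - (A * T - T * A)) + Λ.opD g - (A * g - g * A) := by
        rw [map_add]; noncomm_ring
      have ho : g.OrdLE (-(s : ℤ)) := ordLE_single _ _
      have ho2 := Λ.comm_opA1_ordLE h u ho
      rw [hsum]
      intro j hj
      push_cast at hj
      rcases eq_or_ne j (1 - s) with rfl | hne
      -- By `weight_conj` the top coefficient is `h⁻¹ • weight (1 - s) * (E c - c)`, and `c` was
      -- obtained by summing `h • f / weight (1 - s)`.
      · have htop : (A * g - g * A) (1 - s) = f := by
          have := Λ.comm_opA1_top h u ho
          rw [hgdef, single_coeff_self, weight_conj, hc, Λ.E_dInv _ hfI',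
            show (-(s : ℤ)) + 1 = 1 - s by ring, add_sub_cancel_left, mul_comm (h • f),
            ← mul_assoc, hw', Units.mul_inv, one_mul, smul_smul, inv_mul_cancel₀ hh,
            one_smul] at this
          rw [← this, hgdef, hc, hw', mul_comm (h • f)]
        rw [sub_coeff, add_coeff, Λ.opD_ordLE ho _ (by omega), htop, ← hf]
        simp
      · rw [sub_coeff, add_coeff, h2 j (by omega), Λ.opD_ordLE ho _ (by omega), ho2 j (by omega)]
        simp

lemma lax_sub_laxTrunc_ordLE (u : Rˣ) (s : ℕ) : (Λ.lax h u - Λ.laxTrunc h u s).OrdLE (-s) := by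
  intro j hj
  rw [sub_coeff, lax_coeff, Λ.laxTrunc_coeff_of_gt h u (by omega : 1 - (s : ℤ) ≤ j), sub_self]

lemma isLax_lax (hh : h ≠ 0) {u : Rˣ} (hu : Λ.IsPotential u) : Λ.IsLax h u (Λ.lax h u) where
  order j hj := Λ.laxTrunc_ordLE h u _ j hj
  leading := by
    rw [lax_coeff, sub_self]
    simp [laxTrunc, opA1]
  decay j hj := by
    have := (Λ.laxTrunc_spec hh hu (1 - j).toNat).1 j
    rw [sub_coeff, opA1, single_coeff_ne _ (by omega : j ≠ 1), sub_zero] at this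
    exact this
  eqn := by
    refine ext' fun k => ?_
    -- With `2 - k` steps of the recursion, the defect of the truncation and the contribution of the
    -- remainder `L - T` both have order at most `k - 1`.
    have hs := (Λ.laxTrunc_spec hh hu (2 - k).toNat).2
    have hW := Λ.lax_sub_laxTrunc_ordLE (h := h) u (2 - k).toNat
    set T := Λ.laxTrunc h u (2 - k).toNat
    have hW2 := Λ.comm_opA1_ordLE h u hW
    set A := Λ.opA1 h u
    set L := Λ.lax h u
    rw [← sub_eq_zero, ← sub_coeff]
    have : Λ.opD L - (A * L - L * A) = (Λ.opD T - (A * T - T * A)) + Λ.opD (L - T) -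
        (A * (L - T) - (L - T) * A) := by
      rw [map_sub]; noncomm_ring
    rw [this, sub_coeff, add_coeff, hs k (by omega), Λ.opD_ordLE hW k (by omega), hW2 k (by omega)]
    simp

lemma IsLax.sub_opA1_coeffIn {u : R} {L : PDO Λ.E} (hL : Λ.IsLax h u L) :
    (L - Λ.opA1 h u).CoeffIn Λ.I := by
  intro j
  rw [sub_coeff, opA1]
  rcases lt_trichotomy j 1 with hj | rfl | hj
  · rw [single_coeff_ne _ (by omega), sub_zero]; exact hL.decay j (by omega)
  · rw [single_coeff_self, hL.leading, sub_self]; exact Λ.I.zero_mem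
  · rw [single_coeff_ne _ (by omega), hL.order j hj, sub_zero]; exact Λ.I.zero_mem

lemma IsLax.sub_opA1_ordLE {u : R} {L : PDO Λ.E} (hL : Λ.IsLax h u L) :
    (L - Λ.opA1 h u).OrdLE 0 := by
  intro j hj
  rw [sub_coeff, opA1]
  rcases eq_or_ne j 1 with rfl | hne
  · rw [single_coeff_self, hL.leading, sub_self]
  · rw [single_coeff_ne _ hne, hL.order j (by omega), sub_zero]

/-- Uniqueness for the linearized Lax equation `W_x = [S, L] + [A₁, W]`. -/
lemma eq_of_linearized (hh : h ≠ 0) (u : Rˣ) {B W W' : PDO Λ.E} (hW : W.CoeffIn Λ.I)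
    (hW' : W'.CoeffIn Λ.I)
    (he : Λ.opD W = B + (Λ.opA1 h u * W - W * Λ.opA1 h u))
    (he' : Λ.opD W' = B + (Λ.opA1 h u * W' - W' * Λ.opA1 h u)) : W = W' := by
  rw [← sub_eq_zero]
  refine Λ.eq_zero_of_comm hh u (hW.sub hW') fun k hk => ?_
  have : Λ.opA1 h u * (W - W') - (W - W') * Λ.opA1 h u = Λ.opD (W - W') := by
    rw [map_sub, he, he']; noncomm_ring
  right
  rw [this]
  exact Λ.opD_ordLE hk _ (by omega)

/-- The difference `W` of two solutions is decaying and satisfies `[A₁, W] = W_x`, whose order does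
not exceed that of `W`; so `eq_zero_of_comm` applies. -/
lemma IsLax.eq_lax (hh : h ≠ 0) {u : Rˣ} (hu : Λ.IsPotential u) {L : PDO Λ.E}
    (hL : Λ.IsLax h u L) : L = Λ.lax h u := by
  have hL' := Λ.isLax_lax hh hu
  rw [← sub_eq_zero]
  have hc : (L - Λ.lax h u).CoeffIn Λ.I := by
    rw [← sub_sub_sub_cancel_right _ _ (Λ.opA1 h u)]
    exact (hL.sub_opA1_coeffIn).sub hL'.sub_opA1_coeffIn
  refine Λ.eq_zero_of_comm hh u hc fun k hk => Or.inr ?_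
  have : Λ.opA1 h u * (L - Λ.lax h u) - (L - Λ.lax h u) * Λ.opA1 h u = Λ.opD (L - Λ.lax h u) := by
    rw [map_sub, hL.eqn, hL'.eqn]; noncomm_ring
  rw [this]
  exact Λ.opD_ordLE hk _ (by omega)

end LatticeDiff
end PseudoDiff

namespace PseudoDiff
open PDO Polynomial

/-! ### Commutators with polynomials -/

/-- A derivation of a ring which is inner on `L` is inner on polynomials in `L`. -/
lemma map_aeval_of_comm {A : Type*} [Ring A] [Algebra ℝ A] (D : A →ₗ[ℝ] A)
    (hD : ∀ P Q, D (P * Q) = D P * Q + P * D Q) {L S : A} (h : D L = S * L - L * S)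
    (p : ℝ[X]) : D (aeval L p) = S * aeval L p - aeval L p * S := by
  have h1 : D 1 = 0 := by
    have := hD 1 1
    simpa using this
  have hn : ∀ n : ℕ, D (L ^ n) = S * L ^ n - L ^ n * S := by
    intro n
    induction n with
    | zero => simp [h1]
    | succ n ih => rw [pow_succ, hD, ih, h]; noncomm_ring
  induction p using Polynomial.induction_on' with
  | add p q hp hq => rw [map_add, map_add, hp, hq]; noncomm_ring
  | monomial n a =>
    rw [aeval_monomial, ← Algebra.smul_def, map_smul, hn, smul_sub, mul_smul_comm,
      smul_mul_assoc]

/-- If `[x, G] = c` commutes with `x`, then `[p(x), G] = p'(x) c`. -/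
lemma aeval_comm_of_comm {A : Type*} [Ring A] [Algebra ℝ A] {x G c : A}
    (h : x * G - G * x = c) (hc : Commute x c) (p : ℝ[X]) :
    aeval x p * G - G * aeval x p = aeval x (derivative p) * c := by
  have hn : ∀ n : ℕ, x ^ n * G - G * x ^ n = n • x ^ (n - 1) * c := by
    intro n
    induction n with
    | zero => simp
    | succ n ih =>
      have h1 : x ^ (n + 1) * G - G * x ^ (n + 1) =
          x ^ n * (x * G - G * x) + (x ^ n * G - G * x ^ n) * x := by
        rw [pow_succ]; noncomm_ring
      rw [h1, ih, h, mul_assoc, ← hc.eq, Nat.add_sub_cancel, succ_nsmul, add_mul, add_comm]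
      congr 1
      cases n with
      | zero => simp
      | succ n => rw [Nat.add_sub_cancel, ← mul_assoc, smul_mul_assoc, ← pow_succ]
  induction p using Polynomial.induction_on' with
  | add p q hp hq =>
    rw [map_add, map_add, map_add, add_mul, add_mul, ← hp, ← hq]; noncomm_ring
  | monomial n a =>
    rw [derivative_monomial, aeval_monomial, aeval_monomial, ← Algebra.smul_def, ← Algebra.smul_def,
      smul_mul_assoc, mul_smul_comm, ← smul_sub, hn, mul_smul, Nat.cast_smul_eq_nsmul,
      smul_mul_assoc, smul_mul_assoc, smul_mul_assoc]

/-- Multiplication by `1 + h z`. -/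
def sym (h : ℝ) (q : ℝ[X]) : ℝ[X] := (1 + C h * X) * q

lemma sym_add (h : ℝ) (p q : ℝ[X]) : sym h (p + q) = sym h p + sym h q := mul_add _ _ _

lemma sym_smul (h c : ℝ) (p : ℝ[X]) : sym h (c • p) = c • sym h p := mul_smul_comm _ _ _

lemma aeval_sym (h : ℝ) {A : Type*} [Ring A] [Algebra ℝ A] (L : A) (q : ℝ[X]) :
    aeval L (sym h q) = (1 + h • L) * aeval L q := by
  simp [sym, Algebra.smul_def]

namespace LatticeDiff

variable {R : Type*} [CommRing R] [Algebra ℝ R] (Λ : LatticeDiff R)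

lemma single_one_mul_single (p : R) (b : ℤ) (q : R) :
    (single 1 p * single b q : PDO Λ.E) =
      single (b + 1) (p * Λ.E q) + single b (p * (Λ.E q - q)) := by
  refine ext' fun k => ?_
  by_cases hk : 1 + b < k
  · rw [single_mul_single_ordLE 1 b _ _ k hk, add_coeff, single_coeff_ne _ (by omega),
      single_coeff_ne _ (by omega), add_zero]
  obtain ⟨n, rfl⟩ : ∃ n : ℕ, k = 1 + b - n := ⟨(1 + b - k).toNat, by omega⟩
  rw [single_mul_single_coeff, add_coeff]
  match n with
  | 0 =>
    rw [leibnizCoeff_zero, show (1 : ℤ) + b - (0 : ℕ) = b + 1 by push_cast; ring,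
      single_coeff_ne (p * (Λ.E q - q)) (by omega), zpow_one, add_zero, single_coeff_self]
  | 1 =>
    rw [show (1 : ℤ) + b - (1 : ℕ) = b by push_cast; ring,
      single_coeff_ne (p * Λ.E q) (by omega), single_coeff_self, zero_add]
    simp [leibnizCoeff_apply, delta_apply]
  | n + 2 =>
    rw [single_coeff_ne _ (by push_cast; omega), single_coeff_ne _ (by push_cast; omega),
      leibnizCoeff_apply, ← Nat.cast_one (R := ℤ), choose_natCast_of_lt (by omega)]
    simp

/-! ### The background operators -/

variable (h : ℝ)

/-- `h⁻¹ Δ`. -/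
def bgL : PDO Λ.E := single 1 (algebraMap ℝ R h⁻¹)

/-- `X Δ + (X + h N)`. -/
def bgG : PDO Λ.E := single 1 Λ.xCoord + single 0 (Λ.xCoord + h • Λ.nCoord)

/-- The background operator `p(h⁻¹Δ) + G q(h⁻¹Δ)`. -/
def bg (p q : ℝ[X]) : PDO Λ.E := aeval (Λ.bgL h) p + Λ.bgG h * aeval (Λ.bgL h) q

lemma opD_aeval_bgL (p : ℝ[X]) : Λ.opD (aeval (Λ.bgL h) p) = 0 := by
  have h1 : Λ.opD (Λ.bgL h) = 0 * Λ.bgL h - Λ.bgL h * 0 := by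
    rw [bgL, opD_single, d_algebraMap]; simp
  rw [map_aeval_of_comm Λ.opD Λ.opD_mul h1]; simp

variable {h}

/-- `X Δ` commutes with `Δ`; only the increment of `N` under the shift contributes. Through
`aeval_bgL_comm_bgG` this makes commutation with `G` act on polynomials in `h⁻¹Δ` as the derivation
`(1 + hz) d/dz`. -/
lemma bgL_comm_bgG (hh : h ≠ 0) :
    Λ.bgL h * Λ.bgG h - Λ.bgG h * Λ.bgL h = 1 + h • Λ.bgL h := by
  have hc : ∀ f : R, algebraMap ℝ R h⁻¹ * f = h⁻¹ • f := fun f => (Algebra.smul_def _ _).symm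
  rw [bgG, bgL, mul_add, add_mul, single_one_mul_single, single_one_mul_single,
    single_mul_single_const, single_mul_single_const, smul_single, Λ.E_X, map_add,
    map_smul, Λ.E_X, Λ.E_N, sub_self, mul_zero, single_zero, hc, hc, hc, one_def]
  have e1 : h⁻¹ • (Λ.xCoord + h • (Λ.nCoord + 1)) = h⁻¹ • (Λ.xCoord + h • Λ.nCoord) + 1 := by
    rw [smul_add h, ← add_assoc, smul_add h⁻¹ (Λ.xCoord + _), smul_smul, inv_mul_cancel₀ hh, one_smul]
  have e2 : h⁻¹ • (Λ.xCoord + h • (Λ.nCoord + 1) - (Λ.xCoord + h • Λ.nCoord)) = (1 : R) := by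
    rw [smul_sub, e1, add_sub_cancel_left]
  have e3 : h • algebraMap ℝ R h⁻¹ = 1 := by
    rw [Algebra.algebraMap_eq_smul_one, smul_smul, mul_inv_cancel₀ hh, one_smul]
  rw [e1, e2, e3, single_add, zero_add]
  abel

lemma aeval_bgL_comm (p q : ℝ[X]) :
    aeval (Λ.bgL h) p * aeval (Λ.bgL h) q = aeval (Λ.bgL h) q * aeval (Λ.bgL h) p := by
  rw [← map_mul, mul_comm, map_mul]

lemma aeval_bgL_comm_bgG (hh : h ≠ 0) (p : ℝ[X]) :
    aeval (Λ.bgL h) p * Λ.bgG h =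
      Λ.bgG h * aeval (Λ.bgL h) p + aeval (Λ.bgL h) (sym h (derivative p)) := by
  have hc : Commute (Λ.bgL h) (1 + h • Λ.bgL h) :=
    (Commute.one_right _).add_right ((Commute.refl _).smul_right h)
  have := aeval_comm_of_comm (Λ.bgL_comm_bgG hh) hc p
  rw [sub_eq_iff_eq_add'] at this
  rw [this, aeval_sym]
  congr 1
  have h2 := Λ.aeval_bgL_comm (h := h) (derivative p) (1 + C h * X)
  simpa [Algebra.smul_def] using h2

/-- The background operators represent the Lie algebra of symbols. -/
lemma bg_comm (hh : h ≠ 0) (p q p' q' : ℝ[X]) :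
    Λ.bg h p q * Λ.bg h p' q' - Λ.bg h p' q' * Λ.bg h p q =
      Λ.bg h (derivative p * sym h q' - derivative p' * sym h q)
        (sym h (derivative q * q' - derivative q' * q)) := by
  have c1 := Λ.aeval_bgL_comm_bgG hh p
  have c2 := Λ.aeval_bgL_comm_bgG hh q
  have c3 := Λ.aeval_bgL_comm_bgG hh p'
  have c4 := Λ.aeval_bgL_comm_bgG hh q'
  have e1 : aeval (Λ.bgL h) (derivative p * sym h q') =
      aeval (Λ.bgL h) (sym h (derivative p)) * aeval (Λ.bgL h) q' := by
    rw [← map_mul, sym, sym]; congr 1; ring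
  have e2 : aeval (Λ.bgL h) (derivative p' * sym h q) =
      aeval (Λ.bgL h) (sym h (derivative p')) * aeval (Λ.bgL h) q := by
    rw [← map_mul, sym, sym]; congr 1; ring
  have e3 : aeval (Λ.bgL h) (sym h (derivative q * q' - derivative q' * q)) =
      aeval (Λ.bgL h) (sym h (derivative q)) * aeval (Λ.bgL h) q' -
      aeval (Λ.bgL h) (sym h (derivative q')) * aeval (Λ.bgL h) q := by
    rw [← map_mul, ← map_mul, ← map_sub, sym, sym, sym]; congr 1; ring
  have m1 := Λ.aeval_bgL_comm (h := h) p p'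
  have m2 := Λ.aeval_bgL_comm (h := h) p q'
  have m3 := Λ.aeval_bgL_comm (h := h) q p'
  have m4 := Λ.aeval_bgL_comm (h := h) q q'
  simp only [bg]
  rw [map_sub, e1, e2, e3]
  generalize aeval (Λ.bgL h) p = P at *
  generalize aeval (Λ.bgL h) q = Q at *
  generalize aeval (Λ.bgL h) p' = P' at *
  generalize aeval (Λ.bgL h) q' = Q' at *
  generalize Λ.bgG h = G at *
  have x1 : (P + G * Q) * (P' + G * Q') = P * P' + (P * G) * Q' + G * (Q * P') + G * (Q * G) * Q' := by
    noncomm_ring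
  have x2 : (P' + G * Q') * (P + G * Q) = P' * P + (P' * G) * Q + G * (Q' * P) + G * (Q' * G) * Q := by
    noncomm_ring
  rw [x1, x2, c1, c2, c3, c4, m1, m3, ← m2]
  have x3 : G * (G * Q + aeval (Λ.bgL h) (sym h (derivative q))) * Q' =
    G * G * (Q * Q') + G * aeval (Λ.bgL h) (sym h (derivative q)) * Q' := by noncomm_ring
  rw [x3, m4]
  noncomm_ring

/-- The background operators solve the `x`-part of the zero curvature equations. -/
lemma bg_zero_curvature (hh : h ≠ 0) (p q : ℝ[X]) :
    Λ.opD (Λ.bg h p q) + Λ.bg h p q * Λ.bgL h - Λ.bgL h * Λ.bg h p q = 0 := by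
  have hG : Λ.opD (Λ.bgG h) = 1 + h • Λ.bgL h := by
    have e : h • algebraMap ℝ R h⁻¹ = 1 := by
      rw [Algebra.algebraMap_eq_smul_one, smul_smul, mul_inv_cancel₀ hh, one_smul]
    rw [bgG, map_add, opD_single, opD_single, map_add, map_smul, Λ.d_X, Λ.d_N,
      smul_zero, add_zero, bgL, smul_single, e, one_def, add_comm]
  have c := Λ.aeval_bgL_comm_bgG hh X
  have m1 := Λ.aeval_bgL_comm (h := h) X p
  have m2 := Λ.aeval_bgL_comm (h := h) X q
  rw [derivative_X, aeval_sym, aeval_X, map_one, mul_one] at c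
  rw [aeval_X] at m1 m2
  rw [bg, map_add, opD_mul, opD_aeval_bgL, opD_aeval_bgL, hG, mul_add, ← mul_assoc, c, m1,
    add_mul (aeval (Λ.bgL h) p), mul_assoc (Λ.bgG h) _ (Λ.bgL h), ← m2]
  noncomm_ring

/-- The Lax equation at the zero potential, whose Lax operator `h⁻¹Δ` does not move. It accounts for
the term `(1 + hz) q` in the right-hand side of a flow and makes that right-hand side decaying in
general. -/
lemma bg_eqn (hh : h ≠ 0) (p q : ℝ[X]) :
    Λ.bg h p q * Λ.bgL h - Λ.bgL h * Λ.bg h p q + aeval (Λ.bgL h) (sym h q) = 0 := by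
  have c := Λ.aeval_bgL_comm_bgG hh X
  have m1 := Λ.aeval_bgL_comm (h := h) X p
  have m2 := Λ.aeval_bgL_comm (h := h) X q
  rw [derivative_X, aeval_sym, aeval_X, map_one, mul_one] at c
  rw [aeval_X] at m1 m2
  rw [bg, aeval_sym, mul_add, ← mul_assoc, c, m1, add_mul, mul_assoc (Λ.bgG h) _ (Λ.bgL h), ← m2]
  noncomm_ring

lemma bgL_pow (m : ℕ) : Λ.bgL h ^ m = single (m : ℤ) (algebraMap ℝ R (h⁻¹ ^ m)) := by
  induction m with
  | zero => simp [one_def]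
  | succ m ih =>
    rw [pow_succ, ih, bgL, single_mul_single_const, Nat.cast_succ, Algebra.smul_def,
      ← map_mul, ← pow_succ']

end LatticeDiff
end PseudoDiff

namespace PseudoDiff
open PDO Polynomial
namespace LatticeDiff

variable {R : Type*} [CommRing R] [Algebra ℝ R] (Λ : LatticeDiff R)

/-! ### Flows -/

variable (h : ℝ)

/-- `P` generates a flow with symbol `(p, q)` of the Lax operator `L` of `u`: `P` is a difference
operator without constant term, asymptotic to the background operator, and the right-hand side
`[P, L] + ((1 + h z) q)(L)` of the Lax equation has order at most one. -/
structure IsFlow (u : Rˣ) (P : PDO Λ.E) (p q : ℝ[X]) : Prop where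
  pos : P.PosPart
  asym : (P - Λ.bg h p q).CoeffIn Λ.I
  eqn : (P * Λ.lax h u - Λ.lax h u * P + aeval (Λ.lax h u) (sym h q)).OrdLE 1

/-- The `x`-part `P_x + [P, A₁]` of the zero curvature equation. -/
def curvature (u : R) (P : PDO Λ.E) : PDO Λ.E := Λ.opD P + P * Λ.opA1 h u - Λ.opA1 h u * P

variable {h} {Λ}

lemma opA1_sub_bgL_coeffIn {u : Rˣ} (hu : Λ.IsPotential u) :
    (Λ.opA1 h (u : R) - Λ.bgL h).CoeffIn Λ.I := by
  rw [opA1, bgL, ← single_sub, Algebra.algebraMap_eq_smul_one, ← smul_sub]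
  exact coeffIn_single (Λ.smul_mem _ hu)

lemma lax_sub_bgL_coeffIn (hh : h ≠ 0) {u : Rˣ} (hu : Λ.IsPotential u) :
    (Λ.lax h u - Λ.bgL h).CoeffIn Λ.I := by
  have := ((Λ.isLax_lax hh hu).sub_opA1_coeffIn).add (opA1_sub_bgL_coeffIn (h := h) hu)
  rwa [sub_add_sub_cancel] at this

lemma aeval_sub_coeffIn {P P' : PDO Λ.E} (hP : (P - P').CoeffIn Λ.I) (p : ℝ[X]) :
    (aeval P p - aeval P' p).CoeffIn Λ.I := by
  induction p using Polynomial.induction_on' with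
  | add p q hp hq =>
    rw [map_add, map_add, add_sub_add_comm]
    exact hp.add hq
  | monomial n a =>
    rw [aeval_monomial, aeval_monomial, ← mul_sub, ← Algebra.smul_def]
    exact (Λ.coeffIn_pow_sub hP n).smul a

lemma opD_aeval_lax (hh : h ≠ 0) {u : Rˣ} (hu : Λ.IsPotential u) (p : ℝ[X]) :
    Λ.opD (aeval (Λ.lax h u) p) =
      Λ.opA1 h u * aeval (Λ.lax h u) p - aeval (Λ.lax h u) p * Λ.opA1 h u :=
  map_aeval_of_comm Λ.opD Λ.opD_mul (Λ.isLax_lax hh hu).eqn p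

lemma posPart_opA1 (u : R) : (Λ.opA1 h u).PosPart := posPart_single le_rfl _

lemma PosPart.curvature {u : R} {P : PDO Λ.E} (hP : P.PosPart) :
    (Λ.curvature h u P).PosPart :=
  ((PosPart.map Λ.d hP).add (hP.mul (posPart_opA1 u))).sub ((posPart_opA1 u).mul hP)

namespace IsFlow

variable {u : Rˣ} {P Q : PDO Λ.E} {p q p' q' : ℝ[X]}

/-- Modulo decaying coefficients, `P` and `A₁` may be replaced by their backgrounds, for which
`bg_zero_curvature` gives zero. -/
lemma curvature_coeffIn (hh : h ≠ 0) (hu : Λ.IsPotential u) (hP : Λ.IsFlow h u P p q) :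
    (Λ.curvature h u P).CoeffIn Λ.I := by
  have hA := opA1_sub_bgL_coeffIn (h := h) hu
  have h0 := Λ.bg_zero_curvature hh p q
  have : Λ.curvature h u P = Λ.opD (P - Λ.bg h p q) +
      (P * Λ.opA1 h u - Λ.bg h p q * Λ.bgL h) - (Λ.opA1 h u * P - Λ.bgL h * Λ.bg h p q) := by
    rw [← sub_zero (Λ.curvature h u P), ← h0, curvature, map_sub]
    abel
  rw [this]
  exact ((Λ.opD_coeffIn hP.asym).add (Λ.coeffIn_mul_sub hP.asym hA)).sub
    (Λ.coeffIn_mul_sub hA hP.asym)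

/-- The right-hand side of the Lax equation satisfies the linearized Lax equation. -/
lemma opD_rhs (hh : h ≠ 0) (hu : Λ.IsPotential u) (P : PDO Λ.E) (q : ℝ[X]) :
    Λ.opD (P * Λ.lax h u - Λ.lax h u * P + aeval (Λ.lax h u) (sym h q)) =
      (Λ.curvature h u P * Λ.lax h u - Λ.lax h u * Λ.curvature h u P) +
      (Λ.opA1 h u * (P * Λ.lax h u - Λ.lax h u * P + aeval (Λ.lax h u) (sym h q)) -
       (P * Λ.lax h u - Λ.lax h u * P + aeval (Λ.lax h u) (sym h q)) * Λ.opA1 h u) := by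
  rw [map_add, map_sub, opD_mul, opD_mul, opD_aeval_lax hh hu, (Λ.isLax_lax hh hu).eqn, curvature]
  noncomm_ring

/-- The zero curvature equation. -/
lemma curvature_eq (hh : h ≠ 0) (hu : Λ.IsPotential u) (hP : Λ.IsFlow h u P p q) :
    Λ.curvature h u P = single 1 (Λ.curvature h u P 1) := by
  have hL := Λ.isLax_lax hh hu
  set S := Λ.curvature h u P with hS
  set L := Λ.lax h u with hLdef
  set T := P * L - L * P + aeval L (sym h q) with hT
  have hTo : T.OrdLE 1 := hP.eqn
  have hSI : S.CoeffIn Λ.I := hP.curvature_coeffIn hh hu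
  -- By `opD_rhs`, `[S, L]` is the defect of `T_x = [A₁, T]`, and `T` has order at most one.
  have hSL : (S * L - L * S).OrdLE 2 := by
    have e : S * L - L * S = Λ.opD T - (Λ.opA1 h u * T - T * Λ.opA1 h u) := by
      rw [hT, opD_rhs hh hu]; noncomm_ring
    rw [e]
    exact ((Λ.opD_ordLE hTo).mono (by norm_num)).sub (Λ.comm_opA1_ordLE h u hTo)
  have key : S - single 1 (S 1) = 0 := by
    refine Λ.eq_zero_of_comm hh u (hSI.sub (coeffIn_single (hSI 1))) fun k hk => ?_
    have hpos : (S - single 1 (S 1)).PosPart :=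
      (PosPart.curvature hP.pos).sub (posPart_single le_rfl _)
    rcases lt_trichotomy k 1 with h1 | rfl | h1
    · exact Or.inl (hpos k h1)
    · left; rw [sub_coeff, single_coeff_self, sub_self]
    · right
      have hSk : S.OrdLE k := by
        have := hk.add ((ordLE_single 1 (S 1)).mono h1.le)
        rwa [sub_add_cancel] at this
      have hN := hL.sub_opA1_ordLE
      -- If `S` has order at most `k` with `k > 1`, then `[A₁, S]` differs from `-[S, L]`, of order
      -- at most two, by a commutator with `L - A₁`, of order at most `k`; so it has no term of
      -- order `k + 1`.
      have e : Λ.opA1 h u * S - S * Λ.opA1 h u =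
          -(S * L - L * S) + (S * (L - Λ.opA1 h u) - (L - Λ.opA1 h u) * S) := by noncomm_ring
      have e2 : Λ.opA1 h u * (S - single 1 (S 1)) - (S - single 1 (S 1)) * Λ.opA1 h u =
          (Λ.opA1 h u * S - S * Λ.opA1 h u) -
          (Λ.opA1 h u * single 1 (S 1) - single 1 (S 1) * Λ.opA1 h u) := by noncomm_ring
      rw [e2, e, sub_coeff, add_coeff, neg_coeff, hSL _ (by omega), sub_coeff,
        hSk.mul hN _ (by omega), hN.mul hSk _ (by omega),
        Λ.comm_opA1_ordLE h u (ordLE_single 1 (S 1)) _ (by omega)]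
      simp
  exact sub_eq_zero.1 key

/-- Replacing `P` and `L` by their backgrounds leaves `bg_eqn`, up to decaying coefficients. -/
lemma rhs_coeffIn (hh : h ≠ 0) (hu : Λ.IsPotential u) (hP : Λ.IsFlow h u P p q) :
    (P * Λ.lax h u - Λ.lax h u * P + aeval (Λ.lax h u) (sym h q)).CoeffIn Λ.I := by
  have hL := lax_sub_bgL_coeffIn hh hu
  have := ((Λ.coeffIn_mul_sub hP.asym hL).sub (Λ.coeffIn_mul_sub hL hP.asym)).add
    (aeval_sub_coeffIn hL (sym h q))
  rw [← sub_zero (_ + _), ← Λ.bg_eqn hh p q]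
  convert this using 1
  abel

/-- An operator is determined by its symbol. -/
lemma eq (hh : h ≠ 0) (hu : Λ.IsPotential u) (hP : Λ.IsFlow h u P p q)
    (hQ : Λ.IsFlow h u Q p q) : P = Q := by
  have hL := (Λ.isLax_lax hh hu).sub_opA1_ordLE
  rw [← sub_eq_zero]
  have hI : (P - Q).CoeffIn Λ.I := by
    rw [← sub_sub_sub_cancel_right _ _ (Λ.bg h p q)]
    exact hP.asym.sub hQ.asym
  refine Λ.eq_zero_of_comm hh u hI fun k hk => ?_
  by_cases h1 : k < 1
  · exact Or.inl ((hP.pos.sub hQ.pos) k h1)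
  · right
    -- In the difference of the two right-hand sides the polynomial in `L` cancels, and `[P - Q, L]`
    -- of order at most one remains. Its coefficient at `k + 1 ≥ 2` is that of `[P - Q, A₁]`, as `L
    -- - A₁` has order at most zero.
    have hc := hP.eqn.sub hQ.eqn
    have e : Λ.opA1 h u * (P - Q) - (P - Q) * Λ.opA1 h u =
        ((P - Q) * (Λ.lax h u - Λ.opA1 h u) - (Λ.lax h u - Λ.opA1 h u) * (P - Q)) -
        (P * Λ.lax h u - Λ.lax h u * P + aeval (Λ.lax h u) (sym h q) -
        (Q * Λ.lax h u - Λ.lax h u * Q + aeval (Λ.lax h u) (sym h q))) := by noncomm_ring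
    rw [e, sub_coeff, sub_coeff, hc _ (by omega), hk.mul hL _ (by omega), hL.mul hk _ (by omega)]
    simp

lemma add (hP : Λ.IsFlow h u P p q) (hQ : Λ.IsFlow h u Q p' q') :
    Λ.IsFlow h u (P + Q) (p + p') (q + q') where
  pos := hP.pos.add hQ.pos
  asym := by
    have : P + Q - Λ.bg h (p + p') (q + q') = (P - Λ.bg h p q) + (Q - Λ.bg h p' q') := by
      simp only [bg, map_add, mul_add]; abel
    rw [this]; exact hP.asym.add hQ.asym
  eqn := by
    have : (P + Q) * Λ.lax h u - Λ.lax h u * (P + Q) + aeval (Λ.lax h u) (sym h (q + q')) =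
        (P * Λ.lax h u - Λ.lax h u * P + aeval (Λ.lax h u) (sym h q)) +
        (Q * Λ.lax h u - Λ.lax h u * Q + aeval (Λ.lax h u) (sym h q')) := by
      rw [sym_add, map_add, add_mul, mul_add]; abel
    rw [this]; exact hP.eqn.add hQ.eqn

lemma smul (c : ℝ) (hP : Λ.IsFlow h u P p q) : Λ.IsFlow h u (c • P) (c • p) (c • q) where
  pos := hP.pos.smul c
  asym := by
    have : c • P - Λ.bg h (c • p) (c • q) = c • (P - Λ.bg h p q) := by
      simp only [bg, map_smul, mul_smul_comm, smul_sub, smul_add]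
    rw [this]; exact hP.asym.smul c
  eqn := by
    have : c • P * Λ.lax h u - Λ.lax h u * (c • P) + aeval (Λ.lax h u) (sym h (c • q)) =
        c • (P * Λ.lax h u - Λ.lax h u * P + aeval (Λ.lax h u) (sym h q)) := by
      rw [sym_smul, map_smul, smul_mul_assoc, mul_smul_comm, smul_add, smul_sub]
    rw [this]; exact hP.eqn.smul c

end IsFlow

/-! ### The isospectral operators -/

lemma bgL_pow_posPart {m : ℕ} (hm : 1 ≤ m) : (Λ.bgL h ^ m).PosPart := by
  rw [bgL_pow]; exact posPart_single (by omega) _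

/-- `L^m` commutes with `L`, so `[A_m, L] = [L, L^m - A_m]`, and `L^m - A_m` has order at most zero.
-/
lemma isFlow_opA (hh : h ≠ 0) {u : Rˣ} (hu : Λ.IsPotential u) {m : ℕ} (hm : 1 ≤ m) :
    Λ.IsFlow h u (hiPart 1 (Λ.lax h u ^ m)) (X ^ m) 0 where
  pos := posPart_hiPart _
  asym := by
    intro j
    have hL := Λ.coeffIn_pow_sub (lax_sub_bgL_coeffIn hh hu) m j
    have hb : Λ.bg h (X ^ m) 0 = Λ.bgL h ^ m := by simp [bg]
    rw [hb, sub_coeff, hiPart_coeff]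
    split_ifs with hj
    · exact hL
    · rw [bgL_pow_posPart hm j (by omega), sub_zero]; exact Λ.I.zero_mem
  eqn := by
    have h1 := sub_hiPart_ordLE (k := 1) (l := 0) rfl (Λ.lax h u ^ m)
    have h2 := (Λ.isLax_lax hh hu).order
    have e : hiPart 1 (Λ.lax h u ^ m) * Λ.lax h u - Λ.lax h u * hiPart 1 (Λ.lax h u ^ m) +
        aeval (Λ.lax h u) (sym h 0) = Λ.lax h u * (Λ.lax h u ^ m - hiPart 1 (Λ.lax h u ^ m)) -
        (Λ.lax h u ^ m - hiPart 1 (Λ.lax h u ^ m)) * Λ.lax h u := by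
      rw [mul_sub, sub_mul, ← pow_succ, ← pow_succ', sym, mul_zero, map_zero]; abel
    rw [e]
    exact (h2.mul h1).sub (h1.mul h2)

/-! ### The nonisospectral operators -/

variable (Λ h)

/-- The right-hand side `[B, L] + h L^m + L^(m-1)`. -/
def nonisoRhs (m : ℕ) (u : Rˣ) (B : PDO Λ.E) : PDO Λ.E :=
  B * Λ.lax h u - Λ.lax h u * B + h • Λ.lax h u ^ m + Λ.lax h u ^ (m - 1)

/-- The coefficients of the background operator. -/
def bgB (m : ℕ) : PDO Λ.E := single (m : ℤ) ((h ^ (m - 1))⁻¹ • Λ.xCoord) +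
  single ((m : ℤ) - 1) ((h ^ (m - 1))⁻¹ • (Λ.xCoord + h • Λ.nCoord))

/-- The truncations of `B_m`. -/
def truncB (m : ℕ) (u : Rˣ) : ℕ → PDO Λ.E
  | 0 => 0
  | r + 1 =>
    let T := truncB m u r
    let j : ℤ := m - r
    let f := Λ.nonisoRhs h m u T (j + 1)
    let b := Λ.bgB h m j
    T + single j (Λ.weight u j *
      (b + Λ.dInv (h • f * ((Λ.weight u (j + 1))⁻¹ : Rˣ) - (Λ.E b - b))))

variable {Λ h}

/-- The prescribed asymptotics of `B_m` are `G (h⁻¹Δ)^(m-1)`; this is why its symbol is `(0,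
z^(m-1))`. -/
lemma bgB_eq {m : ℕ} (hm : 1 ≤ m) : Λ.bgB h m = Λ.bg h 0 (X ^ (m - 1)) := by
  rw [bg, bgB, map_zero, zero_add, map_pow, aeval_X, bgL_pow, bgG, add_mul, single_mul_single_const,
    single_mul_single_const, inv_pow, Nat.cast_sub hm]
  congr 2 <;> push_cast <;> ring

lemma bgB_coeff_of_lt {m : ℕ} {j : ℤ} (hj : j < (m : ℤ) - 1) : Λ.bgB h m j = 0 := by
  rw [bgB, add_coeff, single_coeff_ne _ (by omega), single_coeff_ne _ (by omega), add_zero]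

lemma bgB_ordLE (m : ℕ) : (Λ.bgB h m).OrdLE m :=
  (ordLE_single _ _).add ((ordLE_single _ _).mono (by omega))

lemma nonisoRhs_eq {m : ℕ} (hm : 1 ≤ m) (u : Rˣ) (B : PDO Λ.E) : Λ.nonisoRhs h m u B =
    B * Λ.lax h u - Λ.lax h u * B + aeval (Λ.lax h u) (sym h (X ^ (m - 1))) := by
  rw [nonisoRhs, aeval_sym, map_pow, aeval_X, add_mul, one_mul, smul_mul_assoc, ← pow_succ',
    Nat.sub_add_cancel hm]
  abel

/-- The source term in the recursion for `B_m` is decaying. -/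
lemma truncB_source_mem (hh : h ≠ 0) {u : Rˣ} (hu : Λ.IsPotential u) {m : ℕ} (hm : 1 ≤ m) {j : ℤ}
    {T : PDO Λ.E} (h1 : T j = 0) (h3 : ∀ i, j < i → T i - Λ.bgB h m i ∈ Λ.I) :
    h • Λ.nonisoRhs h m u T (j + 1) * ((Λ.weight u (j + 1))⁻¹ : Rˣ) -
      (Λ.E (Λ.bgB h m j) - Λ.bgB h m j) ∈ Λ.I := by
  set f := Λ.nonisoRhs h m u T (j + 1) with hf
  set b := Λ.bgB h m j with hb
  set w' : Rˣ := (Λ.weight u (j + 1))⁻¹ with hw'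
  have hL := lax_sub_bgL_coeffIn hh hu
  have hw'I : Λ.IsPotential w' := Λ.isPotential_inv (Λ.isPotential_weight hu _)
  -- the inhomogeneity agrees with its background value modulo decaying functions
  have hfI : f - h⁻¹ • (Λ.E b - b) ∈ Λ.I := by
    set W := Λ.bgB h m - T with hW
    have hWo : (W - hiPart (j + 1) W).OrdLE j := sub_hiPart_ordLE rfl W
    have hWI : (hiPart (j + 1) W).CoeffIn Λ.I := by
      intro i
      rw [hiPart_coeff]
      split_ifs with hi
      · rw [hW, sub_coeff, ← neg_sub]
        exact Λ.I.neg_mem (h3 i (by omega))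
      · exact Λ.I.zero_mem
    have hWj : (W - hiPart (j + 1) W) j = b := by
      rw [sub_coeff, hiPart_coeff, if_neg (by omega), hW, sub_coeff, h1, sub_zero,
        sub_zero]
    have e0 := Λ.bg_eqn hh 0 (X ^ (m - 1))
    rw [← bgB_eq hm] at e0
    -- `T` is the background minus `W`, and `bg_eqn` removes the background. The part of `W` of
    -- order at most `j` contributes exactly `h⁻¹ • (E b - b)` at order `j + 1`; everything else is
    -- decaying.
    have e1 : Λ.nonisoRhs h m u T = (T * Λ.lax h u - T * Λ.bgL h) -
        (Λ.lax h u * T - Λ.bgL h * T) + (aeval (Λ.lax h u) (sym h (X ^ (m - 1))) -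
        aeval (Λ.bgL h) (sym h (X ^ (m - 1)))) +
        (Λ.bgL h * hiPart (j + 1) W - hiPart (j + 1) W * Λ.bgL h) +
        (Λ.bgL h * (W - hiPart (j + 1) W) - (W - hiPart (j + 1) W) * Λ.bgL h) := by
      rw [nonisoRhs_eq hm, ← sub_zero (_ + _ : PDO Λ.E), ← e0, hW]
      noncomm_ring
    have e2 := Λ.comm_opA1_top h 1 hWo
    have e3 : Λ.opA1 h 1 = Λ.bgL h := by
      rw [opA1, bgL, Algebra.algebraMap_eq_smul_one]
    rw [e3, hWj, map_one, one_mul, mul_one] at e2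
    rw [hf, e1, add_coeff, e2, add_sub_cancel_right]
    refine CoeffIn.add (CoeffIn.add (CoeffIn.sub ?_ ?_) (aeval_sub_coeffIn hL _)) ?_ _
    · rw [← mul_sub]; exact Λ.coeffIn_mul_left _ hL
    · rw [← sub_mul]; exact hL.mul_right _
    · exact (Λ.coeffIn_mul_left _ hWI).sub (hWI.mul_right _)
  have : h • f * (w' : R) - (Λ.E b - b) =
      h • f * ((w' : R) - 1) + h • (f - h⁻¹ • (Λ.E b - b)) := by
    rw [smul_sub, smul_smul, mul_inv_cancel₀ hh, one_smul]; ring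
  rw [this]
  exact Λ.I.add_mem (Λ.I.mul_mem_left _ hw'I) (Λ.smul_mem _ hfI)

/-- Each new coefficient removes the right-hand side at one further order, as in the Lax recursion.
The difference is that the source does not decay; the increment of the background coefficient `b` is
subtracted before summation from `-∞`, and `b` is added back. -/
lemma truncB_spec (hh : h ≠ 0) {u : Rˣ} (hu : Λ.IsPotential u) {m : ℕ} (hm : 1 ≤ m) (r : ℕ) :
    (∀ j : ℤ, j ≤ m - r → Λ.truncB h m u r j = 0) ∧ (Λ.truncB h m u r).OrdLE m ∧
    (∀ j : ℤ, (m : ℤ) - r < j → Λ.truncB h m u r j - Λ.bgB h m j ∈ Λ.I) ∧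
    (Λ.nonisoRhs h m u (Λ.truncB h m u r)).OrdLE (m - r + 1) := by
  have hLo := (Λ.isLax_lax hh hu).order
  have hpow : ∀ n : ℕ, (Λ.lax h u ^ n).OrdLE n := by
    intro n
    induction n with
    | zero => rw [pow_zero, one_def]; exact ordLE_single _ _
    | succ n ih => rw [pow_succ]; exact_mod_cast ih.mul hLo
  induction r with
  | zero =>
    refine ⟨fun _ _ => rfl, ordLE_zero _, fun j hj => ?_, ?_⟩
    · rw [bgB_ordLE m j (by push_cast at hj; omega)]
      simp [truncB]
    · simp only [nonisoRhs, truncB, zero_mul, mul_zero, sub_zero, zero_add]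
      exact (((hpow m).smul h).mono (by push_cast; omega)).add ((hpow (m - 1)).mono (by omega))
  | succ r ih =>
    obtain ⟨h1, h2, h3, h4⟩ := ih
    set T := Λ.truncB h m u r with hT
    set j : ℤ := m - r with hj
    set f := Λ.nonisoRhs h m u T (j + 1) with hf
    set b := Λ.bgB h m j with hb
    set w' : Rˣ := (Λ.weight u (j + 1))⁻¹ with hw'
    have hfI' : h • f * (w' : R) - (Λ.E b - b) ∈ Λ.I := truncB_source_mem hh hu hm (h1 _ le_rfl) h3
    set c := Λ.dInv (h • f * (w' : R) - (Λ.E b - b)) with hc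
    have hcI : c ∈ Λ.I := Λ.dInv_mem _ hfI'
    have hT' : Λ.truncB h m u (r + 1) = T + single j (Λ.weight u j * (b + c)) := rfl
    rw [hT']
    have ho : (single j (Λ.weight u j * (b + c)) : PDO Λ.E).OrdLE j := ordLE_single _ _
    refine ⟨fun i hi => ?_, h2.add (ho.mono (by omega)), fun i hi => ?_, ?_⟩
    · push_cast at hi
      rw [add_coeff, h1 i (by omega), single_coeff_ne _ (by omega), add_zero]
    · push_cast at hi
      rcases eq_or_ne i j with hij | hne
      · rw [hij, add_coeff, h1 _ le_rfl, single_coeff_self, zero_add]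
        have : (Λ.weight u j : R) * (b + c) - b = (Λ.weight u j - 1 : R) * b + Λ.weight u j * c := by
          ring
        rw [this]
        exact Λ.I.add_mem (Λ.I.mul_mem_right _ (Λ.isPotential_weight hu _))
          (Λ.I.mul_mem_left _ hcI)
      · rw [add_coeff, single_coeff_ne _ hne, add_zero]
        exact h3 i (by omega)
    · set g : PDO Λ.E := single j (Λ.weight u j * (b + c)) with hg
      have hN := (Λ.isLax_lax hh hu).sub_opA1_ordLE
      have e : Λ.nonisoRhs h m u (T + g) = Λ.nonisoRhs h m u T -
          (Λ.opA1 h u * g - g * Λ.opA1 h u) +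
          (g * (Λ.lax h u - Λ.opA1 h u) - (Λ.lax h u - Λ.opA1 h u) * g) := by
        simp only [nonisoRhs]; noncomm_ring
      intro i hi
      push_cast at hi
      rw [e, add_coeff, sub_coeff, sub_coeff (g * _), ho.mul hN i (by omega),
        hN.mul ho i (by omega), sub_zero, add_zero]
      rcases eq_or_ne i (j + 1) with rfl | hne
      · have htop := Λ.comm_opA1_top h u ho
        have hE : Λ.E (b + c) - (b + c) = h • f * (w' : R) := by
          rw [map_add, hc, Λ.E_dInv _ hfI']; ring
        rw [single_coeff_self, weight_conj, hE, mul_comm (h • f), ← mul_assoc, hw', Units.mul_inv,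
          one_mul, smul_smul, inv_mul_cancel₀ hh, one_smul] at htop
        rw [← hf, sub_eq_zero]
        exact htop.symm
      · rw [h4 i (by omega), Λ.comm_opA1_ordLE h u ho i (by omega), sub_zero]

/-- After `m` steps the right-hand side has order at most one. For `m ≥ 2` the background only
involves `Δ^m` and `Δ^(m-1)`, so no power below `Δ` is required. -/
lemma isFlow_truncB (hh : h ≠ 0) {u : Rˣ} (hu : Λ.IsPotential u) {m : ℕ} (hm : 2 ≤ m) :
    Λ.IsFlow h u (Λ.truncB h m u m) 0 (X ^ (m - 1)) := by
  obtain ⟨h1, h2, h3, h4⟩ := truncB_spec hh hu (by omega : 1 ≤ m) m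
  rw [sub_self] at h1 h3 h4
  refine ⟨fun j hj => h1 j (by omega), fun j => ?_, ?_⟩
  · rw [← bgB_eq (by omega)]
    by_cases hj : 0 < j
    · exact h3 j hj
    · rw [sub_coeff, h1 j (by omega), bgB_coeff_of_lt (by omega), sub_zero]; exact Λ.I.zero_mem
  · rw [← nonisoRhs_eq (by omega)]
    exact h4

end LatticeDiff
end PseudoDiff

/-! ### First-order jets of families of potentials, and the bracket of two flows. -/

namespace PseudoDiff
open PDO Polynomial

variable {R : Type*} [CommRing R] [Algebra ℝ R]

/-- First-order jets of one-parameter families: evaluation `π` at a parameter value, and the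
derivative `δ` with respect to the parameter at that value. -/
structure Jet (Λ : LatticeDiff R) where
  π : R →ₐ[ℝ] R
  δ : R →ₗ[ℝ] R
  δ_mul : ∀ f g, δ (f * g) = δ f * π g + π f * δ g
  π_E : ∀ f, π (Λ.E f) = Λ.E (π f)
  δ_E : ∀ f, δ (Λ.E f) = Λ.E (δ f)
  π_d : ∀ f, π (Λ.d f) = Λ.d (π f)
  δ_d : ∀ f, δ (Λ.d f) = Λ.d (δ f)
  π_mem : ∀ f ∈ Λ.I, π f ∈ Λ.I
  δ_mem : ∀ f ∈ Λ.I, δ f ∈ Λ.I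
  π_x : π Λ.xCoord = Λ.xCoord
  π_n : π Λ.nCoord = Λ.nCoord
  δ_x : δ Λ.xCoord = 0
  δ_n : δ Λ.nCoord = 0

namespace Jet

open LatticeDiff

variable {Λ : LatticeDiff R} (J : Jet Λ)

/-- Evaluation of families of operators. -/
def opπ : PDO Λ.E →ₐ[ℝ] PDO Λ.E := mapHom Λ.E J.π J.π_E

/-- The parameter derivative of families of operators. -/
def opδ : PDO Λ.E →ₗ[ℝ] PDO Λ.E := mapLin Λ.E J.δ

@[simp] lemma opπ_coeff (P : PDO Λ.E) (j : ℤ) : J.opπ P j = J.π (P j) := rfl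
@[simp] lemma opδ_coeff (P : PDO Λ.E) (j : ℤ) : J.opδ P j = J.δ (P j) := rfl

lemma opδ_mul (P Q : PDO Λ.E) : J.opδ (P * Q) = J.opδ P * J.opπ Q + J.opπ P * J.opδ Q :=
  mapC_mul_of_leibniz (E := Λ.E) (E' := Λ.E) J.δ J.π.toLinearMap J.π.toLinearMap J.π_E J.δ_E
    J.δ_mul P Q

lemma opπ_ordLE {P : PDO Λ.E} {k : ℤ} (hP : P.OrdLE k) : (J.opπ P).OrdLE k :=
  OrdLE.map J.π.toLinearMap hP
lemma opδ_ordLE {P : PDO Λ.E} {k : ℤ} (hP : P.OrdLE k) : (J.opδ P).OrdLE k := OrdLE.map J.δ hP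
lemma opπ_posPart {P : PDO Λ.E} (hP : P.PosPart) : (J.opπ P).PosPart :=
  PosPart.map J.π.toLinearMap hP
lemma opδ_posPart {P : PDO Λ.E} (hP : P.PosPart) : (J.opδ P).PosPart := PosPart.map J.δ hP
lemma opπ_coeffIn {P : PDO Λ.E} (hP : P.CoeffIn Λ.I) : (J.opπ P).CoeffIn Λ.I :=
  fun j => J.π_mem _ (hP j)
lemma opδ_coeffIn {P : PDO Λ.E} (hP : P.CoeffIn Λ.I) : (J.opδ P).CoeffIn Λ.I :=
  fun j => J.δ_mem _ (hP j)

lemma opπ_single (a : ℤ) (p : R) : J.opπ (single a p) = single a (J.π p) := mapC_single _ _ _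
lemma opδ_single (a : ℤ) (p : R) : J.opδ (single a p) = single a (J.δ p) := mapC_single _ _ _

lemma opπ_opD (P : PDO Λ.E) : J.opπ (Λ.opD P) = Λ.opD (J.opπ P) := ext' fun _ => J.π_d _
lemma opδ_opD (P : PDO Λ.E) : J.opδ (Λ.opD P) = Λ.opD (J.opδ P) := ext' fun _ => J.δ_d _

lemma δ_one : J.δ 1 = 0 := by
  have := J.δ_mul 1 1
  simpa using this

lemma δ_algebraMap (c : ℝ) : J.δ (algebraMap ℝ R c) = 0 := by
  rw [Algebra.algebraMap_eq_smul_one, map_smul, δ_one, smul_zero]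

variable {h : ℝ}

lemma opπ_bgL : J.opπ (Λ.bgL h) = Λ.bgL h := by
  rw [bgL, opπ_single, AlgHom.commutes]

lemma opπ_bg (p q : ℝ[X]) : J.opπ (Λ.bg h p q) = Λ.bg h p q := by
  rw [bg, map_add, map_mul, ← aeval_algHom_apply, ← aeval_algHom_apply, opπ_bgL, bgG, map_add,
    opπ_single, opπ_single, map_add, map_smul, J.π_x, J.π_n]

lemma opδ_pow_of_eq_zero {P : PDO Λ.E} (hP : J.opδ P = 0) (n : ℕ) : J.opδ (P ^ n) = 0 := by
  induction n with
  | zero => rw [pow_zero, one_def, opδ_single, δ_one, single_zero]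
  | succ n ih => rw [pow_succ, opδ_mul, ih, hP, zero_mul, mul_zero, add_zero]

lemma opδ_aeval_of_eq_zero {P : PDO Λ.E} (hP : J.opδ P = 0) (p : ℝ[X]) :
    J.opδ (aeval P p) = 0 := by
  induction p using Polynomial.induction_on' with
  | add p q hp hq => rw [map_add, map_add, hp, hq, add_zero]
  | monomial n a =>
    rw [aeval_monomial, ← Algebra.smul_def, map_smul, J.opδ_pow_of_eq_zero hP, smul_zero]

lemma opδ_bg (p q : ℝ[X]) : J.opδ (Λ.bg h p q) = 0 := by
  have h1 : J.opδ (Λ.bgL h) = 0 := by rw [bgL, opδ_single, δ_algebraMap, single_zero]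
  have h2 : J.opδ (Λ.bgG h) = 0 := by
    rw [bgG, map_add, opδ_single, opδ_single, map_add, map_smul, J.δ_x, J.δ_n]; simp
  rw [bg, map_add, opδ_mul, J.opδ_aeval_of_eq_zero h1, J.opδ_aeval_of_eq_zero h1, h2]
  simp

section Families

variable {u w : Rˣ}

lemma opπ_opA1 (hw : J.π w = u) : J.opπ (Λ.opA1 h w) = Λ.opA1 h u := by
  rw [opA1, opπ_single, map_smul, hw, opA1]

/-- Evaluation preserves all the properties that characterize the Lax operator, so uniqueness
identifies the result and the recursion need not be followed. -/
lemma opπ_lax (hh : h ≠ 0) (hu : Λ.IsPotential u) (hwI : Λ.IsPotential w) (hw : J.π w = u) :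
    J.opπ (Λ.lax h w) = Λ.lax h u := by
  have hL := Λ.isLax_lax hh hwI
  refine IsLax.eq_lax Λ hh hu ⟨J.opπ_ordLE hL.order, ?_, fun j hj => J.π_mem _ (hL.decay j hj), ?_⟩
  · rw [opπ_coeff, hL.leading, map_smul, hw]
  · rw [← opπ_opD, hL.eqn, map_sub, map_mul, map_mul, J.opπ_opA1 hw]

lemma isFlow_opπ (hh : h ≠ 0) (hu : Λ.IsPotential u) (hwI : Λ.IsPotential w) (hw : J.π w = u)
    {P : PDO Λ.E} {p q : ℝ[X]} (hP : Λ.IsFlow h w P p q) : Λ.IsFlow h u (J.opπ P) p q where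
  pos := J.opπ_posPart hP.pos
  asym := by
    rw [← J.opπ_bg p q, ← map_sub]
    exact J.opπ_coeffIn hP.asym
  eqn := by
    have := J.opπ_ordLE hP.eqn
    rwa [map_add, map_sub, map_mul, map_mul, ← aeval_algHom_apply,
      J.opπ_lax hh hu hwI hw] at this

/-- The background is built from constants and the coordinates, none of which depends on the
parameter; only the decaying part of `P` is differentiated. -/
lemma opδ_coeffIn_of_isFlow {P : PDO Λ.E} {p q : ℝ[X]} (hP : Λ.IsFlow h w P p q) :
    (J.opδ P).CoeffIn Λ.I := by
  have := J.opδ_coeffIn hP.asym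
  rwa [map_sub, opδ_bg, sub_zero] at this

/-- Along a family whose velocity is a flow, the Lax operator satisfies the Lax equation. -/
theorem opδ_lax (hh : h ≠ 0) (hu : Λ.IsPotential u) (hwI : Λ.IsPotential w) (hw : J.π w = u)
    {Q : PDO Λ.E} {p q : ℝ[X]} (hQ : Λ.IsFlow h u Q p q)
    (hδ : J.δ w = h • Λ.curvature h u Q 1) :
    J.opδ (Λ.lax h w) = Q * Λ.lax h u - Λ.lax h u * Q + aeval (Λ.lax h u) (sym h q) := by
  have hL := Λ.isLax_lax hh hwI
  -- By the zero curvature equation the coefficient of `Δ` is the whole curvature, so `A₁` moves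
  -- with velocity `curvature h u Q`.
  have hA : J.opδ (Λ.opA1 h w) = Λ.curvature h u Q := by
    rw [hQ.curvature_eq hh hu, opA1, opδ_single, map_smul, hδ, smul_smul, inv_mul_cancel₀ hh,
      one_smul]
  -- Both sides are decaying and solve `W_x = [S, L] + [A₁, W]` with `S` the curvature of `Q`.
  refine Λ.eq_of_linearized hh u ?_ (hQ.rhs_coeffIn hh hu) ?_ (IsFlow.opD_rhs hh hu Q q)
  · have := J.opδ_coeffIn hL.sub_opA1_coeffIn
    rw [map_sub, hA] at this
    have := this.add (hQ.curvature_coeffIn hh hu)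
    rwa [sub_add_cancel] at this
  · rw [← opδ_opD, hL.eqn, map_sub, opδ_mul, opδ_mul, hA, J.opπ_lax hh hu hwI hw,
      J.opπ_opA1 hw]
    abel

/-- The chain rule: the commutator with `Q` is a derivation, and the inhomogeneity `((1 + hz) q)(L)`
commutes with `L`, so it appears multiplied by `f'(L)`. -/
lemma opδ_aeval_lax (hh : h ≠ 0) (hu : Λ.IsPotential u) (hwI : Λ.IsPotential w) (hw : J.π w = u)
    {Q : PDO Λ.E} {p q : ℝ[X]} (hQ : Λ.IsFlow h u Q p q)
    (hδ : J.δ w = h • Λ.curvature h u Q 1) (f : ℝ[X]) :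
    J.opδ (aeval (Λ.lax h w) f) = Q * aeval (Λ.lax h u) f - aeval (Λ.lax h u) f * Q +
      aeval (Λ.lax h u) (derivative f * sym h q) := by
  have hD := J.opδ_lax hh hu hwI hw hQ hδ
  have hπ := J.opπ_lax hh hu hwI hw
  set L := Λ.lax h u
  have hn : ∀ n : ℕ, J.opδ (Λ.lax h w ^ n) = Q * L ^ n - L ^ n * Q +
      aeval L (derivative (X ^ n) * sym h q) := by
    intro n
    induction n with
    | zero => rw [pow_zero, one_def, opδ_single, δ_one, single_zero]; simp
    | succ n ih =>
      have e : derivative (X ^ (n + 1) : ℝ[X]) * sym h q =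
          (derivative (X ^ n) * sym h q) * X + X ^ n * sym h q := by
        rw [pow_succ (X : ℝ[X]), derivative_mul, derivative_X]; ring
      have e' : aeval L (derivative (X ^ (n + 1)) * sym h q) =
          aeval L (derivative (X ^ n) * sym h q) * L + L ^ n * aeval L (sym h q) := by
        rw [e, map_add, map_mul (aeval L) _ X, aeval_X, map_mul (aeval L) (X ^ n),
          map_pow (aeval L), aeval_X]
      rw [e', pow_succ, opδ_mul, ih, hD, map_pow J.opπ, hπ, pow_succ]
      noncomm_ring
  induction f using Polynomial.induction_on' with
  | add p q hp hq =>
    rw [map_add, map_add, hp, hq, map_add, map_add, add_mul (derivative p), map_add]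
    noncomm_ring
  | monomial n a =>
    have e1 : ∀ M : PDO Λ.E, aeval M (monomial n a) = a • M ^ n := fun M => by
      rw [aeval_monomial, Algebra.smul_def]
    have e2 : derivative (monomial n a : ℝ[X]) = a • derivative (X ^ n) := by
      rw [← derivative_smul, ← C_mul_X_pow_eq_monomial, smul_eq_C_mul]
    rw [e1, e1, e2, map_smul, hn, smul_mul_assoc, smul_mul_assoc, map_smul (aeval L),
      mul_smul_comm, smul_add, smul_sub]

end Families

/-- The commutator of two flows is a flow, whose symbol is the commutator of the symbols. -/
theorem isFlow_bracket (hh : h ≠ 0) {u wP wQ : Rˣ} (hu : Λ.IsPotential u)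
    (hwP : Λ.IsPotential wP) (hwQ : Λ.IsPotential wQ) {P Q P' Q' : PDO Λ.E} {p q p' q' : ℝ[X]}
    (hP : Λ.IsFlow h u P p q) (hQ : Λ.IsFlow h u Q p' q')
    (hP' : Λ.IsFlow h wQ P' p q) (hQ' : Λ.IsFlow h wP Q' p' q')
    (hπP : J.π wP = u) (hπQ : J.π wQ = u)
    (hδP : J.δ wP = h • Λ.curvature h u P 1) (hδQ : J.δ wQ = h • Λ.curvature h u Q 1) :
    ∃ Z, Λ.IsFlow h u Z (derivative p * sym h q' - derivative p' * sym h q)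
        (sym h (derivative q * q' - derivative q' * q)) ∧
      J.δ (Λ.curvature h wQ P' 1) - J.δ (Λ.curvature h wP Q' 1) = Λ.curvature h u Z 1 := by
  have hπP' : J.opπ P' = P := (J.isFlow_opπ hh hu hwQ hπQ hP').eq hh hu hP
  have hπQ' : J.opπ Q' = Q := (J.isFlow_opπ hh hu hwP hπP hQ').eq hh hu hQ
  have hLQ := J.opδ_lax hh hu hwQ hπQ hQ hδQ
  have hLP := J.opδ_lax hh hu hwP hπP hP hδP
  have hfQ := J.opδ_aeval_lax hh hu hwQ hπQ hQ hδQ (sym h q)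
  have hfP := J.opδ_aeval_lax hh hu hwP hπP hP hδP (sym h q')
  -- The generator combines the derivative of `P` along the flow of `Q`, that of `Q` along the flow
  -- of `P`, and the commutator of `P` and `Q`.
  refine ⟨J.opδ P' - J.opδ Q' + (P * Q - Q * P), ⟨?_, ?_, ?_⟩, ?_⟩
  · exact ((J.opδ_posPart hP'.pos).sub (J.opδ_posPart hQ'.pos)).add
      ((hP.pos.mul hQ.pos).sub (hQ.pos.mul hP.pos))
  · rw [← Λ.bg_comm hh]
    have := ((J.opδ_coeffIn_of_isFlow hP').sub (J.opδ_coeffIn_of_isFlow hQ')).add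
      ((Λ.coeffIn_mul_sub hP.asym hQ.asym).sub (Λ.coeffIn_mul_sub hQ.asym hP.asym))
    convert this using 1
    abel
  · have h1 := J.opδ_ordLE hP'.eqn
    have h2 := J.opδ_ordLE hQ'.eqn
    rw [map_add, map_sub, opδ_mul, opδ_mul, hLQ, hfQ, hπP', J.opπ_lax hh hu hwQ hπQ] at h1
    rw [map_add, map_sub, opδ_mul, opδ_mul, hLP, hfP, hπQ', J.opπ_lax hh hu hwP hπP] at h2
    -- The terms in which the factor `1 + hz` is differentiated cancel by antisymmetry.
    have e : sym h (sym h (derivative q * q' - derivative q' * q)) =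
        derivative (sym h q) * sym h q' - derivative (sym h q') * sym h q := by
      simp only [sym, derivative_mul, derivative_add, derivative_one, derivative_C, derivative_X]
      ring
    rw [e, map_sub]
    -- The derivatives of the two right-hand sides, of order at most one, are subtracted; by the
    -- Jacobi identity what remains is the right-hand side for the new generator.
    convert h1.sub h2 using 1
    noncomm_ring
  · have hA : ∀ {w : Rˣ} {S : PDO Λ.E} {a b : ℝ[X]}, Λ.IsFlow h u S a b →
        J.δ w = h • Λ.curvature h u S 1 → J.opδ (Λ.opA1 h w) = Λ.curvature h u S := by
      intro w S a b hS hw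
      rw [hS.curvature_eq hh hu, opA1, opδ_single, map_smul, hw, smul_smul, inv_mul_cancel₀ hh,
        one_smul]
    rw [← opδ_coeff, ← opδ_coeff, ← sub_coeff]
    congr 1
    rw [curvature, curvature, map_sub, map_add, map_sub, map_add, opδ_mul, opδ_mul, opδ_mul,
      opδ_mul, hA hQ hδQ, hA hP hδP, J.opπ_opA1 hπP, J.opπ_opA1 hπQ, hπP', hπQ', opδ_opD, opδ_opD,
      curvature, curvature, curvature, map_add, map_sub, map_sub, opD_mul, opD_mul]
    noncomm_ring

end Jet
end PseudoDiff

namespace DDmKP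
open Set

/-! ## Rapidly decreasing families -/

section RapidDecrease

variable {P : Type*} [NormedAddCommGroup P] [NormedSpace ℝ P]

/-- A bound of `iteratedFDeriv` on compact sets. -/
lemma exists_bound_iteratedFDeriv {F : Type*} [NormedAddCommGroup F] [NormedSpace ℝ F]
    {f : P → F} (hf : ContDiff ℝ ∞ f) {C : Set P} (hC : IsCompact C)
    (k : ℕ) : ∃ M, ∀ z ∈ C, ‖iteratedFDeriv ℝ k f z‖ ≤ M :=
  hC.exists_bound_of_continuousOn
    (hf.continuous_iteratedFDeriv (m := k) (mod_cast le_top)).continuousOn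

lemma rapidlyDecreasing_contDiff {f : ℤ → P → ℝ} (hf : RapidlyDecreasing univ f) (n : ℤ) :
    ContDiff ℝ ∞ (f n) := contDiffOn_univ.1 (hf.1 n)

/-- Only finitely many `n` lie between `-m` and `0`, and each `f n` has bounded derivatives on
compact sets. -/
lemma rapidlyDecreasing_of_eventually {f : ℤ → P → ℝ} (h1 : ∀ n, ContDiff ℝ ∞ (f n))
    (h2 : ∀ C : Set P, IsCompact C → ∀ p k : ℕ, ∃ (m : ℕ) (M : ℝ), ∀ n : ℤ, n ≤ -m → ∀ z ∈ C,
      |(n : ℝ)| ^ p * ‖iteratedFDeriv ℝ k (f n) z‖ ≤ M) : RapidlyDecreasing univ f := by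
  refine ⟨fun n => (h1 n).contDiffOn, fun C _ hC p k => ?_⟩
  obtain ⟨m, M, hM⟩ := h2 C hC p k
  choose B hB using fun n => exists_bound_iteratedFDeriv (h1 n) hC k
  refine ⟨max M (∑ n ∈ Finset.Icc (-(m : ℤ)) 0, |(n : ℝ)| ^ p * |B n|), fun n hn z hz => ?_⟩
  by_cases hnm : n ≤ -m
  · exact (hM n hnm z hz).trans (le_max_left _ _)
  · refine le_trans ?_ (le_max_right _ _)
    refine le_trans ?_ (Finset.single_le_sum (f := fun n : ℤ => |(n : ℝ)| ^ p * |B n|)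
      (fun i _ => by positivity) (Finset.mem_Icc.2 ⟨by omega, hn⟩))
    gcongr
    exact (hB n z hz).trans (le_abs_self _)

/-- Smooth families all of whose derivatives grow at most polynomially as `n → -∞`. -/
def Moderate (a : ℤ → P → ℝ) : Prop :=
  (∀ n, ContDiff ℝ ∞ (a n)) ∧ ∀ C : Set P, IsCompact C → ∀ k : ℕ, ∃ (m p : ℕ) (M : ℝ),
    ∀ n : ℤ, n ≤ -m → ∀ z ∈ C, ‖iteratedFDeriv ℝ k (a n) z‖ ≤ M * (1 + |(n : ℝ)| ^ p)

lemma RapidlyDecreasing.moderate {f : ℤ → P → ℝ} (hf : RapidlyDecreasing univ f) :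
    Moderate f := by
  refine ⟨rapidlyDecreasing_contDiff hf, fun C hC k => ?_⟩
  obtain ⟨M, hM⟩ := hf.2 C (subset_univ _) hC 0 k
  refine ⟨0, 0, M, fun n hn z hz => ?_⟩
  have h1 := hM n (by simpa using hn) z hz
  have h2 : 0 ≤ ‖iteratedFDeriv ℝ k (f n) z‖ := norm_nonneg _
  simp only [pow_zero, one_mul] at h1 ⊢
  linarith

lemma moderate_of_const {a : ℤ → P → ℝ} (h1 : ∀ n, ContDiff ℝ ∞ (a n)) {b : P → ℝ}
    (h2 : ∀ n ≤ 0, a n = b) : Moderate a := by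
  refine ⟨h1, fun C hC k => ?_⟩
  obtain ⟨M, hM⟩ := exists_bound_iteratedFDeriv (h1 0) hC k
  refine ⟨0, 0, M, fun n hn z hz => ?_⟩
  have h3 := hM z hz
  rw [h2 0 le_rfl] at h3
  rw [h2 n (by simpa using hn)]
  have : 0 ≤ ‖iteratedFDeriv ℝ k b z‖ := norm_nonneg _
  simp only [pow_zero]
  linarith

lemma moderate_intCast : Moderate (fun (n : ℤ) (_ : P) => (n : ℝ)) := by
  refine ⟨fun n => contDiff_const, fun C hC k => ⟨0, 1, 1, fun n hn z hz => ?_⟩⟩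
  rcases Nat.eq_zero_or_pos k with rfl | hk
  · rw [norm_iteratedFDeriv_zero, Real.norm_eq_abs, pow_one]; linarith
  · rw [iteratedFDeriv_const_of_ne hk.ne']
    simp only [Pi.zero_apply, norm_zero]; positivity

/-- In the Leibniz formula the polynomial growth of each derivative of `a` is absorbed by using the
decay of `f` with a larger exponent. -/
lemma RapidlyDecreasing.moderate_mul {a f : ℤ → P → ℝ} (ha : Moderate a)
    (hf : RapidlyDecreasing univ f) : RapidlyDecreasing univ (a * f) := by
  refine rapidlyDecreasing_of_eventually
    (fun n => (ha.1 n).mul (rapidlyDecreasing_contDiff hf n)) fun C hC q k => ?_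
  choose m p M hM using ha.2 C hC
  choose B hB using fun q i => hf.2 C (subset_univ _) hC q i
  refine ⟨∑ i ∈ Finset.range (k + 1), m i, ∑ i ∈ Finset.range (k + 1),
    (k.choose i : ℝ) * (|M i| * (B q (k - i) + B (p i + q) (k - i))), fun n hn z hz => ?_⟩
  have h0 : n ≤ 0 := hn.trans (by push_cast; simp; positivity)
  refine (mul_le_mul_of_nonneg_left (norm_iteratedFDeriv_mul_le (N := ∞) (ha.1 n)
    (rapidlyDecreasing_contDiff hf n) z (mod_cast le_top)) (by positivity)).trans ?_
  rw [Finset.mul_sum]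
  refine Finset.sum_le_sum fun i hi => ?_
  have hmi : m i ≤ ∑ i ∈ Finset.range (k + 1), m i :=
    Finset.single_le_sum (f := m) (fun _ _ => Nat.zero_le _) hi
  have h1 := hM i n (by omega) z hz
  have h2 := hB q (k - i) n h0 z hz
  have h3 := hB (p i + q) (k - i) n h0 z hz
  have h4 : M i * (1 + |(n : ℝ)| ^ p i) ≤ |M i| * (1 + |(n : ℝ)| ^ p i) := by
    gcongr; exact le_abs_self _
  set x := ‖iteratedFDeriv ℝ (k - i) (f n) z‖
  calc |(n : ℝ)| ^ q * ((k.choose i : ℝ) * ‖iteratedFDeriv ℝ i (a n) z‖ * x)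
      ≤ |(n : ℝ)| ^ q * ((k.choose i : ℝ) * (|M i| * (1 + |(n : ℝ)| ^ p i)) * x) := by
        gcongr; exact h1.trans h4
    _ = (k.choose i : ℝ) * (|M i| * (|(n : ℝ)| ^ q * x + |(n : ℝ)| ^ (p i + q) * x)) := by
        rw [pow_add]; ring
    _ ≤ _ := by gcongr

lemma RapidlyDecreasing.zero : RapidlyDecreasing univ (0 : ℤ → P → ℝ) :=
  rapidlyDecreasing_of_eventually (fun _ => contDiff_const) fun C _ p k => ⟨0, 0, fun n _ z _ => by
    have : iteratedFDeriv ℝ k ((0 : ℤ → P → ℝ) n) = 0 := iteratedFDeriv_fun_zero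
    rw [this]; simp⟩

lemma RapidlyDecreasing.add {f g : ℤ → P → ℝ} (hf : RapidlyDecreasing univ f)
    (hg : RapidlyDecreasing univ g) : RapidlyDecreasing univ (f + g) := by
  have hf' := rapidlyDecreasing_contDiff hf
  have hg' := rapidlyDecreasing_contDiff hg
  refine ⟨fun n => ((hf' n).add (hg' n)).contDiffOn, fun C hC' hC p k => ?_⟩
  obtain ⟨M, hM⟩ := hf.2 C hC' hC p k
  obtain ⟨N, hN⟩ := hg.2 C hC' hC p k
  refine ⟨M + N, fun n hn z hz => ?_⟩
  have : iteratedFDeriv ℝ k ((f + g) n) z =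
      iteratedFDeriv ℝ k (f n) z + iteratedFDeriv ℝ k (g n) z :=
    iteratedFDeriv_add_apply ((hf' n).contDiffAt.of_le (mod_cast le_top))
      ((hg' n).contDiffAt.of_le (mod_cast le_top))
  rw [this]
  calc |(n : ℝ)| ^ p * ‖iteratedFDeriv ℝ k (f n) z + iteratedFDeriv ℝ k (g n) z‖
      ≤ |(n : ℝ)| ^ p * (‖iteratedFDeriv ℝ k (f n) z‖ + ‖iteratedFDeriv ℝ k (g n) z‖) := by
        gcongr; exact norm_add_le _ _
    _ ≤ M + N := by rw [mul_add]; exact add_le_add (hM n hn z hz) (hN n hn z hz)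

lemma RapidlyDecreasing.shift {f : ℤ → P → ℝ} (hf : RapidlyDecreasing univ f) (a : ℤ) :
    RapidlyDecreasing univ (fun n => f (n + a)) := by
  refine rapidlyDecreasing_of_eventually (fun n => rapidlyDecreasing_contDiff hf _)
    fun C hC p k => ?_
  obtain ⟨M, hM⟩ := hf.2 C (subset_univ _) hC p k
  -- For `n ≤ -2|a|` one has `n + a ≤ 0` and `|n| ≤ 2|n + a|`.
  refine ⟨2 * a.natAbs, 2 ^ p * M, fun n hn z hz => ?_⟩
  have h1 : n + a ≤ 0 := by omega
  have h2 : |(n : ℝ)| ≤ 2 * |((n + a : ℤ) : ℝ)| := by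
    have : |n| ≤ 2 * |n + a| := by
      rw [abs_of_nonpos h1, abs_of_nonpos (by omega : n ≤ 0)]; omega
    exact_mod_cast this
  calc |(n : ℝ)| ^ p * ‖iteratedFDeriv ℝ k (f (n + a)) z‖
      ≤ (2 * |((n + a : ℤ) : ℝ)|) ^ p * ‖iteratedFDeriv ℝ k (f (n + a)) z‖ := by gcongr
    _ = 2 ^ p * (|((n + a : ℤ) : ℝ)| ^ p * ‖iteratedFDeriv ℝ k (f (n + a)) z‖) := by
        rw [mul_pow]; ring
    _ ≤ 2 ^ p * M := by gcongr; exact hM _ h1 z hz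

/-- Smooth changes of the parameter preserve rapid decrease. -/
lemma RapidlyDecreasing.comp {P' : Type*} [NormedAddCommGroup P'] [NormedSpace ℝ P'] {Ω : Set P}
    (hΩ : IsOpen Ω) {f : ℤ → P → ℝ} (hf : RapidlyDecreasing Ω f) {φ : P' → P}
    (hφ : ContDiff ℝ ∞ φ) (hm : ∀ z, φ z ∈ Ω) : RapidlyDecreasing univ (fun n z => f n (φ z)) := by
  refine ⟨fun n => ((hf.1 n).comp_contDiff hφ hm).contDiffOn, fun C _ hC p k => ?_⟩
  choose B hB using fun i =>
    hf.2 (φ '' C) (by rintro _ ⟨z, _, rfl⟩; exact hm z) (hC.image hφ.continuous) p i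
  choose D hD using fun i => exists_bound_iteratedFDeriv hφ hC i
  -- The estimate for derivatives of a composition requires the `i`-th derivative of `φ` to be
  -- bounded by `D' ^ i`; `D' ≥ 1` and `D' ≥ |D i|` suffice for all `1 ≤ i ≤ k`.
  set D' : ℝ := 1 + ∑ i ∈ Finset.range (k + 1), |D i| with hD'
  have hD1 : 1 ≤ D' := by
    have : 0 ≤ ∑ i ∈ Finset.range (k + 1), |D i| := by positivity
    linarith
  refine ⟨k.factorial * (∑ i ∈ Finset.range (k + 1), B i) * D' ^ k, fun n hn z hz => ?_⟩
  have hle : ‖iteratedFDeriv ℝ k (f n ∘ φ) z‖ ≤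
      k.factorial * (∑ i ∈ Finset.range (k + 1), ‖iteratedFDeriv ℝ i (f n) (φ z)‖) * D' ^ k := by
    have := norm_iteratedFDerivWithin_comp_le (𝕜 := ℝ) (g := f n) (f := φ) (n := k) (s := univ)
      (t := Ω) (x := z) (N := ∞) (hf.1 n) hφ.contDiffOn (mod_cast le_top) hΩ.uniqueDiffOn
      uniqueDiffOn_univ (fun z _ => hm z) (mem_univ z)
      (C := ∑ i ∈ Finset.range (k + 1), ‖iteratedFDeriv ℝ i (f n) (φ z)‖) (D := D')
      (fun i hi => by
        rw [iteratedFDerivWithin_of_isOpen i hΩ (hm z)]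
        exact Finset.single_le_sum (f := fun i => ‖iteratedFDeriv ℝ i (f n) (φ z)‖)
          (fun _ _ => norm_nonneg _) (Finset.mem_range.2 (by omega)))
      (fun i hi hik => by
        rw [iteratedFDerivWithin_univ]
        have h1 := (hD i z hz).trans (le_abs_self _)
        have h2 := Finset.single_le_sum (f := fun i => |D i|) (fun _ _ => abs_nonneg _)
          (Finset.mem_range.2 (by omega : i < k + 1))
        exact (h1.trans (h2.trans (by linarith))).trans (le_self_pow₀ hD1 (by omega)))
    rwa [iteratedFDerivWithin_univ] at this
  calc |(n : ℝ)| ^ p * ‖iteratedFDeriv ℝ k (f n ∘ φ) z‖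
      ≤ |(n : ℝ)| ^ p * (k.factorial *
        (∑ i ∈ Finset.range (k + 1), ‖iteratedFDeriv ℝ i (f n) (φ z)‖) * D' ^ k) := by gcongr
    _ = k.factorial * (∑ i ∈ Finset.range (k + 1),
        |(n : ℝ)| ^ p * ‖iteratedFDeriv ℝ i (f n) (φ z)‖) * D' ^ k := by
        rw [← Finset.mul_sum]; ring
    _ ≤ _ := by
        gcongr with i
        exact hB i n hn _ (mem_image_of_mem _ hz)

/-- The reciprocal of a nowhere vanishing family asymptotic to `1`. -/
lemma moderate_inv {w : ℤ → P → ℝ} (hw : RapidlyDecreasing univ (w - 1))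
    (h0 : ∀ n z, w n z ≠ 0) : Moderate w⁻¹ := by
  have hc : ∀ n, ContDiff ℝ ∞ (w n) := fun n => by
    have := (rapidlyDecreasing_contDiff hw n).add (contDiff_const (c := (1 : ℝ)))
    have e : w n = fun z => (w - 1) n z + 1 := by funext z; simp
    rw [e]
    exact this
  refine ⟨fun n => (hc n).inv (h0 n), fun C hC k => ?_⟩
  set t : Set ℝ := {0}ᶜ with ht
  have hto : IsOpen t := isOpen_compl_singleton
  have hinv : ContDiffOn ℝ ∞ (fun y : ℝ => y⁻¹) t := fun y hy =>
    (contDiffAt_inv ℝ hy).contDiffWithinAt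
  have hIcc : Icc (1 / 2 : ℝ) (3 / 2) ⊆ t := fun y hy => by
    simp only [ht, mem_compl_iff, mem_singleton_iff]
    rintro rfl
    norm_num at hy
  have hbd : ∀ i, ∃ A, ∀ y ∈ Icc (1 / 2 : ℝ) (3 / 2),
      ‖iteratedFDerivWithin ℝ i (fun y : ℝ => y⁻¹) t y‖ ≤ A := fun i =>
    isCompact_Icc.exists_bound_of_continuousOn
      ((hinv.continuousOn_iteratedFDerivWithin (m := i) (mod_cast le_top)
        hto.uniqueDiffOn).mono hIcc)
  choose A hA using hbd
  obtain ⟨M0, hM0⟩ := hw.2 C (subset_univ _) hC 1 0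
  choose D hD using fun i => hw.2 C (subset_univ _) hC 0 i
  set D' : ℝ := 1 + ∑ i ∈ Finset.range (k + 1), |D i| with hD'
  have hD1 : 1 ≤ D' := by
    have : 0 ≤ ∑ i ∈ Finset.range (k + 1), |D i| := by positivity
    linarith
  -- Beyond this threshold `|n| |w - 1| ≤ M0` forces `|w - 1| ≤ 1/2`, so `w` takes values in the
  -- compact interval `[1/2, 3/2]`, on which all derivatives of `y⁻¹` are bounded.
  refine ⟨⌈2 * |M0|⌉₊ + 1, 0, k.factorial * (∑ i ∈ Finset.range (k + 1), |A i|) * D' ^ k,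
    fun n hn z hz => ?_⟩
  have hn0 : n ≤ 0 := by omega
  have hwz : w n z ∈ Icc (1 / 2 : ℝ) (3 / 2) := by
    have h1 := hM0 n hn0 z hz
    rw [pow_one, norm_iteratedFDeriv_zero, Real.norm_eq_abs] at h1
    have h2 : 2 * |M0| + 1 ≤ |(n : ℝ)| := by
      have h3 : (⌈2 * |M0|⌉₊ : ℤ) + 1 ≤ |n| := by
        rw [abs_of_nonpos hn0]; push_cast at hn; omega
      have h4 : ((⌈2 * |M0|⌉₊ : ℝ)) + 1 ≤ |(n : ℝ)| := by exact_mod_cast h3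
      linarith [Nat.le_ceil (2 * |M0|)]
    have h5 : |(w - 1) n z| ≤ 1 / 2 := by
      by_contra hcon
      push Not at hcon
      have : |(n : ℝ)| * (1 / 2) ≤ |(n : ℝ)| * |(w - 1) n z| := by gcongr
      linarith [le_abs_self M0]
    have h6 := abs_le.1 h5
    simp only [Pi.sub_apply, Pi.one_apply] at h6
    constructor <;> linarith [h6.1, h6.2]
  have hwD : ∀ i, 1 ≤ i → i ≤ k → ‖iteratedFDeriv ℝ i (w n) z‖ ≤ D' ^ i := by
    intro i hi hik
    have e : iteratedFDeriv ℝ i (w n) z = iteratedFDeriv ℝ i ((w - 1) n) z := by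
      have e1 : w n = (w - 1) n + fun _ => (1 : ℝ) := by ext z; simp
      conv_lhs => rw [e1]
      rw [iteratedFDeriv_add_apply
        ((rapidlyDecreasing_contDiff hw n).contDiffAt.of_le (mod_cast le_top))
        contDiff_const.contDiffAt, iteratedFDeriv_const_of_ne (by omega)]
      simp
    rw [e]
    have h1 := hD i n hn0 z hz
    rw [pow_zero, one_mul] at h1
    have h2 := Finset.single_le_sum (f := fun i => |D i|) (fun _ _ => abs_nonneg _)
      (Finset.mem_range.2 (by omega : i < k + 1))
    exact ((h1.trans (le_abs_self _)).trans (h2.trans (by linarith))).trans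
      (le_self_pow₀ hD1 (by omega))
  have := norm_iteratedFDerivWithin_comp_le (𝕜 := ℝ) (g := fun y : ℝ => y⁻¹) (f := w n) (n := k)
    (s := univ) (t := t) (x := z) (N := ∞) hinv (hc n).contDiffOn (mod_cast le_top)
    hto.uniqueDiffOn uniqueDiffOn_univ (fun z _ => h0 n z) (mem_univ z)
    (C := ∑ i ∈ Finset.range (k + 1), |A i|) (D := D')
    (fun i hi => (hA i _ hwz).trans ((le_abs_self _).trans
      (Finset.single_le_sum (f := fun i => |A i|) (fun _ _ => abs_nonneg _)
          (Finset.mem_range.2 (by omega)))))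
    (fun i hi hik => by rw [iteratedFDerivWithin_univ]; exact hwD i hi hik)
  rw [iteratedFDerivWithin_univ] at this
  have hpos : 0 ≤ (k.factorial * (∑ i ∈ Finset.range (k + 1), |A i|) * D' ^ k : ℝ) := by positivity
  rw [pow_zero]
  refine le_trans this ?_
  linarith

/-- The derivative of a family in the direction `e` of the parameter space. -/
def dirDeriv (e : P) (f : ℤ → P → ℝ) : ℤ → P → ℝ := fun n z => fderiv ℝ (f n) z e

lemma contDiff_dirDeriv (e : P) {f : P → ℝ} (hf : ContDiff ℝ ∞ f) :
    ContDiff ℝ ∞ (fun z => fderiv ℝ f z e) :=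
  (hf.fderiv_right (m := ∞) (by simp)).clm_apply contDiff_const

lemma RapidlyDecreasing.dirDeriv (e : P) {f : ℤ → P → ℝ} (hf : RapidlyDecreasing univ f) :
    RapidlyDecreasing univ (dirDeriv e f) := by
  refine ⟨fun n => (contDiff_dirDeriv e (rapidlyDecreasing_contDiff hf n)).contDiffOn,
    fun C hC' hC p k => ?_⟩
  obtain ⟨M, hM⟩ := hf.2 C hC' hC p (k + 1)
  let L : (P →L[ℝ] ℝ) →L[ℝ] ℝ := ContinuousLinearMap.apply ℝ ℝ e
  refine ⟨‖L‖ * M, fun n hn z hz => ?_⟩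
  have h1 : ‖iteratedFDeriv ℝ k (L ∘ fderiv ℝ (f n)) z‖ ≤
      ‖L‖ * ‖iteratedFDeriv ℝ k (fderiv ℝ (f n)) z‖ :=
    L.norm_iteratedFDeriv_comp_left 
      ((rapidlyDecreasing_contDiff hf n).fderiv_right (m := ∞) (by simp)).contDiffAt
      (mod_cast le_top)
  rw [norm_iteratedFDeriv_fderiv] at h1
  calc |(n : ℝ)| ^ p * ‖iteratedFDeriv ℝ k (L ∘ fderiv ℝ (f n)) z‖
      ≤ |(n : ℝ)| ^ p * (‖L‖ * ‖iteratedFDeriv ℝ (k + 1) (f n) z‖) := by gcongr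
    _ = ‖L‖ * (|(n : ℝ)| ^ p * ‖iteratedFDeriv ℝ (k + 1) (f n) z‖) := by ring
    _ ≤ ‖L‖ * M := by gcongr; exact hM n hn z hz

/-- A rapidly decreasing family independent of the lattice variable vanishes. -/
lemma RapidlyDecreasing.eq_zero {f : ℤ → P → ℝ} (hf : RapidlyDecreasing univ f)
    (h : ∀ n z, f (n + 1) z = f n z) : f = 0 := by
  funext n z
  have hc : ∀ m : ℤ, f m z = f 0 z := by
    intro m
    induction m using Int.induction_on with
    | zero => rfl
    | succ i ih => rw [h, ih]
    | pred i ih => rw [← ih, ← h, sub_add_cancel]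
  obtain ⟨M, hM⟩ := hf.2 {z} (subset_univ _) isCompact_singleton 1 0
  rw [hc]
  by_contra hne
  have hpos : 0 < |f 0 z| := abs_pos.2 hne
  obtain ⟨N, hN⟩ := exists_nat_gt (M / |f 0 z|)
  have := hM (-N) (by simp) z rfl
  rw [pow_one, norm_iteratedFDeriv_zero, hc, Real.norm_eq_abs] at this
  push_cast at this
  rw [abs_neg, Nat.abs_cast] at this
  rw [div_lt_iff₀ hpos] at hN
  linarith

end RapidDecrease

/-! ### Summation from `-∞` -/

/-- The inverse difference of a family. -/
def famInvDiff (f : ℤ → ℝ × ℝ → ℝ) : ℤ → ℝ × ℝ → ℝ := fun n z => ∑' k : ℕ, f (n - 1 - k) z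

lemma summable_one_div_succ_sq (M : ℝ) : Summable fun k : ℕ => M / ((k : ℝ) + 1) ^ 2 := by
  have h1 : Summable fun k : ℕ => (1 : ℝ) / (k : ℝ) ^ 2 :=
    Real.summable_one_div_nat_pow.2 one_lt_two
  have h2 := ((summable_nat_add_iff 1).2 h1).mul_left M
  refine h2.congr fun k => ?_
  push_cast
  ring

/-- For `n ≤ 0` the number `|n - 1 - k|` dominates both `|n|` and `k + 1`. The decay exponent `p +
2` is split between them, giving decay in `n` together with summability in `k`. -/
lemma RapidlyDecreasing.sq_bound {f : ℤ → ℝ × ℝ → ℝ} (hf : RapidlyDecreasing univ f)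
    {C : Set (ℝ × ℝ)} (hC : IsCompact C) (p i : ℕ) : ∃ M, 0 ≤ M ∧ ∀ n : ℤ, n ≤ 0 → ∀ (k : ℕ),
      ∀ z ∈ C, |(n : ℝ)| ^ p * ‖iteratedFDeriv ℝ i (f (n - 1 - k)) z‖ ≤ M / ((k : ℝ) + 1) ^ 2 := by
  obtain ⟨M, hM⟩ := hf.2 C (subset_univ _) hC (p + 2) i
  refine ⟨|M|, abs_nonneg _, fun n hn k z hz => ?_⟩
  rw [le_div_iff₀ (by positivity)]
  have h1 := hM (n - 1 - k) (by omega) z hz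
  have h2 : |(n : ℝ)| ≤ |((n - 1 - k : ℤ) : ℝ)| := by
    have : |n| ≤ |n - 1 - k| := by
      rw [abs_of_nonpos hn, abs_of_nonpos (by omega)]; omega
    exact_mod_cast this
  have h3 : (k : ℝ) + 1 ≤ |((n - 1 - k : ℤ) : ℝ)| := by
    have : (k : ℤ) + 1 ≤ |n - 1 - k| := by
      rw [abs_of_nonpos (by omega)]; omega
    exact_mod_cast this
  calc |(n : ℝ)| ^ p * ‖iteratedFDeriv ℝ i (f (n - 1 - k)) z‖ * ((k : ℝ) + 1) ^ 2
      ≤ |((n - 1 - k : ℤ) : ℝ)| ^ p * ‖iteratedFDeriv ℝ i (f (n - 1 - k)) z‖ *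
        |((n - 1 - k : ℤ) : ℝ)| ^ 2 := by gcongr
    _ = |((n - 1 - k : ℤ) : ℝ)| ^ (p + 2) * ‖iteratedFDeriv ℝ i (f (n - 1 - k)) z‖ := by
        rw [pow_add]; ring
    _ ≤ |M| := h1.trans (le_abs_self _)

/-- Differentiating the series term by term calls for bounds uniform in `z`, while the decay is only
locally uniform. Multiplication by a bump function equal to `1` near `z₀` makes the bounds global
without changing germs at `z₀`. -/
lemma RapidlyDecreasing.famInvDiff_aux {f : ℤ → ℝ × ℝ → ℝ} (hf : RapidlyDecreasing univ f)
    (z₀ : ℝ × ℝ) : ContDiffAt ℝ ∞ (famInvDiff f 0) z₀ ∧ ∀ i : ℕ,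
      iteratedFDeriv ℝ i (famInvDiff f 0) z₀ = ∑' k : ℕ, iteratedFDeriv ℝ i (f (0 - 1 - k)) z₀ := by
  let χ : ContDiffBump z₀ := ⟨1, 2, one_pos, one_lt_two⟩
  have hχ : ContDiff ℝ ∞ χ := χ.contDiff
  set g : ℤ → ℝ × ℝ → ℝ := fun n z => χ z * f n z with hg
  have hgR : RapidlyDecreasing univ g :=
    RapidlyDecreasing.moderate_mul (a := fun _ => χ)
      (moderate_of_const (fun _ => hχ) (b := χ) fun _ _ => rfl) hf
  have hC : IsCompact (tsupport χ) := χ.hasCompactSupport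
  choose M hM0 hM using fun i => hgR.sq_bound hC 0 i
  have hv : ∀ (i k : ℕ) (z : ℝ × ℝ),
      ‖iteratedFDeriv ℝ i (g (0 - 1 - k)) z‖ ≤ M i / ((k : ℝ) + 1) ^ 2 := by
    intro i k z
    by_cases hz : z ∈ tsupport χ
    · simpa using hM i 0 le_rfl k z hz
    · have : z ∉ tsupport (iteratedFDeriv ℝ i (g (0 - 1 - k))) := fun h =>
        hz (closure_mono (Function.support_mul_subset_left _ _) (tsupport_iteratedFDeriv_subset i h))
      rw [image_eq_zero_of_notMem_tsupport this, norm_zero]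
      have := hM0 i
      positivity
  have hgc : ∀ k : ℕ, ContDiff ℝ ((⊤ : ℕ∞) : WithTop ℕ∞) (g (0 - 1 - k)) := fun k =>
    rapidlyDecreasing_contDiff hgR _
  have hsum := contDiff_tsum (f := fun k : ℕ => g (0 - 1 - k)) hgc
    (v := fun (i k : ℕ) => M i / ((k : ℝ) + 1) ^ 2)
    (fun i _ => summable_one_div_succ_sq _) (fun i k z _ => hv i k z)
  have hone : (χ : ℝ × ℝ → ℝ) =ᶠ[nhds z₀] 1 := χ.eventuallyEq_one
  have hloc : ∀ n, g n =ᶠ[nhds z₀] f n := fun n => by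
    filter_upwards [hone] with z hz
    simp [hg, hz]
  have hloc' : (fun z => ∑' k : ℕ, g (0 - 1 - k) z) =ᶠ[nhds z₀] famInvDiff f 0 := by
    filter_upwards [hone] with z hz
    simp [hg, hz, famInvDiff]
  refine ⟨hsum.contDiffAt.congr_of_eventuallyEq hloc'.symm, fun i => ?_⟩
  rw [← (hloc'.iteratedFDeriv ℝ i).eq_of_nhds,
    iteratedFDeriv_tsum (f := fun k : ℕ => g (0 - 1 - k))
      (v := fun (i k : ℕ) => M i / ((k : ℝ) + 1) ^ 2) hgc (fun i _ => summable_one_div_succ_sq (M i)) (fun i k z _ => hv i k z)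
      le_top]
  exact tsum_congr fun k => ((hloc _).iteratedFDeriv ℝ i).eq_of_nhds

lemma famInvDiff_shift (f : ℤ → ℝ × ℝ → ℝ) (n : ℤ) :
    famInvDiff f n = famInvDiff (fun m => f (m + n)) 0 := by
  funext z
  refine tsum_congr fun k => ?_
  congr 1; ring

lemma RapidlyDecreasing.famInvDiff {f : ℤ → ℝ × ℝ → ℝ} (hf : RapidlyDecreasing univ f) :
    RapidlyDecreasing univ (famInvDiff f) := by
  refine ⟨fun n => ContDiff.contDiffOn ?_, fun C hC' hC p i => ?_⟩
  · rw [famInvDiff_shift]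
    exact contDiff_iff_contDiffAt.2 fun z => ((hf.shift n).famInvDiff_aux z).1
  · obtain ⟨M, hM0, hM⟩ := hf.sq_bound hC p i
    refine ⟨∑' k : ℕ, M / ((k : ℝ) + 1) ^ 2, fun n hn z hz => ?_⟩
    rw [famInvDiff_shift, ((hf.shift n).famInvDiff_aux z).2 i,
      ← abs_of_nonneg (by positivity : 0 ≤ |(n : ℝ)| ^ p), ← Real.norm_eq_abs (|(n : ℝ)| ^ p),
      ← norm_smul, ← tsum_const_smul'']
    refine tsum_of_norm_bounded (summable_one_div_succ_sq M).hasSum fun k => ?_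
    rw [norm_smul, Real.norm_eq_abs, abs_of_nonneg (by positivity)]
    have := hM n hn k z hz
    rwa [show 0 - 1 - (k : ℤ) + n = n - 1 - k by ring]

lemma RapidlyDecreasing.summable_invDiff {f : ℤ → ℝ × ℝ → ℝ} (hf : RapidlyDecreasing univ f)
    (n : ℤ) (z : ℝ × ℝ) : Summable fun k : ℕ => f (n - 1 - k) z := by
  obtain ⟨M, hM0, hM⟩ := (hf.shift n).sq_bound (isCompact_singleton (x := z)) 0 0
  refine Summable.of_norm_bounded (summable_one_div_succ_sq M) fun k => ?_
  have := hM 0 le_rfl k z rfl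
  rw [pow_zero, one_mul, norm_iteratedFDeriv_zero] at this
  rwa [show 0 - 1 - (k : ℤ) + n = n - 1 - k by ring] at this

lemma famInvDiff_succ {f : ℤ → ℝ × ℝ → ℝ} (hf : RapidlyDecreasing univ f) (n : ℤ) (z : ℝ × ℝ) :
    famInvDiff f (n + 1) z = famInvDiff f n z + f n z := by
  have := (hf.summable_invDiff (n + 1) z).tsum_eq_zero_add
  simp only [famInvDiff]
  rw [this, add_comm]
  congr 1
  · refine tsum_congr fun k => ?_
    congr 1; push_cast; ring
  · congr 1; push_cast; ring

end DDmKP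

namespace DDmKP
open Set

/-! ### Closure properties of families of moderate growth. -/

section Moderate

variable {P : Type*} [NormedAddCommGroup P] [NormedSpace ℝ P]

/-- This form of the bound is monotone in all three natural constants, so several bounds are merged
by adding their constants. -/
lemma moderate_iff {a : ℤ → P → ℝ} : Moderate a ↔
    (∀ n, ContDiff ℝ ∞ (a n)) ∧ ∀ C : Set P, IsCompact C → ∀ k : ℕ, ∃ m p M : ℕ,
      ∀ n : ℤ, n ≤ -m → ∀ z ∈ C, ‖iteratedFDeriv ℝ k (a n) z‖ ≤ M * (1 + |(n : ℝ)|) ^ p := by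
  refine and_congr_right fun _ => forall₃_congr fun C hC k => ⟨?_, ?_⟩
  · rintro ⟨m, p, M, hM⟩
    refine ⟨m, p, ⌈|M| * 2⌉₊, fun n hn z hz => (hM n hn z hz).trans ?_⟩
    have h1 : (1 : ℝ) ≤ (1 + |(n : ℝ)|) ^ p := one_le_pow₀ (by simp)
    have h2 : |(n : ℝ)| ^ p ≤ (1 + |(n : ℝ)|) ^ p := by gcongr; simp
    calc M * (1 + |(n : ℝ)| ^ p) ≤ |M| * (2 * (1 + |(n : ℝ)|) ^ p) := by
          gcongr
          · exact le_abs_self _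
          · linarith
      _ = |M| * 2 * (1 + |(n : ℝ)|) ^ p := by ring
      _ ≤ _ := by gcongr; exact Nat.le_ceil _
  · rintro ⟨m, p, M, hM⟩
    refine ⟨m, p, M * 2 ^ (p - 1), fun n hn z hz => (hM n hn z hz).trans ?_⟩
    have := add_pow_le (zero_le_one : (0 : ℝ) ≤ 1) (abs_nonneg (n : ℝ)) p
    rw [one_pow] at this
    rw [mul_assoc]
    gcongr

lemma moderate_const (c : ℝ) : Moderate (fun (_ : ℤ) (_ : P) => c) :=
  moderate_of_const (b := fun _ => c) (fun _ => contDiff_const) fun _ _ => rfl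

lemma Moderate.add {a b : ℤ → P → ℝ} (ha : Moderate a) (hb : Moderate b) : Moderate (a + b) := by
  rw [moderate_iff] at ha hb ⊢
  refine ⟨fun n => (ha.1 n).add (hb.1 n), fun C hC k => ?_⟩
  obtain ⟨m, p, M, hM⟩ := ha.2 C hC k
  obtain ⟨m', p', M', hM'⟩ := hb.2 C hC k
  refine ⟨m + m', p + p', M + M', fun n hn z hz => ?_⟩
  have h1 : (1 : ℝ) ≤ 1 + |(n : ℝ)| := by simp
  have e : iteratedFDeriv ℝ k ((a + b) n) z =
      iteratedFDeriv ℝ k (a n) z + iteratedFDeriv ℝ k (b n) z :=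
    iteratedFDeriv_add_apply ((ha.1 n).contDiffAt.of_le (mod_cast le_top))
      ((hb.1 n).contDiffAt.of_le (mod_cast le_top))
  rw [e]
  refine (norm_add_le _ _).trans ?_
  push_cast at hn ⊢
  rw [add_mul]
  refine add_le_add ((hM n (by omega) z hz).trans ?_) ((hM' n (by omega) z hz).trans ?_) <;>
  · gcongr
    omega

lemma Moderate.mul {a b : ℤ → P → ℝ} (ha : Moderate a) (hb : Moderate b) : Moderate (a * b) := by
  rw [moderate_iff] at ha hb ⊢
  refine ⟨fun n => (ha.1 n).mul (hb.1 n), fun C hC k => ?_⟩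
  choose m p M hM using ha.2 C hC
  choose m' p' M' hM' using hb.2 C hC
  have hs : ∀ f : ℕ → ℕ, ∀ i ≤ k, f i ≤ ∑ i ∈ Finset.range (k + 1), f i := fun f i hi =>
    Finset.single_le_sum (f := f) (fun _ _ => Nat.zero_le _) (Finset.mem_range.2 (by omega))
  refine ⟨∑ i ∈ Finset.range (k + 1), m i + ∑ i ∈ Finset.range (k + 1), m' i,
    ∑ i ∈ Finset.range (k + 1), p i + ∑ i ∈ Finset.range (k + 1), p' i,
    ∑ i ∈ Finset.range (k + 1), k.choose i * M i * M' (k - i), fun n hn z hz => ?_⟩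
  have h1 : (1 : ℝ) ≤ 1 + |(n : ℝ)| := by simp
  refine (norm_iteratedFDeriv_mul_le (N := ∞) (ha.1 n) (hb.1 n) z (mod_cast le_top)).trans ?_
  push_cast at hn ⊢
  rw [Finset.sum_mul]
  refine Finset.sum_le_sum fun i hi => ?_
  rw [Finset.mem_range] at hi
  have e1 := hs m i (by omega)
  have e2 := hs m' (k - i) (by omega)
  have e3 := hs p i (by omega)
  have e4 := hs p' (k - i) (by omega)
  zify at e1 e2
  have b1 := hM i n (by omega) z hz
  have b2 := hM' (k - i) n (by omega) z hz
  calc (k.choose i : ℝ) * ‖iteratedFDeriv ℝ i (a n) z‖ * ‖iteratedFDeriv ℝ (k - i) (b n) z‖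
      ≤ k.choose i * (M i * (1 + |(n : ℝ)|) ^ p i) * (M' (k - i) * (1 + |(n : ℝ)|) ^ p' (k - i)) := by
        gcongr
    _ = k.choose i * M i * M' (k - i) * (1 + |(n : ℝ)|) ^ (p i + p' (k - i)) := by
        rw [pow_add]; ring
    _ ≤ _ := by gcongr

lemma Moderate.shift {f : ℤ → P → ℝ} (hf : Moderate f) (a : ℤ) :
    Moderate (fun n => f (n + a)) := by
  rw [moderate_iff] at hf ⊢
  refine ⟨fun n => hf.1 _, fun C hC k => ?_⟩
  obtain ⟨m, p, M, hM⟩ := hf.2 C hC k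
  refine ⟨m + a.natAbs, p, M * (1 + a.natAbs) ^ p, fun n hn z hz => ?_⟩
  refine (hM (n + a) (by omega) z hz).trans ?_
  push_cast
  rw [mul_assoc, ← mul_pow, Nat.cast_natAbs, Int.cast_abs]
  gcongr
  nlinarith [abs_add_le (n : ℝ) a, abs_nonneg (n : ℝ), abs_nonneg (a : ℝ),
    mul_nonneg (abs_nonneg (n : ℝ)) (abs_nonneg (a : ℝ))]

lemma Moderate.dirDeriv (e : P) {f : ℤ → P → ℝ} (hf : Moderate f) : Moderate (dirDeriv e f) := by
  refine ⟨fun n => contDiff_dirDeriv e (hf.1 n), fun C hC k => ?_⟩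
  obtain ⟨m, p, M, hM⟩ := hf.2 C hC (k + 1)
  let L : (P →L[ℝ] ℝ) →L[ℝ] ℝ := ContinuousLinearMap.apply ℝ ℝ e
  refine ⟨m, p, ‖L‖ * M, fun n hn z hz => ?_⟩
  have h1 : ‖iteratedFDeriv ℝ k (L ∘ fderiv ℝ (f n)) z‖ ≤
      ‖L‖ * ‖iteratedFDeriv ℝ k (fderiv ℝ (f n)) z‖ :=
    L.norm_iteratedFDeriv_comp_left ((hf.1 n).fderiv_right (m := ∞) (by simp)).contDiffAt
      (mod_cast le_top)
  rw [norm_iteratedFDeriv_fderiv] at h1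
  rw [mul_assoc]
  exact h1.trans (by gcongr; exact hM n hn z hz)

lemma Moderate.comp_clm {f : ℤ → P → ℝ} (hf : Moderate f) {P' : Type*} [NormedAddCommGroup P']
    [NormedSpace ℝ P'] (L : P' →L[ℝ] P) : Moderate (fun n z => f n (L z)) := by
  refine ⟨fun n => (hf.1 n).comp L.contDiff, fun C hC k => ?_⟩
  obtain ⟨m, p, M, hM⟩ := hf.2 (L '' C) (hC.image L.continuous) k
  refine ⟨m, p, ‖L‖ ^ k * M, fun n hn z hz => ?_⟩
  have h1 : iteratedFDeriv ℝ k (fun z => f n (L z)) z = _ :=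
    L.iteratedFDeriv_comp_right (hf.1 n) z (i := k) (mod_cast le_top)
  rw [h1]
  refine (ContinuousMultilinearMap.norm_compContinuousLinearMap_le _ _).trans ?_
  rw [Finset.prod_const, Finset.card_univ, Fintype.card_fin, mul_comm, mul_assoc]
  gcongr
  exact hM n hn _ (mem_image_of_mem _ hz)

end Moderate

/-! ## The algebra of one-parameter families of lattice functions -/

/-- One-parameter families `f(n, s, x)` of lattice functions of moderate growth. -/
def famSubalgebra : Subalgebra ℝ (ℤ → ℝ × ℝ → ℝ) where
  carrier := {f | Moderate f}
  mul_mem' := Moderate.mul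
  add_mem' := Moderate.add
  algebraMap_mem' c := moderate_const c

/-- The type of families. -/
abbrev Fam : Type := famSubalgebra

namespace Fam

lemma ext {f g : Fam} (h : ∀ n z, f.1 n z = g.1 n z) : f = g :=
  Subtype.ext (funext fun n => funext fun z => h n z)

/-- The shift of families. -/
def shiftEquiv : Fam ≃ₐ[ℝ] Fam where
  toFun f := ⟨fun n => f.1 (n + 1), f.2.shift 1⟩
  invFun f := ⟨fun n => f.1 (n + -1), f.2.shift (-1)⟩
  left_inv f := ext fun n z => by simp
  right_inv f := ext fun n z => by simp
  map_mul' _ _ := rfl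
  map_add' _ _ := rfl
  commutes' _ := rfl

lemma shiftEquiv_apply (f : Fam) (n : ℤ) (z : ℝ × ℝ) : (shiftEquiv f).1 n z = f.1 (n + 1) z := rfl

lemma contDiff (f : Fam) (n : ℤ) : ContDiff ℝ ∞ (f.1 n) := f.2.1 n

lemma differentiable (f : Fam) (n : ℤ) : Differentiable ℝ (f.1 n) :=
  (f.contDiff n).differentiable (by simp)

/-- Directional derivatives of families. -/
def derivMap (e : ℝ × ℝ) : Fam →ₗ[ℝ] Fam where
  toFun f := ⟨dirDeriv e f.1, f.2.dirDeriv e⟩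
  map_add' f g := ext fun n z => by
    have : fderiv ℝ ((f.1 + g.1) n) z = fderiv ℝ (f.1 n) z + fderiv ℝ (g.1 n) z :=
      fderiv_add (f.differentiable n z) (g.differentiable n z)
    change fderiv ℝ ((f.1 + g.1) n) z e = _
    rw [this]; rfl
  map_smul' c f := ext fun n z => by
    have : fderiv ℝ ((c • f.1) n) z = c • fderiv ℝ (f.1 n) z :=
      fderiv_const_smul (f.differentiable n z) c
    change fderiv ℝ ((c • f.1) n) z e = _
    rw [this]; rfl

lemma derivMap_mul (e : ℝ × ℝ) (f g : Fam) :
    derivMap e (f * g) = derivMap e f * g + f * derivMap e g := ext fun n z => by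
  have : fderiv ℝ ((f.1 * g.1) n) z = f.1 n z • fderiv ℝ (g.1 n) z + g.1 n z • fderiv ℝ (f.1 n) z :=
    fderiv_mul (f.differentiable n z) (g.differentiable n z)
  change fderiv ℝ ((f.1 * g.1) n) z e = fderiv ℝ (f.1 n) z e * g.1 n z + f.1 n z * fderiv ℝ (g.1 n) z e
  rw [this]
  simp only [add_apply, smul_apply, smul_eq_mul]
  ring

lemma derivMap_comm (e e' : ℝ × ℝ) (f : Fam) :
    derivMap e (derivMap e' f) = derivMap e' (derivMap e f) := ext fun n z => by
  have hd : DifferentiableAt ℝ (fderiv ℝ (f.1 n)) z :=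
    ((f.contDiff n).fderiv_right (m := ∞) (by simp)).differentiable (by simp) z
  have key : ∀ a b : ℝ × ℝ, fderiv ℝ (fun y => fderiv ℝ (f.1 n) y a) z b =
      fderiv ℝ (fderiv ℝ (f.1 n)) z b a := fun a b => by
    rw [fderiv_clm_apply hd (differentiableAt_const a)]
    simp
  change fderiv ℝ (fun y => fderiv ℝ (f.1 n) y e') z e = fderiv ℝ (fun y => fderiv ℝ (f.1 n) y e) z e'
  rw [key, key]
  have hs : IsSymmSndFDerivAt ℝ (f.1 n) z :=
    (f.contDiff n).contDiffAt.isSymmSndFDerivAt (by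
      rw [minSmoothness_of_isRCLikeNormedField]
      exact WithTop.coe_le_coe.2 (le_top : (2 : ℕ∞) ≤ ⊤))
  exact hs e e'

/-- The rapidly decreasing families. -/
def rapidIdeal : Ideal Fam where
  carrier := {f | RapidlyDecreasing univ f.1}
  add_mem' := RapidlyDecreasing.add
  zero_mem' := RapidlyDecreasing.zero
  smul_mem' c _ hf := RapidlyDecreasing.moderate_mul c.2 hf

lemma mem_rapidIdeal {f : Fam} : f ∈ rapidIdeal ↔ RapidlyDecreasing univ f.1 := Iff.rfl

open Classical in
/-- Summation from `-∞`, on rapidly decreasing families. -/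
def sumBelow (f : Fam) : Fam :=
  if hf : RapidlyDecreasing univ f.1 then ⟨famInvDiff f.1, hf.famInvDiff.moderate⟩ else 0

lemma sumBelow_coe {f : Fam} (hf : f ∈ rapidIdeal) : (sumBelow f).1 = famInvDiff f.1 := by
  rw [sumBelow, dif_pos (mem_rapidIdeal.1 hf)]

/-- The coordinate `x`. -/
def coordX : Fam := ⟨fun _ z => z.2, moderate_of_const (b := Prod.snd) (fun _ => contDiff_snd)
  fun _ _ => rfl⟩

/-- The coordinate `n`. -/
def coordN : Fam := ⟨fun n _ => n, moderate_intCast⟩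

/-- The differential algebra of one-parameter families of lattice functions. -/
def latticeDiff : PseudoDiff.LatticeDiff Fam where
  E := shiftEquiv
  d := derivMap (0, 1)
  I := rapidIdeal
  dInv := sumBelow
  xCoord := coordX
  nCoord := coordN
  d_mul := derivMap_mul (0, 1)
  d_E _ := rfl
  E_mem _ hf := RapidlyDecreasing.shift hf 1
  E_symm_mem _ hf := RapidlyDecreasing.shift hf (-1)
  d_mem _ hf := RapidlyDecreasing.dirDeriv _ hf
  dInv_mem f hf := by
    rw [mem_rapidIdeal, sumBelow_coe hf]
    exact RapidlyDecreasing.famInvDiff hf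
  E_dInv f hf := ext fun n z => by
    rw [shiftEquiv_apply, sumBelow_coe hf, famInvDiff_succ hf]
    change _ = (sumBelow f).1 n z + f.1 n z
    rw [sumBelow_coe hf]
  eq_zero f hf h := Subtype.ext (RapidlyDecreasing.eq_zero hf fun n z =>
    congrFun (congrFun (congrArg Subtype.val h) n) z)
  E_X := rfl
  E_N := ext fun n z => by
    change ((n + 1 : ℤ) : ℝ) = n + 1
    push_cast; rfl
  d_X := ext fun n z => by
    change fderiv ℝ (Prod.snd : ℝ × ℝ → ℝ) z (0, 1) = 1
    rw [fderiv_snd]; rfl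
  d_N := ext fun n z => by
    change fderiv ℝ (fun _ : ℝ × ℝ => (n : ℝ)) z (0, 1) = 0
    rw [fderiv_fun_const]; rfl

/-- The projection `(s, x) ↦ (0, x)`. -/
def sliceMap : ℝ × ℝ →L[ℝ] ℝ × ℝ := (0 : ℝ × ℝ →L[ℝ] ℝ).prod (ContinuousLinearMap.snd ℝ ℝ ℝ)

/-- Evaluation of a family at `s = 0`. -/
def slice : Fam →ₐ[ℝ] Fam where
  toFun f := ⟨fun n z => f.1 n (sliceMap z), f.2.comp_clm sliceMap⟩
  map_one' := rfl
  map_mul' _ _ := rfl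
  map_zero' := rfl
  map_add' _ _ := rfl
  commutes' _ := rfl

lemma slice_mem {f : Fam} (hf : f ∈ rapidIdeal) : slice f ∈ rapidIdeal :=
  RapidlyDecreasing.comp isOpen_univ hf sliceMap.contDiff fun _ => mem_univ _

lemma slice_derivMap (f : Fam) : slice (derivMap (0, 1) f) = derivMap (0, 1) (slice f) :=
  ext fun n z => by
    have h := (f.differentiable n (sliceMap z)).hasFDerivAt.comp z sliceMap.hasFDerivAt
    change fderiv ℝ (f.1 n) (sliceMap z) (0, 1) = fderiv ℝ (f.1 n ∘ sliceMap) z (0, 1)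
    rw [h.fderiv]
    rfl

/-- The first-order jet of families at `s = 0`. -/
def jet : PseudoDiff.Jet latticeDiff where
  π := slice
  δ := slice.toLinearMap ∘ₗ derivMap (1, 0)
  δ_mul f g := by
    simp only [LinearMap.comp_apply, AlgHom.toLinearMap_apply, derivMap_mul, map_add, map_mul]
  π_E _ := rfl
  δ_E _ := rfl
  π_d := slice_derivMap
  δ_d f := by
    simp only [LinearMap.comp_apply, AlgHom.toLinearMap_apply, latticeDiff]
    rw [derivMap_comm, slice_derivMap]
  π_mem _ hf := slice_mem hf
  δ_mem _ hf := slice_mem (RapidlyDecreasing.dirDeriv _ hf)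
  π_x := rfl
  π_n := rfl
  δ_x := ext fun n z => by
    change fderiv ℝ (Prod.snd : ℝ × ℝ → ℝ) (sliceMap z) (1, 0) = 0
    rw [fderiv_snd]; rfl
  δ_n := ext fun n z => by
    change fderiv ℝ (fun _ : ℝ × ℝ => (n : ℝ)) (sliceMap z) (1, 0) = 0
    rw [fderiv_fun_const]; rfl

lemma jet_δ_apply (f : Fam) (n : ℤ) (z : ℝ × ℝ) :
    (jet.δ f).1 n z = fderiv ℝ (f.1 n) (0, z.2) (1, 0) := rfl

lemma hasDerivAt_jet (f : Fam) (n : ℤ) (s x : ℝ) :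
    HasDerivAt (fun s => f.1 n (s, x)) ((jet.δ f).1 n (s, x)) 0 := by
  have h := (f.differentiable n (0, x)).hasFDerivAt.comp_hasDerivAt (0 : ℝ)
    ((hasDerivAt_id (0 : ℝ)).prodMk (hasDerivAt_const (0 : ℝ) x))
  exact h

/-! ### Units -/

/-- Families of admissible potentials. -/
structure _root_.DDmKP.AdmissibleFamily (h : ℝ) (w : ℤ → ℝ × ℝ → ℝ) : Prop where
  rapid : RapidlyDecreasing univ w
  ne_zero : ∀ n z, 1 + h * w n z ≠ 0

/-- The unit `1 + h w` of a family of admissible potentials. -/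
def unitOf (h : ℝ) (w : ℤ → ℝ × ℝ → ℝ) (hw : AdmissibleFamily h w) : Famˣ :=
  have hr : RapidlyDecreasing univ ((fun n z => 1 + h * w n z) - 1) := by
    have : (fun n z => 1 + h * w n z) - 1 = (fun _ _ => h) * w := by
      funext n z; simp
    rw [this]
    exact RapidlyDecreasing.moderate_mul (moderate_const h) hw.rapid
  have hm : Moderate (fun n z => 1 + h * w n z) :=
    (moderate_const 1).add ((moderate_const h).mul hw.rapid.moderate)
  { val := ⟨_, hm⟩
    inv := ⟨_, moderate_inv hr hw.ne_zero⟩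
    val_inv := ext fun n z => mul_inv_cancel₀ (hw.ne_zero n z)
    inv_val := ext fun n z => inv_mul_cancel₀ (hw.ne_zero n z) }

variable {h : ℝ} {w : ℤ → ℝ × ℝ → ℝ} (hw : AdmissibleFamily h w)

lemma isPotential_unitOf : latticeDiff.IsPotential (unitOf h w hw) := by
  have : ((unitOf h w hw : Fam) - 1).1 = (fun _ _ => h) * w := by
    funext n z
    change 1 + h * w n z - 1 = h * w n z
    ring
  change RapidlyDecreasing univ ((unitOf h w hw : Fam) - 1).1
  rw [this]
  exact RapidlyDecreasing.moderate_mul (moderate_const h) hw.rapid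

end Fam
end DDmKP

namespace DDmKP
open Set PseudoDiff

/-! ## Evaluation of families -/

/-- The shift of lattice functions, as an automorphism. -/
def fnShift : Fn ≃ₐ[ℝ] Fn where
  toFun := shift 1
  invFun := shift (-1)
  left_inv f := by funext n x; simp [shift]
  right_inv f := by funext n x; simp [shift]
  map_mul' _ _ := rfl
  map_add' _ _ := rfl
  commutes' _ := rfl

lemma fnShift_zpow (a : ℤ) (f : Fn) : (fnShift ^ a) f = shift a f := by
  induction a using Int.induction_on generalizing f with
  | zero => funext n x; simp [shift]
  | succ i ih =>
    rw [zpow_add_one, AlgEquiv.mul_apply, ih]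
    change shift i (shift 1 f) = _
    funext n x; simp [shift, add_assoc]
  | pred i ih =>
    rw [zpow_sub_one, AlgEquiv.mul_apply, ih]
    change shift (-i) (shift (-1) f) = _
    funext n x; simp [shift, sub_eq_add_neg, add_assoc]

lemma delta_fnShift_pow (i : ℕ) (f : Fn) : (delta fnShift ^ i) f = diff^[i] f := by
  rw [Module.End.pow_apply]
  rfl

/-- `Op` carries no bound on the order and is not the ring `PDO`; the common formula for the
coefficients is what makes `evOp` multiplicative. -/
lemma opMul_eq (P Q : Op) : opMul P Q = PDO.mulCoeff fnShift P Q := by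
  funext k
  simp only [opMul, PDO.mulCoeff, leibnizCoeff_apply, fnShift_zpow, delta_fnShift_pow, mul_smul_comm]

namespace Fam

/-- The member of a family at the parameter value `s`. -/
def ev (s : ℝ) : Fam →ₐ[ℝ] Fn where
  toFun f n x := f.1 n (s, x)
  map_one' := rfl
  map_mul' _ _ := rfl
  map_zero' := rfl
  map_add' _ _ := rfl
  commutes' _ := rfl

lemma ev_E (s : ℝ) (f : Fam) : ev s (latticeDiff.E f) = fnShift (ev s f) := rfl

lemma ev_E_zpow (s : ℝ) (a : ℤ) (f : Fam) : ev s ((latticeDiff.E ^ a) f) = shift a (ev s f) := by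
  rw [← fnShift_zpow]
  induction a using Int.induction_on generalizing f with
  | zero => rfl
  | succ i ih => rw [zpow_add_one, zpow_add_one, AlgEquiv.mul_apply, ih]; rfl
  | pred i ih => rw [zpow_sub_one, zpow_sub_one, AlgEquiv.mul_apply, ih]; rfl

lemma ev_unit_inv (s : ℝ) (u : Famˣ) : ev s (u⁻¹ : Famˣ) = (ev s u)⁻¹ := by
  funext n x
  refine eq_inv_of_mul_eq_one_left ?_
  exact congrFun (congrFun (congrArg (ev s) u.inv_mul) n) x

lemma ev_d (s : ℝ) (f : Fam) : ev s (latticeDiff.d f) = dx (ev s f) := by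
  funext n x
  have h := (f.differentiable n (s, x)).hasFDerivAt.comp_hasDerivAt x
    ((hasDerivAt_const x s).prodMk (hasDerivAt_id x))
  exact h.deriv.symm

lemma ev_dInv (s : ℝ) {f : Fam} (hf : f ∈ latticeDiff.I) :
    ev s (latticeDiff.dInv f) = invDiff (ev s f) := by
  funext n x
  change (sumBelow f).1 n (s, x) = _
  rw [sumBelow_coe hf]
  rfl

lemma ev_rapid (s : ℝ) {f : Fam} (hf : f ∈ latticeDiff.I) :
    RapidlyDecreasing univ (ev s f) :=
  RapidlyDecreasing.comp isOpen_univ (mem_rapidIdeal.1 hf) (φ := fun x : ℝ => (s, x))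
    (contDiff_const.prodMk contDiff_id) fun _ => mem_univ _

/-- The member of a family of operators at the parameter value `s`. -/
def evOp (s : ℝ) (P : PDO latticeDiff.E) : Op := fun j => ev s (P j)

variable (s : ℝ)

lemma evOp_mul (P Q : PDO latticeDiff.E) : evOp s (P * Q) = opMul (evOp s P) (evOp s Q) := by
  rw [opMul_eq]
  have := map_mul (PDO.mapHom fnShift (ev s) (ev_E s)) P Q
  exact congrArg PDO.coeff this

lemma evOp_add (P Q : PDO latticeDiff.E) : evOp s (P + Q) = evOp s P + evOp s Q := rfl
lemma evOp_sub (P Q : PDO latticeDiff.E) : evOp s (P - Q) = evOp s P - evOp s Q := rfl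
lemma evOp_smul (c : ℝ) (P : PDO latticeDiff.E) : evOp s (c • P) = c • evOp s P := rfl

lemma evOp_single (a : ℤ) (p : Fam) :
    evOp s (PDO.single a p) = Pi.single a (ev s p) := by
  funext j
  rw [evOp, PDO.single_coeff, Pi.single_apply]
  split_ifs <;> simp

lemma evOp_pow (P : PDO latticeDiff.E) (m : ℕ) : evOp s (P ^ m) = opPow (evOp s P) m := by
  induction m with
  | zero => rw [pow_zero, PDO.one_def, evOp_single, map_one]; rfl
  | succ m ih => rw [pow_succ, evOp_mul, ih]; rfl

lemma evOp_opD (P : PDO latticeDiff.E) : evOp s (latticeDiff.opD P) = opDx (evOp s P) :=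
  funext fun _ => ev_d s _

lemma evOp_comm (P Q : PDO latticeDiff.E) :
    evOp s (P * Q - Q * P) = comm (evOp s P) (evOp s Q) := by
  rw [evOp_sub, evOp_mul, evOp_mul]; rfl

lemma evOp_hiPart (P : PDO latticeDiff.E) : evOp s (PDO.hiPart 1 P) = geOne (evOp s P) := by
  funext j
  rw [evOp, PDO.hiPart_coeff, geOne]
  split_ifs
  · rfl
  · simp

variable {s} {h : ℝ} {u : Famˣ} {v : Fn} (hv : ev s u = vbar h v)
include hv

lemma evOp_opA1 : evOp s (latticeDiff.opA1 h u) = opA1 h v := by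
  rw [LatticeDiff.opA1, evOp_single, map_smul, hv]; rfl

lemma ev_shiftUnit (a : ℤ) (n : ℤ) (x : ℝ) :
    ev s (latticeDiff.shiftUnit a u) n x = vbar h v (n + a) x := by
  rw [LatticeDiff.coe_shiftUnit, ev_E_zpow, hv]; rfl

lemma ev_prod_shiftUnit (k : ℕ) (g : ℕ → ℤ) (n : ℤ) (x : ℝ) :
    ev s ((∏ i ∈ Finset.range k, latticeDiff.shiftUnit (g i) u : Famˣ) : Fam) n x =
      ∏ i ∈ Finset.range k, vbar h v (n + g i) x := by
  rw [Units.coe_prod, map_prod, Finset.prod_apply, Finset.prod_apply]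
  exact Finset.prod_congr rfl fun i _ => ev_shiftUnit hv _ _ _

lemma ev_weight (j : ℤ) : ev s (latticeDiff.weight u j) = weight h v j := by
  funext n x
  obtain ⟨k, rfl | rfl⟩ := j.eq_nat_or_neg
  · rw [LatticeDiff.weight_natCast, ev_prod_shiftUnit hv]
    simp [weight]
  · rw [LatticeDiff.weight_neg_natCast, ev_unit_inv, Pi.inv_apply, Pi.inv_apply,
      ev_prod_shiftUnit hv]
    simp only [weight, neg_neg, Int.toNat_natCast]
    rw [show (-(k : ℤ)).toNat = 0 by omega, Finset.prod_range_zero, one_div]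
    congr 1
    exact Finset.prod_congr rfl fun i _ => by congr 1; ring

variable (hu : latticeDiff.IsPotential u)

include hu

/-- The two recursions coincide term by term, but `dInv` is summation from `-∞` only on the ideal;
hence the need for the decay of the source. -/
lemma evOp_laxTrunc (hh : h ≠ 0) (r : ℕ) :
    evOp s (latticeDiff.laxTrunc h u r) = laxTrunc h v r := by
  induction r with
  | zero => exact evOp_opA1 hv
  | succ r ih =>
    have hm := latticeDiff.laxDefect_coeffIn hu (latticeDiff.laxTrunc_spec hh hu r).1 (1 - r)
    simp only [LatticeDiff.laxTrunc, laxTrunc]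
    rw [evOp_add, evOp_single, ih, map_mul, ev_weight hv,
      ev_dInv s (latticeDiff.I.mul_mem_right _ (latticeDiff.smul_mem h hm)), map_mul, map_smul,
      ev_unit_inv, ev_weight hv, ← div_eq_mul_inv]
    congr 6
    change evOp s _ (1 - r : ℤ) = _
    rw [evOp_sub, evOp_opD, evOp_comm, ih, evOp_opA1 hv]

lemma evOp_lax (hh : h ≠ 0) : evOp s (latticeDiff.lax h u) = lax h v :=
  funext fun _ => congrFun (evOp_laxTrunc hv hu hh _) _

lemma evOp_opA (hh : h ≠ 0) (m : ℕ) :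
    evOp s (PDO.hiPart 1 (latticeDiff.lax h u ^ m)) = opA h m v := by
  rw [evOp_hiPart, evOp_pow, evOp_lax hv hu hh, opA]

omit hu in
lemma evOp_curvature (P : PDO latticeDiff.E) :
    evOp s (latticeDiff.curvature h u P) = opDx (evOp s P) + comm (evOp s P) (opA1 h v) := by
  rw [LatticeDiff.curvature, add_sub_assoc, evOp_add, evOp_opD, evOp_comm, evOp_opA1 hv]

omit hu in
lemma evOp_curvature' (P : PDO latticeDiff.E) :
    evOp s (latticeDiff.curvature h u P) = opDx (evOp s P) - comm (opA1 h v) (evOp s P) := by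
  rw [evOp_curvature hv, comm, comm]; abel

lemma ev_flowK (hh : h ≠ 0) (m : ℕ) :
    ev s (latticeDiff.curvature h u (PDO.hiPart 1 (latticeDiff.lax h u ^ m)) 1) = flowK h m v := by
  have := congrFun (evOp_curvature' hv (PDO.hiPart 1 (latticeDiff.lax h u ^ m))) 1
  rw [evOp_opA hv hu hh] at this
  exact this

omit hu hv in
lemma evOp_bgB (m : ℕ) : evOp s (latticeDiff.bgB h m) = backgroundB h m := by
  rw [LatticeDiff.bgB, evOp_add, evOp_single, evOp_single, backgroundB]
  congr 2
  funext n x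
  change _ * (x + h * (n : ℝ)) = _
  ring

lemma evOp_nonisoRhs (hh : h ≠ 0) (m : ℕ) (B : PDO latticeDiff.E) :
    evOp s (latticeDiff.nonisoRhs h m u B) = nonisoRhs h m v (evOp s B) := by
  rw [LatticeDiff.nonisoRhs, evOp_add, evOp_add, evOp_comm, evOp_smul, evOp_pow, evOp_pow,
    evOp_lax hv hu hh, nonisoRhs]

lemma evOp_truncB (hh : h ≠ 0) {m : ℕ} (hm : 1 ≤ m) (r : ℕ) :
    evOp s (latticeDiff.truncB h m u r) = truncB h m v r := by
  induction r with
  | zero => rfl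
  | succ r ih =>
    obtain ⟨h1, -, h3, -⟩ := LatticeDiff.truncB_spec hh hu hm r
    have hmem := LatticeDiff.truncB_source_mem hh hu hm (h1 _ le_rfl) h3
    have hb : ∀ j, ev s (latticeDiff.bgB h m j) = backgroundB h m j :=
      fun j => congrFun (evOp_bgB (s := s) m) j
    have hf : ev s (latticeDiff.nonisoRhs h m u (latticeDiff.truncB h m u r) (m - r + 1)) =
        nonisoRhs h m v (truncB h m v r) (m - r + 1) := by
      rw [← ih, ← evOp_nonisoRhs hv hu hh]; rfl
    simp only [LatticeDiff.truncB, truncB]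
    rw [evOp_add, evOp_single, ih, map_mul, ev_weight hv, map_add, ev_dInv s hmem, map_sub,
      map_mul, map_smul, ev_unit_inv, ev_weight hv, ← div_eq_mul_inv, map_sub, ev_E, hb, hf]
    rfl

lemma evOp_opB (hh : h ≠ 0) {m : ℕ} (hm : 1 ≤ m) :
    evOp s (latticeDiff.truncB h m u m) = opB h m v := evOp_truncB hv hu hh hm m

lemma ev_flowSigma (hh : h ≠ 0) {m : ℕ} (hm : 1 ≤ m) :
    ev s (latticeDiff.curvature h u (latticeDiff.truncB h m u m) 1) = flowSigma h m v := by
  have := congrFun (evOp_curvature hv (latticeDiff.truncB h m u m)) 1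
  rw [evOp_opB hv hu hh hm] at this
  exact this

end Fam
end DDmKP

namespace DDmKP
open Set PseudoDiff

/-! ## Locality -/

/-- The values of `F v` for `n ≤ N` over an open set depend only on the values of `v` for `n ≤ N'`
over the same set. -/
def IsLocal (F : Functional) : Prop :=
  ∀ N : ℤ, ∃ N' : ℤ, ∀ U : Set ℝ, IsOpen U → ∀ v v' : Fn,
    (∀ n ≤ N', ∀ x ∈ U, v n x = v' n x) → ∀ n ≤ N, ∀ x ∈ U, F v n x = F v' n x

namespace IsLocal

lemma const (f : Fn) : IsLocal fun _ => f := fun N => ⟨N, fun _ _ _ _ _ _ _ _ _ => rfl⟩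

lemma id : IsLocal fun v => v := fun N => ⟨N, fun _ _ _ _ h => h⟩

variable {F G : Functional}

lemma map₂ (hF : IsLocal F) (hG : IsLocal G) (op : ℝ → ℝ → ℝ) :
    IsLocal fun v n x => op (F v n x) (G v n x) := fun N => by
  obtain ⟨N₁, h₁⟩ := hF N
  obtain ⟨N₂, h₂⟩ := hG N
  refine ⟨max N₁ N₂, fun U hU v v' h n hn x hx => ?_⟩
  simp only
  rw [h₁ U hU v v' (fun n hn => h n (hn.trans (le_max_left _ _))) n hn x hx,
    h₂ U hU v v' (fun n hn => h n (hn.trans (le_max_right _ _))) n hn x hx]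

lemma add (hF : IsLocal F) (hG : IsLocal G) : IsLocal fun v => F v + G v := hF.map₂ hG (· + ·)
lemma sub (hF : IsLocal F) (hG : IsLocal G) : IsLocal fun v => F v - G v := hF.map₂ hG (· - ·)
lemma mul (hF : IsLocal F) (hG : IsLocal G) : IsLocal fun v => F v * G v := hF.map₂ hG (· * ·)
lemma div (hF : IsLocal F) (hG : IsLocal G) : IsLocal fun v => F v / G v := hF.map₂ hG (· / ·)
lemma smul (hF : IsLocal F) (c : ℝ) : IsLocal fun v => c • F v := hF.map₂ hF fun a _ => c * a
lemma zsmul (hF : IsLocal F) (c : ℤ) : IsLocal fun v => c • F v := hF.map₂ hF fun a _ => c • a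

lemma sum {ι : Type*} (s : Finset ι) {F : ι → Functional} (hF : ∀ i, IsLocal (F i)) :
    IsLocal fun v => ∑ i ∈ s, F i v := by
  classical
  induction s using Finset.induction_on with
  | empty => simpa using const 0
  | insert a s ha ih => simpa only [Finset.sum_insert ha] using (hF a).add ih

lemma prod {ι : Type*} (s : Finset ι) {F : ι → Functional} (hF : ∀ i, IsLocal (F i)) :
    IsLocal fun v => ∏ i ∈ s, F i v := by
  classical
  induction s using Finset.induction_on with
  | empty => simpa using const 1
  | insert a s ha ih => simpa only [Finset.prod_insert ha] using (hF a).mul ih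

lemma shift (hF : IsLocal F) (a : ℤ) : IsLocal fun v => shift a (F v) := fun N => by
  obtain ⟨N', h'⟩ := hF (N + a)
  exact ⟨N', fun U hU v v' h n hn x hx => h' U hU v v' h (n + a) (by omega) x hx⟩

lemma diff (hF : IsLocal F) : IsLocal fun v => diff (F v) := (hF.shift 1).sub hF

lemma iterate_diff (hF : IsLocal F) (i : ℕ) : IsLocal fun v => DDmKP.diff^[i] (F v) := by
  induction i with
  | zero => exact hF
  | succ i ih => simpa only [Function.iterate_succ_apply'] using ih.diff

/-- This is where `U` has to be open: the two functions agree near each of its points. -/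
lemma dx (hF : IsLocal F) : IsLocal fun v => dx (F v) := fun N => by
  obtain ⟨N', h'⟩ := hF N
  refine ⟨N', fun U hU v v' h n hn x hx => Filter.EventuallyEq.deriv_eq ?_⟩
  filter_upwards [hU.mem_nhds hx] with y hy
  exact h' U hU v v' h n hn y hy

/-- Summation from `-∞` only uses sites to the left of `n`, which is why locality is one-sided in
`n`. -/
lemma invDiff (hF : IsLocal F) : IsLocal fun v => invDiff (F v) := fun N => by
  obtain ⟨N', h'⟩ := hF N
  exact ⟨N', fun U hU v v' h n hn x hx =>
    tsum_congr fun k => h' U hU v v' h (n - 1 - k) (by omega) x hx⟩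

lemma vbar (h : ℝ) : IsLocal (vbar h) := id.map₂ id fun a _ => 1 + h * a

lemma weight (h : ℝ) (j : ℤ) : IsLocal fun v => weight h v j := by
  have h1 := (prod (Finset.range j.toNat) (F := fun i v => DDmKP.shift i (DDmKP.vbar h v))
    fun i => (vbar h).shift i).div (prod (Finset.range (-j).toNat)
    (F := fun i v => DDmKP.shift (-1 - i) (DDmKP.vbar h v)) fun i => (vbar h).shift (-1 - i))
  convert h1 using 2 with v
  funext n x
  simp only [DDmKP.weight, DDmKP.shift, Pi.div_apply, Finset.prod_apply]
  congr 1
  exact Finset.prod_congr rfl fun i _ => by congr 1; ring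

end IsLocal

/-- Operators of order at most `p` with local coefficients. -/
structure IsLocalOp (P : Fn → Op) (p : ℤ) : Prop where
  order : ∀ v j, p < j → P v j = 0
  loc : ∀ j, IsLocal fun v => P v j

namespace IsLocalOp

variable {P Q : Fn → Op} {p q : ℤ}

lemma mono (hP : IsLocalOp P p) (h : p ≤ q) : IsLocalOp P q :=
  ⟨fun v j hj => hP.order v j (by omega), hP.loc⟩

lemma add (hP : IsLocalOp P p) (hQ : IsLocalOp Q p) : IsLocalOp (fun v => P v + Q v) p :=
  ⟨fun v j hj => by simp [hP.order v j hj, hQ.order v j hj], fun j => (hP.loc j).add (hQ.loc j)⟩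

lemma sub (hP : IsLocalOp P p) (hQ : IsLocalOp Q p) : IsLocalOp (fun v => P v - Q v) p :=
  ⟨fun v j hj => by simp [hP.order v j hj, hQ.order v j hj], fun j => (hP.loc j).sub (hQ.loc j)⟩

lemma smul (hP : IsLocalOp P p) (c : ℝ) : IsLocalOp (fun v => c • P v) p :=
  ⟨fun v j hj => by simp [hP.order v j hj], fun j => (hP.loc j).smul c⟩

lemma opDx (hP : IsLocalOp P p) : IsLocalOp (fun v => opDx (P v)) p :=
  ⟨fun v j hj => by
    funext n x
    simp only [DDmKP.opDx, DDmKP.dx, hP.order v j hj]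
    exact deriv_const x 0, fun j => (hP.loc j).dx⟩

lemma single (a : ℤ) {F : Functional} (hF : IsLocal F) : IsLocalOp (fun v => Pi.single a (F v)) a :=
  ⟨fun v j hj => Pi.single_eq_of_ne (M := fun _ => Fn) (by omega) _, fun j => by
    rcases eq_or_ne j a with rfl | h
    · simpa using hF
    · simpa [h] using IsLocal.const 0⟩

lemma geOne (hP : IsLocalOp P p) : IsLocalOp (fun v => geOne (P v)) p :=
  ⟨fun v j hj => by simp [DDmKP.geOne, hP.order v j hj], fun j => by
    by_cases h : 1 ≤ j
    · simpa [DDmKP.geOne, h] using hP.loc j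
    · simpa [DDmKP.geOne, h] using IsLocal.const 0⟩

/-- The bounds on the order are uniform in `v`, so a given coefficient of the product is the same
finite sum for all `v`. -/
lemma mul (hP : IsLocalOp P p) (hQ : IsLocalOp Q q) :
    IsLocalOp (fun v => opMul (P v) (Q v)) (p + q) where
  order v j hj := by
    simp only [opMul_eq]
    exact PDO.mulCoeff_eq_zero (hP.order v) (hQ.order v) hj
  loc k := by
    simp only [opMul_eq]
    have e : ∀ v, PDO.mulCoeff fnShift (P v) (Q v) k = _ := fun v =>
      PDO.mulCoeff_eq_sum (hP.order v) (hQ.order v) (k := k) subset_rfl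
        (N := (p + q - k + 1).toNat) (by omega)
    simp only [e, leibnizCoeff_apply, fnShift_zpow, delta_fnShift_pow]
    exact IsLocal.sum _ fun a => IsLocal.sum _ fun i =>
      (hP.loc a).mul ((((hQ.loc _).shift _).iterate_diff i).zsmul _)

lemma comm (hP : IsLocalOp P p) (hQ : IsLocalOp Q q) :
    IsLocalOp (fun v => comm (P v) (Q v)) (p + q) :=
  (hP.mul hQ).sub ((hQ.mul hP).mono (by omega))

lemma pow (hP : IsLocalOp P 1) (m : ℕ) : IsLocalOp (fun v => opPow (P v) m) m := by
  induction m with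
  | zero => exact single 0 (IsLocal.const 1)
  | succ m ih => exact (ih.mul hP).mono (by push_cast; omega)

variable (h : ℝ)

lemma opA1 : IsLocalOp (opA1 h) 1 := single 1 ((IsLocal.vbar h).smul h⁻¹)

lemma laxTrunc (r : ℕ) : IsLocalOp (fun v => laxTrunc h v r) 1 := by
  induction r with
  | zero => exact opA1 h
  | succ r ih =>
    refine ih.add ((single _ ?_).mono (by omega : -(r : ℤ) ≤ 1))
    exact (IsLocal.weight h _).mul
      (((((ih.opDx.mono (by omega)).sub ((opA1 h).comm ih)).loc _).smul h).div
        (IsLocal.weight h _)).invDiff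

lemma lax : IsLocalOp (lax h) 1 := ⟨fun v j hj => (laxTrunc h _).order v j hj, fun j =>
  (laxTrunc h _).loc j⟩

lemma opA (m : ℕ) : IsLocalOp (opA h m) m := ((lax h).pow m).geOne

lemma nonisoRhs {m : ℕ} (hP : IsLocalOp P m) : IsLocalOp (fun v => nonisoRhs h m v (P v)) (m + 1) :=
  ((hP.comm (lax h)).add ((((lax h).pow m).smul h).mono (by omega))).add
    (((lax h).pow (m - 1)).mono (by omega))

lemma truncB (m r : ℕ) : IsLocalOp (fun v => truncB h m v r) m := by
  induction r with
  | zero => exact ⟨fun _ _ _ => rfl, fun _ => IsLocal.const 0⟩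
  | succ r ih =>
    refine ih.add ((single _ ?_).mono (by omega : (m : ℤ) - r ≤ m))
    exact (IsLocal.weight h _).mul ((IsLocal.const _).add
      (((((nonisoRhs h ih).loc _).smul h).div (IsLocal.weight h _)).sub (IsLocal.const _)).invDiff)

end IsLocalOp

lemma isLocal_lax (h : ℝ) (j : ℤ) : IsLocal fun v => lax h v j := (IsLocalOp.lax h).loc j

lemma isLocal_flowK (h : ℝ) (m : ℕ) : IsLocal (flowK h m) :=
  (((IsLocalOp.opA h m).opDx.mono (by omega : (m : ℤ) ≤ 1 + m)).sub
    ((IsLocalOp.opA1 h).comm (IsLocalOp.opA h m))).loc 1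

lemma isLocal_flowSigma (h : ℝ) (m : ℕ) : IsLocal (flowSigma h m) :=
  (((IsLocalOp.truncB h m m).opDx.mono (by omega : (m : ℤ) ≤ m + 1)).add
    ((IsLocalOp.truncB h m m).comm (IsLocalOp.opA1 h))).loc 1

/-! ## Families through a potential -/

lemma RapidlyDecreasing.comp_snd {f : Fn} (hf : RapidlyDecreasing univ f) :
    RapidlyDecreasing univ (fun n (z : ℝ × ℝ) => f n z.2) :=
  RapidlyDecreasing.comp isOpen_univ hf contDiff_snd fun _ => mem_univ _

/-- The constant family. -/
lemma Admissible.constFamily {h : ℝ} {v : Fn} (hv : Admissible h v) :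
    AdmissibleFamily h (fun n z => v n z.2) := ⟨hv.1.comp_snd, fun n z => hv.2 n z.2⟩

/-- The member of a family of potentials at the parameter value `s`. -/
def fiber (w : ℤ → ℝ × ℝ → ℝ) (s : ℝ) : Fn := fun n x => w n (s, x)

lemma AdmissibleFamily.admissible {h : ℝ} {w : ℤ → ℝ × ℝ → ℝ} (hw : AdmissibleFamily h w) (s : ℝ) :
    Admissible h (fiber w s) :=
  ⟨RapidlyDecreasing.comp isOpen_univ hw.rapid (φ := fun x : ℝ => (s, x))
    (contDiff_const.prodMk contDiff_id) fun _ => mem_univ _, fun n x => hw.ne_zero n (s, x)⟩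

lemma Fam.ev_unitOf {h : ℝ} {w : ℤ → ℝ × ℝ → ℝ} (hw : AdmissibleFamily h w) (s : ℝ) :
    ev s (unitOf h w hw) = vbar h (fiber w s) := rfl

/-- A change of parameter inverting `s ↦ δ sin (s / δ)` near `0`. -/
def arcsinScale (δ ε : ℝ) : ℝ := δ * Real.arcsin (ε / δ)

lemma sinScale_arcsinScale {δ ε : ℝ} (hδ : 0 < δ) (h : |ε| ≤ δ) :
    δ * Real.sin (arcsinScale δ ε / δ) = ε := by
  have h1 := abs_le.1 h
  rw [arcsinScale, mul_div_cancel_left₀ _ hδ.ne', Real.sin_arcsin]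
  · field_simp
  · rw [le_div_iff₀ hδ]; linarith
  · rw [div_le_iff₀ hδ]; linarith

lemma arcsinScale_zero (δ : ℝ) : arcsinScale δ 0 = 0 := by simp [arcsinScale]

lemma hasDerivAt_arcsinScale {δ : ℝ} (hδ : 0 < δ) : HasDerivAt (arcsinScale δ) 1 0 := by
  have h1 : HasDerivAt (fun ε : ℝ => ε / δ) (1 / δ) 0 := (hasDerivAt_id (0 : ℝ)).div_const δ
  have h2 : HasDerivAt Real.arcsin (1 / √(1 - (0 / δ) ^ 2)) (0 / δ) :=
    Real.hasDerivAt_arcsin (by simp) (by simp)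
  have h3 := (h2.comp 0 h1).const_mul δ
  exact h3.congr_deriv (by simp [hδ.ne'])

lemma hasDerivAt_sinScale {δ : ℝ} (hδ : 0 < δ) :
    HasDerivAt (fun s : ℝ => δ * Real.sin (s / δ)) 1 0 := by
  have h1 : HasDerivAt (fun ε : ℝ => ε / δ) (1 / δ) 0 := (hasDerivAt_id (0 : ℝ)).div_const δ
  exact ((h1.sin).const_mul δ).congr_deriv (by simp [hδ.ne'])

lemma contDiff_sinScale (δ : ℝ) : ContDiff ℝ ∞ fun s : ℝ => δ * Real.sin (s / δ) :=
  contDiff_const.mul (Real.contDiff_sin.comp (contDiff_id.div_const δ))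

lemma abs_sinScale_le {δ : ℝ} (hδ : 0 < δ) (s : ℝ) : |δ * Real.sin (s / δ)| ≤ δ := by
  rw [abs_mul, abs_of_pos hδ]
  exact mul_le_of_le_one_right hδ.le (Real.abs_sin_le_one _)

lemma hasDerivAt_of_fderiv {f : ℝ × ℝ → ℝ} {x : ℝ} (hf : DifferentiableAt ℝ f (0, x)) :
    HasDerivAt (fun s => f (s, x)) (fderiv ℝ f (0, x) (1, 0)) 0 := by
  have h := hf.hasFDerivAt.comp_hasDerivAt (0 : ℝ)
    ((hasDerivAt_id (0 : ℝ)).prodMk (hasDerivAt_const (0 : ℝ) x))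
  exact h

/-- An admissible family with prescribed velocity which near a given point is a straight line. -/
theorem exists_family_of_velocity {h : ℝ} {v g : Fn} (hv : Admissible h v)
    (hg : RapidlyDecreasing univ g) (N : ℕ) (x₀ : ℝ) :
    ∃ w, AdmissibleFamily h w ∧ fiber w 0 = v ∧
      (∀ n x, fderiv ℝ (w n) (0, x) (1, 0) = g n x) ∧
      ∃ δ > 0, ∃ U, IsOpen U ∧ x₀ ∈ U ∧ ∀ ε, |ε| ≤ δ → ∀ n ≤ (N : ℤ), ∀ x ∈ U,
        fiber w (arcsinScale δ ε) n x = (v + ε • g) n x := by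
  have hr : RapidlyDecreasing univ (vbar h v - 1) := by
    have : vbar h v - 1 = (fun _ _ => h) * v := by funext n z; simp [vbar]
    rw [this]
    exact RapidlyDecreasing.moderate_mul (moderate_const h) hv.1
  set a : Fn := (vbar h v)⁻¹ * g with ha
  have haR : RapidlyDecreasing univ a := RapidlyDecreasing.moderate_mul (moderate_inv hr hv.2) hg
  let χ : ContDiffBump x₀ := ⟨1, 2, one_pos, one_lt_two⟩
  -- a bound for the relative velocity on the support of the cutoff
  obtain ⟨M, hM0, hM⟩ : ∃ M : ℝ, 0 ≤ M ∧ ∀ n ≤ (N : ℤ), ∀ x ∈ tsupport χ, |a n x| ≤ M := by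
    obtain ⟨M, hM⟩ := (haR.shift N).2 _ (subset_univ _) χ.hasCompactSupport 0 0
    refine ⟨|M|, abs_nonneg _, fun n hn x hx => ?_⟩
    have := hM (n - N) (by omega) x hx
    rw [pow_zero, one_mul, norm_iteratedFDeriv_zero] at this
    simp only [sub_add_cancel] at this
    exact this.trans (le_abs_self _)
  -- Chosen so that `|h ψ a| ≤ |h| δ M ≤ 1/2` wherever the cutoff `θ` below does not vanish.
  set δ : ℝ := 1 / (2 * (|h| * M + 1)) with hδ
  have hδ0 : 0 < δ := by positivity
  -- The family has to be defined for all real `s`; the sine keeps the displacement in `[-δ, δ]` and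
  -- has derivative `1` at `0`.
  set ψ : ℝ → ℝ := fun s => δ * Real.sin (s / δ) with hψ
  have hψc : ContDiff ℝ ∞ ψ := contDiff_sinScale δ
  set θ : Fn := fun n x => if n ≤ (N : ℤ) then χ x else 0 with hθ
  have hθc : ∀ n, ContDiff ℝ ∞ (θ n) := fun n => by
    by_cases hn : n ≤ (N : ℤ)
    · have : θ n = χ := by funext x; simp [hθ, hn]
      rw [this]; exact χ.contDiff
    · have : θ n = fun _ => 0 := by funext x; simp [hθ, hn]
      rw [this]; exact contDiff_const
  -- With `y = h ψ a` this means `1 + h w = v̄ (1 + y + (1 - θ) y²)`. Where `θ = 0` the factor `1 +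
  -- y + y²` is positive for every `y`; elsewhere `|y| ≤ 1/2`. The quadratic term does not affect
  -- the velocity at `s = 0`, and where `θ = 1` it disappears and leaves the straight line.
  set w : ℤ → ℝ × ℝ → ℝ := fun n z =>
    v n z.2 + ψ z.1 * g n z.2 + (1 - θ n z.2) * ψ z.1 ^ 2 * h * a n z.2 * g n z.2 with hw
  have hvb : ∀ n x, g n x = a n x * vbar h v n x := fun n x => by
    simp only [ha, Pi.mul_apply, Pi.inv_apply]
    field_simp [hv.2 n x]
  have hwb : ∀ n z, 1 + h * w n z = vbar h v n z.2 * (1 + h * ψ z.1 * a n z.2 +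
      (1 - θ n z.2) * (h * ψ z.1 * a n z.2) ^ 2) := fun n z => by
    simp only [hw]
    rw [hvb n z.2]
    simp only [vbar]
    ring
  have hψ0 : ψ 0 = 0 := by simp [hψ]
  refine ⟨w, ⟨?_, fun n z => ?_⟩, ?_, fun n x => ?_, δ, hδ0, Metric.ball x₀ 1, Metric.isOpen_ball,
    Metric.mem_ball_self one_pos, fun ε hε n hn x hx => ?_⟩
  · have m1 : Moderate (fun (_ : ℤ) (z : ℝ × ℝ) => ψ z.1) :=
      moderate_of_const (b := fun z => ψ z.1) (fun _ => hψc.comp contDiff_fst) fun _ _ => rfl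
    have m2 : Moderate (fun (n : ℤ) (z : ℝ × ℝ) => (1 - θ n z.2) * ψ z.1 ^ 2 * h) := by
      refine moderate_of_const (b := fun z => (1 - χ z.2) * ψ z.1 ^ 2 * h) (fun n => ?_) fun n hn => ?_
      · exact ((contDiff_const.sub ((hθc n).comp contDiff_snd)).mul
          ((hψc.comp contDiff_fst).pow 2)).mul contDiff_const
      · funext z
        simp [hθ, show n ≤ (N : ℤ) by omega]
    exact (hv.1.comp_snd.add (RapidlyDecreasing.moderate_mul m1 hg.comp_snd)).add
      (RapidlyDecreasing.moderate_mul (m2.mul haR.comp_snd.moderate) hg.comp_snd)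
  · rw [hwb]
    refine mul_ne_zero (hv.2 _ _) (ne_of_gt ?_)
    set y := h * ψ z.1 * a n z.2 with hy
    have hθ01 : 0 ≤ θ n z.2 ∧ θ n z.2 ≤ 1 := by
      simp only [hθ]
      split_ifs
      · exact ⟨χ.nonneg, χ.le_one⟩
      · simp
    by_cases hz : n ≤ (N : ℤ) ∧ z.2 ∈ tsupport χ
    · have h1 : |y| ≤ 1 / 2 := by
        rw [hy, abs_mul, abs_mul]
        calc |h| * |ψ z.1| * |a n z.2| ≤ |h| * δ * M := by
              gcongr
              · exact abs_sinScale_le hδ0 _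
              · exact hM n hz.1 _ hz.2
          _ = (|h| * M) / (2 * (|h| * M + 1)) := by rw [hδ]; ring
          _ ≤ 1 / 2 := by
              rw [div_le_div_iff₀ (by positivity) two_pos]
              linarith
      have h2 := (abs_le.1 h1).1
      nlinarith [mul_nonneg (sub_nonneg.2 hθ01.2) (sq_nonneg y)]
    · have h0 : θ n z.2 = 0 := by
        simp only [hθ]
        split_ifs with hn
        · exact image_eq_zero_of_notMem_tsupport fun h => hz ⟨hn, h⟩
        · rfl
      rw [h0]
      nlinarith [sq_nonneg (y + 1 / 2)]
  · funext n x
    simp [fiber, hw, hψ0]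
  · have hd : DifferentiableAt ℝ (w n) (0, x) := by
      have c1 := rapidlyDecreasing_contDiff hv.1 n
      have c2 := rapidlyDecreasing_contDiff hg n
      have c3 := rapidlyDecreasing_contDiff haR n
      have : ContDiff ℝ ∞ (w n) :=
        ((c1.comp contDiff_snd).add ((hψc.comp contDiff_fst).mul (c2.comp contDiff_snd))).add
          (((((contDiff_const.sub ((hθc n).comp contDiff_snd)).mul
          ((hψc.comp contDiff_fst).pow 2)).mul contDiff_const).mul (c3.comp contDiff_snd)).mul
          (c2.comp contDiff_snd))
      exact this.differentiable (by simp) _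
    have h1 : HasDerivAt (fun s => w n (s, x)) (fderiv ℝ (w n) (0, x) (1, 0)) 0 :=
      hasDerivAt_of_fderiv hd
    have hψd : HasDerivAt ψ 1 0 := hasDerivAt_sinScale hδ0
    have h2 : HasDerivAt (fun s => w n (s, x)) (1 * g n x +
        (1 - θ n x) * (((2 : ℕ) : ℝ) * ψ 0 ^ (2 - 1) * 1) * h * a n x * g n x) 0 :=
      ((hψd.mul_const (g n x)).const_add (v n x)).add (((((hψd.pow 2).const_mul
        (1 - θ n x)).mul_const h).mul_const (a n x)).mul_const (g n x))
    rw [h1.unique h2, hψ0]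
    simp
  · have hχ : χ x = 1 := χ.one_of_mem_closedBall (Metric.ball_subset_closedBall hx)
    have hs : ψ (arcsinScale δ ε) = ε := sinScale_arcsinScale hδ0 hε
    simp [fiber, hw, hθ, hn, hχ, hs]

/-- Gateaux derivatives are derivatives along families. -/
theorem exists_family_hasDerivAt {h : ℝ} {v g : Fn} (hv : Admissible h v)
    (hg : RapidlyDecreasing univ g) {F : Functional} (hF : IsLocal F) (n₀ : ℤ) (x₀ : ℝ) :
    ∃ w, AdmissibleFamily h w ∧ fiber w 0 = v ∧
      (∀ n x, fderiv ℝ (w n) (0, x) (1, 0) = g n x) ∧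
      ∀ f' : ℝ, HasDerivAt (fun s => F (fiber w s) n₀ x₀) f' 0 →
        HasDerivAt (fun ε : ℝ => F (v + ε • g) n₀ x₀) f' 0 := by
  obtain ⟨N', hN'⟩ := hF n₀
  obtain ⟨w, hw, hw0, hwg, δ, hδ, U, hU, hxU, hline⟩ :=
    exists_family_of_velocity hv hg N'.toNat x₀
  refine ⟨w, hw, hw0, hwg, fun f' hf => ?_⟩
  rw [← arcsinScale_zero δ] at hf
  have h1 := hf.comp 0 (hasDerivAt_arcsinScale hδ)
  rw [mul_one] at h1
  refine h1.congr_of_eventuallyEq ?_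
  have : ∀ᶠ ε : ℝ in nhds 0, |ε| < δ := by
    have := Metric.ball_mem_nhds (0 : ℝ) hδ
    filter_upwards [this] with ε hε
    simpa using hε
  filter_upwards [this] with ε hε
  exact hN' U hU _ _ (fun n hn x hx => (hline ε hε.le n (by omega) x hx).symm) n₀ le_rfl x₀ hxU

/-- The family of potentials swept by a solution near a given time. -/
theorem IsSolution.exists_family {h : ℝ} {K : Functional} {I : Set ℝ} {v : ℝ → Fn} (hI : IsOpen I)
    (hv : IsSolution h K I v) {t : ℝ} (ht : t ∈ I) :
    ∃ w, AdmissibleFamily h w ∧ fiber w 0 = v t ∧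
      (∀ n x, fderiv ℝ (w n) (0, x) (1, 0) = K (v t) n x) ∧
      ∀ (F : Functional) (n : ℤ) (x f' : ℝ), HasDerivAt (fun s => F (fiber w s) n x) f' 0 →
        HasDerivAt (fun t => F (v t) n x) f' t := by
  obtain ⟨δ, hδ, hball⟩ := Metric.isOpen_iff.1 hI t ht
  set η := δ / 2 with hη
  have hη0 : 0 < η := by positivity
  -- A reparametrization of time, defined for all `s` and confined to a ball inside `I`, with
  -- velocity `1` at `s = 0`.
  set φ : ℝ → ℝ := fun s => t + η * Real.sin (s / η) with hφ
  have hφI : ∀ s, φ s ∈ I := fun s => hball (by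
    rw [Metric.mem_ball, Real.dist_eq, hφ, add_sub_cancel_left]
    linarith [abs_sinScale_le hη0 s])
  have hφc : ContDiff ℝ ∞ φ := contDiff_const.add (contDiff_sinScale η)
  have hφ0 : φ 0 = t := by simp [hφ]
  set w : ℤ → ℝ × ℝ → ℝ := fun n z => v (φ z.1) n z.2 with hw
  have hwR : RapidlyDecreasing univ w :=
    RapidlyDecreasing.comp (hI.prod isOpen_univ) hv.smooth (φ := fun z : ℝ × ℝ => (φ z.1, z.2))
      ((hφc.comp contDiff_fst).prodMk contDiff_snd) fun z => ⟨hφI _, mem_univ _⟩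
  refine ⟨w, ⟨hwR, fun n z => hv.ne_zero _ (hφI _) n z.2⟩, ?_, fun n x => ?_, fun F n x f' hf => ?_⟩
  · funext n x; simp only [fiber, hw, hφ0]
  · have hd : DifferentiableAt ℝ (w n) (0, x) :=
      (rapidlyDecreasing_contDiff hwR n).differentiable (by simp) _
    have h1 : HasDerivAt (fun s => w n (s, x)) (fderiv ℝ (w n) (0, x) (1, 0)) 0 :=
      hasDerivAt_of_fderiv hd
    have h2 := hv.eqn t ht n x
    rw [← hφ0] at h2
    have h3 := h2.comp 0 ((hasDerivAt_sinScale hη0).const_add t)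
    rw [mul_one, hφ0] at h3
    exact h1.unique h3
  · have h0 : arcsinScale η (t - t) = 0 := by rw [sub_self, arcsinScale_zero]
    have h1 := hasDerivAt_arcsinScale hη0
    rw [← sub_self t] at h1
    have h2 : HasDerivAt (fun t' => arcsinScale η (t' - t)) 1 t := by
      have := HasDerivAt.comp (h := fun t' => t' - t) t h1 ((hasDerivAt_id t).sub_const t)
      rwa [mul_one] at this
    rw [← h0] at hf
    have h3 := hf.comp t h2
    rw [mul_one] at h3
    refine h3.congr_of_eventuallyEq ?_
    filter_upwards [Metric.ball_mem_nhds t hη0] with t' ht'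
    rw [Metric.mem_ball, Real.dist_eq] at ht'
    have : fiber w (arcsinScale η (t' - t)) = v t' := by
      funext n x
      simp only [fiber, hw, hφ]
      rw [sinScale_arcsinScale hη0 ht'.le, add_sub_cancel]
    simp only [Function.comp_apply, this]

end DDmKP

namespace DDmKP
open Set PseudoDiff
open Polynomial (aeval derivative X)
open scoped Polynomial

/-! ## The hierarchy is well defined -/

namespace Fam

lemma ext_ev {f g : Fam} (h : ∀ s, ev s f = ev s g) : f = g :=
  ext fun n z => congrFun (congrFun (h z.1) n) z.2

lemma ext_evOp {P Q : PDO latticeDiff.E} (h : ∀ s, evOp s P = evOp s Q) : P = Q :=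
  PDO.ext' fun j => ext_ev fun s => congrFun (h s) j

lemma evOp_coeff (s : ℝ) (P : PDO latticeDiff.E) (j : ℤ) : evOp s P j = ev s (P j) := rfl

/-- The constant family of operators. -/
def constOp (P : Op) (hP : ∀ j, Moderate (P j)) (hb : ∃ M : ℤ, ∀ j, M < j → P j = 0) :
    PDO latticeDiff.E where
  coeff j := ⟨fun n z => P j n z.2, (hP j).comp_clm (ContinuousLinearMap.snd ℝ ℝ ℝ)⟩
  bdd := by
    obtain ⟨M, hM⟩ := hb
    exact ⟨M, fun j hj => ext fun n z => by simp [hM j hj]⟩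

variable {P : Op} {hP : ∀ j, Moderate (P j)} {hb : ∃ M : ℤ, ∀ j, M < j → P j = 0}

lemma evOp_constOp (s : ℝ) : evOp s (constOp P hP hb) = P := rfl

lemma moderate_ev (f : Fam) : Moderate (ev 0 f) :=
  f.2.comp_clm (ContinuousLinearMap.inr ℝ ℝ ℝ)

end Fam

open Fam

variable {h : ℝ}

section WellDefined

variable {v : Fn}

/-- The unit `v̄`, as a constant family. -/
def Admissible.unit (hv : Admissible h v) : Famˣ := unitOf h _ hv.constFamily

lemma Admissible.ev_unit (hv : Admissible h v) (s : ℝ) : ev s hv.unit = vbar h v := rfl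

lemma Admissible.isPotential (hv : Admissible h v) : latticeDiff.IsPotential hv.unit :=
  isPotential_unitOf _

lemma isLax_lax (hh : h ≠ 0) (hv : Admissible h v) : IsLax h v (lax h v) := by
  have hL := latticeDiff.isLax_lax hh hv.isPotential
  have e := evOp_lax (s := 0) (hv.ev_unit 0) hv.isPotential hh
  rw [← e]
  refine ⟨fun j hj => ?_, ?_, fun j hj => ev_rapid 0 (hL.decay j hj), ?_⟩
  · rw [evOp_coeff, hL.order j hj, map_zero]
  · rw [evOp_coeff, hL.leading, map_smul, hv.ev_unit]
  · rw [← evOp_opD, hL.eqn, evOp_comm, evOp_opA1 (hv.ev_unit 0)]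

/-- `L` is regarded as a family constant in the parameter, so that the abstract uniqueness applies.
-/
lemma IsLax.eq_lax (hh : h ≠ 0) (hv : Admissible h v) {L : Op} (hL : IsLax h v L) :
    L = lax h v := by
  have hm : ∀ j, Moderate (L j) := fun j => by
    rcases lt_trichotomy j 1 with hj | rfl | hj
    · exact (hL.decay j (by omega)).moderate
    · rw [hL.leading]
      have := moderate_ev (h⁻¹ • (hv.unit : Fam))
      rwa [map_smul, hv.ev_unit] at this
    · rw [hL.order j hj]; exact RapidlyDecreasing.zero.moderate
  set L' := constOp L hm ⟨1, hL.order⟩ with hL'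
  have key : L' = latticeDiff.lax h hv.unit := by
    refine LatticeDiff.IsLax.eq_lax _ hh hv.isPotential ⟨fun j hj => ?_, ?_, fun j hj => ?_, ?_⟩
    · exact ext_ev fun s => by rw [← evOp_coeff, evOp_constOp, hL.order j hj, map_zero]
    · exact ext_ev fun s => by
        rw [← evOp_coeff, evOp_constOp, hL.leading, map_smul, hv.ev_unit]
    · exact (hL.decay j hj).comp_snd
    · exact ext_evOp fun s => by
        rw [evOp_opD, evOp_comm, evOp_opA1 (hv.ev_unit s), evOp_constOp, hL.eqn]
  rw [← evOp_lax (hv.ev_unit 0) hv.isPotential hh, ← key, evOp_constOp]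

lemma bg_eq_bgB {m : ℕ} (hm : 2 ≤ m) (j : ℤ) :
    latticeDiff.bg h 0 (X ^ (m - 1)) j = latticeDiff.bgB h m j := by
  rw [LatticeDiff.bgB_eq (by omega)]

lemma isOpB_opB (hh : h ≠ 0) (hv : Admissible h v) {m : ℕ} (hm : 2 ≤ m) :
    IsOpB h m v (opB h m v) := by
  have hB := LatticeDiff.isFlow_truncB hh hv.isPotential hm
  have hs := LatticeDiff.truncB_spec hh hv.isPotential (by omega : 1 ≤ m) m
  have e := evOp_opB (s := 0) (hv.ev_unit 0) hv.isPotential hh (by omega : 1 ≤ m)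
  rw [← e]
  refine ⟨fun j hj => ?_, fun j => ?_, fun j hj => ?_⟩
  · rcases hj with hj | hj
    · rw [evOp_coeff, hB.pos j hj, map_zero]
    · rw [evOp_coeff, hs.2.1 j hj, map_zero]
  · have := ev_rapid 0 (hB.asym j)
    rwa [PDO.sub_coeff, bg_eq_bgB hm, map_sub, ← evOp_coeff 0 (latticeDiff.bgB h m), evOp_bgB] at this
  · have := hB.eqn j (by omega)
    rw [← LatticeDiff.nonisoRhs_eq (by omega : 1 ≤ m)] at this
    rw [← evOp_nonisoRhs (hv.ev_unit 0) hv.isPotential hh, evOp_coeff, this, map_zero]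

lemma IsOpB.eq_opB (hh : h ≠ 0) (hv : Admissible h v) {m : ℕ} (hm : 2 ≤ m) {B : Op}
    (hB : IsOpB h m v B) : B = opB h m v := by
  have hmod : ∀ j, Moderate (B j) := fun j => by
    have := (hB.asymptotics j).moderate.add (moderate_ev (latticeDiff.bgB h m j))
    rwa [← evOp_coeff, evOp_bgB, sub_add_cancel] at this
  set B' := constOp B hmod ⟨m, fun j hj => hB.form j (Or.inr hj)⟩ with hB'
  have hflow : latticeDiff.IsFlow h hv.unit B' 0 (X ^ (m - 1)) := by
    refine ⟨fun j hj => ?_, fun j => ?_, fun j hj => ?_⟩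
    · exact ext_ev fun s => by
        rw [← evOp_coeff, evOp_constOp, hB.form j (Or.inl hj), map_zero]
    · have e : B' j - latticeDiff.bgB h m j =
          ⟨fun n z => (B j - backgroundB h m j) n z.2, (hB.asymptotics j).comp_snd.moderate⟩ :=
        ext_ev fun s => by
          rw [map_sub, ← evOp_coeff, ← evOp_coeff, evOp_bgB, evOp_constOp]
          rfl
      rw [PDO.sub_coeff, bg_eq_bgB hm, e]
      exact (hB.asymptotics j).comp_snd
    · rw [← LatticeDiff.nonisoRhs_eq (by omega : 1 ≤ m)]
      refine ext_ev fun s => ?_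
      rw [← evOp_coeff, evOp_nonisoRhs (hv.ev_unit s) hv.isPotential hh, evOp_constOp,
        hB.eqn j (by omega), map_zero]
  have key := hflow.eq hh hv.isPotential (LatticeDiff.isFlow_truncB hh hv.isPotential hm)
  rw [← evOp_opB (hv.ev_unit 0) hv.isPotential hh (by omega : 1 ≤ m), ← key, evOp_constOp]

/-- The parameter derivative of `1 + h w` at `s = 0`. -/
lemma jet_δ_unitOf {w : ℤ → ℝ × ℝ → ℝ} (hw : AdmissibleFamily h w) {f : Fam}
    (hf : ∀ n s x, fderiv ℝ (w n) (0, x) (1, 0) = f.1 n (s, x)) :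
    jet.δ (unitOf h w hw) = h • f := Fam.ext fun n z => by
  rw [jet_δ_apply]
  change fderiv ℝ (fun z => 1 + h * w n z) (0, z.2) (1, 0) = h * f.1 n z
  have hd : DifferentiableAt ℝ (w n) (0, z.2) :=
    (rapidlyDecreasing_contDiff hw.rapid n).differentiable (by simp) _
  rw [fderiv_const_add, fderiv_const_mul hd, smul_apply, hf n z.1, smul_eq_mul]

lemma jet_π_unitOf (hv : Admissible h v) {w : ℤ → ℝ × ℝ → ℝ} (hw : AdmissibleFamily h w)
    (h0 : fiber w 0 = v) : jet.π (unitOf h w hw) = hv.unit := Fam.ext fun n z => by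
  subst h0; rfl

/-- The derivative of the Lax operator along a flow. -/
theorem gateaux_lax (hh : h ≠ 0) (hv : Admissible h v) {Q : PDO latticeDiff.E} {p q : ℝ[X]}
    (hQ : latticeDiff.IsFlow h hv.unit Q p q) {g : Fn}
    (hg : ∀ s, ev s (latticeDiff.curvature h hv.unit Q 1) = g) (j : ℤ) :
    GateauxDiff (fun u => lax h u j) v g ∧ gateaux (fun u => lax h u j) v g =
      evOp 0 (Q * latticeDiff.lax h hv.unit - latticeDiff.lax h hv.unit * Q +
        aeval (latticeDiff.lax h hv.unit) (sym h q)) j := by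
  have hgR : RapidlyDecreasing univ g := by
    rw [← hg 0]; exact ev_rapid 0 (hQ.curvature_coeffIn hh hv.isPotential 1)
  have key : ∀ n x, HasDerivAt (fun ε : ℝ => lax h (v + ε • g) j n x)
      (evOp 0 (Q * latticeDiff.lax h hv.unit - latticeDiff.lax h hv.unit * Q +
        aeval (latticeDiff.lax h hv.unit) (sym h q)) j n x) 0 := by
    intro n x
    -- The line is exchanged for an admissible family of the same velocity, along which `opδ_lax` is
    -- available.
    obtain ⟨w, hw, hw0, hwg, hd⟩ := exists_family_hasDerivAt hv hgR (isLocal_lax h j) n x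
    refine hd _ ?_
    have hδ := jet.opδ_lax hh hv.isPotential (isPotential_unitOf hw) (jet_π_unitOf hv hw hw0) hQ
      (jet_δ_unitOf hw fun n s x => by rw [hwg, ← hg s]; rfl)
    have := hasDerivAt_jet (latticeDiff.lax h (unitOf h w hw) j) n 0 x
    rw [← Jet.opδ_coeff, hδ] at this
    refine this.congr_of_eventuallyEq (Filter.Eventually.of_forall fun s => ?_)
    simp only
    rw [← evOp_lax (ev_unitOf hw s) (isPotential_unitOf hw) hh]
    rfl
  exact ⟨fun n x => (key n x).differentiableAt, funext fun n => funext fun x => (key n x).deriv⟩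

theorem hierarchyWellDefined (hh : h ≠ 0) (hv : Admissible h v) : HierarchyWellDefined h v where
  lax_unique L := ⟨fun hL => hL.eq_lax hh hv, fun e => e ▸ isLax_lax hh hv⟩
  opB_unique m hm B := ⟨fun hB => hB.eq_opB hh hv hm, fun e => e ▸ isOpB_opB hh hv hm⟩
  zero_curvature_K m hm := by
    have hA := LatticeDiff.isFlow_opA hh hv.isPotential hm
    have := congrArg (evOp 0) (hA.curvature_eq hh hv.isPotential)
    rwa [evOp_curvature' (hv.ev_unit 0), evOp_single, ev_flowK (hv.ev_unit 0) hv.isPotential hh,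
      evOp_opA (hv.ev_unit 0) hv.isPotential hh] at this
  zero_curvature_sigma m hm := by
    have hB := LatticeDiff.isFlow_truncB hh hv.isPotential hm
    have := congrArg (evOp 0) (hB.curvature_eq hh hv.isPotential)
    rwa [evOp_curvature (hv.ev_unit 0), evOp_single,
      ev_flowSigma (hv.ev_unit 0) hv.isPotential hh (by omega),
      evOp_opB (hv.ev_unit 0) hv.isPotential hh (by omega)] at this
  lax_eqn_K m hm j := by
    have hA := LatticeDiff.isFlow_opA hh hv.isPotential hm
    have := gateaux_lax hh hv hA (fun s => ev_flowK (hv.ev_unit s) hv.isPotential hh m) j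
    rwa [show sym h 0 = 0 from mul_zero _, map_zero, add_zero, evOp_comm,
      evOp_opA (hv.ev_unit 0) hv.isPotential hh, evOp_lax (hv.ev_unit 0) hv.isPotential hh] at this
  lax_eqn_sigma m hm j := by
    have hB := LatticeDiff.isFlow_truncB hh hv.isPotential hm
    have := gateaux_lax hh hv hB
      (fun s => ev_flowSigma (hv.ev_unit s) hv.isPotential hh (by omega)) j
    rwa [← LatticeDiff.nonisoRhs_eq (by omega : 1 ≤ m), evOp_nonisoRhs (hv.ev_unit 0) hv.isPotential hh,
      evOp_opB (hv.ev_unit 0) hv.isPotential hh (by omega)] at this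

end WellDefined

/-! ## Functionals given by flows -/

/-- The functional `F` is the flow with symbol `(p, q)`. -/
structure HasSymbol (h : ℝ) (F : Functional) (p q : ℝ[X]) : Prop where
  isLocal : IsLocal F
  flow : ∀ w (hw : AdmissibleFamily h w), ∃ P : PDO latticeDiff.E,
    latticeDiff.IsFlow h (unitOf h w hw) P p q ∧
      ∀ s, F (fiber w s) = ev s (latticeDiff.curvature h (unitOf h w hw) P 1)

lemma hasSymbol_flowK (hh : h ≠ 0) {m : ℕ} (hm : 1 ≤ m) : HasSymbol h (flowK h m) (X ^ m) 0 :=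
  ⟨isLocal_flowK h m, fun _ hw => ⟨_, LatticeDiff.isFlow_opA hh (isPotential_unitOf hw) hm,
    fun s => (ev_flowK (ev_unitOf hw s) (isPotential_unitOf hw) hh m).symm⟩⟩

lemma hasSymbol_flowSigma (hh : h ≠ 0) {m : ℕ} (hm : 2 ≤ m) :
    HasSymbol h (flowSigma h m) 0 (X ^ (m - 1)) :=
  ⟨isLocal_flowSigma h m, fun _ hw => ⟨_, LatticeDiff.isFlow_truncB hh (isPotential_unitOf hw) hm,
    fun s => (ev_flowSigma (ev_unitOf hw s) (isPotential_unitOf hw) hh (by omega)).symm⟩⟩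

namespace HasSymbol

variable {F G H : Functional} {p q p' q' : ℝ[X]}

lemma add (hF : HasSymbol h F p q) (hG : HasSymbol h G p' q') :
    HasSymbol h (F + G) (p + p') (q + q') := by
  refine ⟨hF.isLocal.add hG.isLocal, fun w hw => ?_⟩
  obtain ⟨P, hP, eP⟩ := hF.flow w hw
  obtain ⟨Q, hQ, eQ⟩ := hG.flow w hw
  refine ⟨P + Q, hP.add hQ, fun s => ?_⟩
  have : latticeDiff.curvature h (unitOf h w hw) (P + Q) =
      latticeDiff.curvature h (unitOf h w hw) P + latticeDiff.curvature h (unitOf h w hw) Q := by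
    simp only [LatticeDiff.curvature, map_add]; noncomm_ring
  rw [this, PDO.add_coeff, map_add, ← eP, ← eQ]
  rfl

lemma smul (c : ℝ) (hF : HasSymbol h F p q) : HasSymbol h (c • F) (c • p) (c • q) := by
  refine ⟨hF.isLocal.smul c, fun w hw => ?_⟩
  obtain ⟨P, hP, eP⟩ := hF.flow w hw
  refine ⟨c • P, hP.smul c, fun s => ?_⟩
  have : latticeDiff.curvature h (unitOf h w hw) (c • P) =
      c • latticeDiff.curvature h (unitOf h w hw) P := by
    simp only [LatticeDiff.curvature, map_smul, smul_mul_assoc, mul_smul_comm, smul_add, smul_sub]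
  rw [this, PDO.smul_coeff, map_smul, ← eP]
  rfl

/-- The generator of the flow at a potential. -/
lemma flow_const (hF : HasSymbol h F p q) {v : Fn} (hv : Admissible h v) :
    ∃ P : PDO latticeDiff.E, latticeDiff.IsFlow h hv.unit P p q ∧
      ∀ s, ev s (latticeDiff.curvature h hv.unit P 1) = F v := by
  obtain ⟨P, hP, eP⟩ := hF.flow _ hv.constFamily
  exact ⟨P, hP, fun s => (eP s).symm⟩

lemma rapidlyDecreasing (hh : h ≠ 0) (hF : HasSymbol h F p q) {v : Fn} (hv : Admissible h v) :
    RapidlyDecreasing univ (F v) := by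
  obtain ⟨P, hP, eP⟩ := hF.flow_const hv
  rw [← eP 0]
  exact ev_rapid 0 (hP.curvature_coeffIn hh hv.isPotential 1)

/-- Flows are differentiable along families. -/
lemma exists_hasDerivAt (hF : HasSymbol h F p q) {w : ℤ → ℝ × ℝ → ℝ} (hw : AdmissibleFamily h w)
    (n : ℤ) (x : ℝ) : ∃ a, HasDerivAt (fun s => F (fiber w s) n x) a 0 := by
  obtain ⟨P, -, eP⟩ := hF.flow w hw
  refine ⟨_, (hasDerivAt_jet (latticeDiff.curvature h (unitOf h w hw) P 1) n 0 x).congr_of_eventuallyEq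
    (Filter.Eventually.of_forall fun s => ?_)⟩
  simp only [eP]
  rfl

lemma gateauxDiff (hF : HasSymbol h F p q) {v g : Fn} (hv : Admissible h v)
    (hg : RapidlyDecreasing univ g) : GateauxDiff F v g := fun n x => by
  obtain ⟨w, hw, -, -, hd⟩ := exists_family_hasDerivAt hv hg hF.isLocal n x
  obtain ⟨a, ha⟩ := hF.exists_hasDerivAt hw n x
  exact (hd a ha).differentiableAt

/-- The commutator of the derivatives of two flows along families with the velocities of each
other is the flow whose symbol is the commutator of the symbols. -/
theorem hasDerivAt_sub (hh : h ≠ 0) (hF : HasSymbol h F p q) (hG : HasSymbol h G p' q')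
    (hH : HasSymbol h H (derivative p * sym h q' - derivative p' * sym h q)
      (sym h (derivative q * q' - derivative q' * q))) {v : Fn} (hv : Admissible h v)
    {wF wG : ℤ → ℝ × ℝ → ℝ} (hwF : AdmissibleFamily h wF) (hwG : AdmissibleFamily h wG)
    (hF0 : fiber wF 0 = v) (hG0 : fiber wG 0 = v)
    (hFd : ∀ n x, fderiv ℝ (wF n) (0, x) (1, 0) = F v n x)
    (hGd : ∀ n x, fderiv ℝ (wG n) (0, x) (1, 0) = G v n x) (n : ℤ) (x a b : ℝ)
    (ha : HasDerivAt (fun s => F (fiber wG s) n x) a 0)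
    (hb : HasDerivAt (fun s => G (fiber wF s) n x) b 0) : a - b = H v n x := by
  obtain ⟨P, hP, eP⟩ := hF.flow_const hv
  obtain ⟨Q, hQ, eQ⟩ := hG.flow_const hv
  obtain ⟨R, hR, eR⟩ := hH.flow_const hv
  obtain ⟨P', hP', eP'⟩ := hF.flow wG hwG
  obtain ⟨Q', hQ', eQ'⟩ := hG.flow wF hwF
  obtain ⟨Z, hZ, hZe⟩ := jet.isFlow_bracket hh hv.isPotential (isPotential_unitOf hwF)
    (isPotential_unitOf hwG) hP hQ hP' hQ' (jet_π_unitOf hv hwF hF0) (jet_π_unitOf hv hwG hG0)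
    (jet_δ_unitOf hwF fun n s x => by rw [hFd, ← eP s]; rfl)
    (jet_δ_unitOf hwG fun n s x => by rw [hGd, ← eQ s]; rfl)
  -- The bracket generator has the symbol of `H`, hence is the generator of `H`.
  rw [hZ.eq hh hv.isPotential hR] at hZe
  have h1 := hasDerivAt_jet (latticeDiff.curvature h (unitOf h wG hwG) P' 1) n 0 x
  have h2 := hasDerivAt_jet (latticeDiff.curvature h (unitOf h wF hwF) Q' 1) n 0 x
  simp only [eP'] at ha
  simp only [eQ'] at hb
  rw [ha.unique h1, hb.unique h2, ← eR 0, ← hZe]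
  rfl

theorem lieProd_eq (hh : h ≠ 0) (hF : HasSymbol h F p q) (hG : HasSymbol h G p' q')
    (hH : HasSymbol h H (derivative p * sym h q' - derivative p' * sym h q)
      (sym h (derivative q * q' - derivative q' * q))) {v : Fn} (hv : Admissible h v) :
    lieProd F G v = H v := by
  funext n x
  obtain ⟨wG, hwG, hG0, hGd, hdF⟩ :=
    exists_family_hasDerivAt hv (hG.rapidlyDecreasing hh hv) hF.isLocal n x
  obtain ⟨wF, hwF, hF0, hFd, hdG⟩ :=
    exists_family_hasDerivAt hv (hF.rapidlyDecreasing hh hv) hG.isLocal n x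
  obtain ⟨a, ha⟩ := hF.exists_hasDerivAt hwG n x
  obtain ⟨b, hb⟩ := hG.exists_hasDerivAt hwF n x
  rw [← hasDerivAt_sub hh hF hG hH hv hwF hwG hF0 hG0 hFd hGd n x a b ha hb, ← (hdF a ha).deriv,
    ← (hdG b hb).deriv]
  rfl

end HasSymbol

/-- If `F₁` is the negative of the commutator of `F₀` and `K`, then `F₀ + t F₁` is a symmetry of
`v_t = K(v)`, for an isospectral flow `K`. -/
theorem isSymmetry_of_hasSymbol (hh : h ≠ 0) {K F₀ F₁ : Functional} {k p₀ q₀ : ℝ[X]}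
    (hK : HasSymbol h K k 0) (h₀ : HasSymbol h F₀ p₀ q₀)
    (h₁ : HasSymbol h F₁ (derivative k * sym h q₀) 0) :
    IsSymmetry h K fun t => t • F₁ + F₀ := by
  intro I v hI hsol t ht
  obtain ⟨wK, hwK, hK0, hKd, hdt⟩ := hsol.exists_family hI ht
  have hv : Admissible h (v t) := hK0 ▸ hwK.admissible 0
  have hF := (h₁.smul t).add h₀
  have hR := hF.rapidlyDecreasing hh hv
  refine ⟨hK.gateauxDiff hv hR, fun n x => ?_⟩
  obtain ⟨wF, hwF, hF0, hFd, hdK⟩ := exists_family_hasDerivAt hv hR hK.isLocal n x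
  obtain ⟨b, hb⟩ := hK.exists_hasDerivAt hwF n x
  obtain ⟨f₁, hf₁⟩ := h₁.exists_hasDerivAt hwK n x
  obtain ⟨f₀, hf₀⟩ := h₀.exists_hasDerivAt hwK n x
  -- The commutator of `t F₁ + F₀` with `K` is `-F₁`, because `F₁` and `K` have symbols with second
  -- component zero and commute.
  have hH : HasSymbol h ((-1 : ℝ) • F₁)
      (derivative (t • (derivative k * sym h q₀) + p₀) * sym h 0 -
        derivative k * sym h (t • 0 + q₀))
      (sym h (derivative (t • 0 + q₀) * 0 - derivative 0 * (t • 0 + q₀))) := by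
    convert h₁.smul (-1) using 1
    · simp [sym]
    · simp [sym]
  have hab := HasSymbol.hasDerivAt_sub hh hF hK hH hv hwF hwK hF0 hK0 hFd hKd n x
    (t * f₁ + f₀) b ((hf₁.const_mul t).add hf₀) hb
  -- The total derivative is `F₁` plus the derivative `t f₁ + f₀` at frozen time; the latter minus
  -- `b` is `-F₁` by `hab`, so the sum is `b`.
  have h1 := ((hasDerivAt_id t).mul (hdt F₁ n x f₁ hf₁)).add (hdt F₀ n x f₀ hf₀)
  have h2 : gateaux K (v t) ((t • F₁ + F₀) (v t)) n x = b := (hdK b hb).deriv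
  have h3 : ((-1 : ℝ) • F₁) (v t) n x = -1 * F₁ (v t) n x := rfl
  rw [h3] at hab
  rw [h2]
  refine h1.congr_deriv ?_
  simp only [id]
  linarith

end DDmKP

namespace DDmKP
open Set PseudoDiff
open Polynomial (derivative X C)
open scoped Polynomial

/-! ## The Lie algebra of symbols -/

/-- Pairs `(a, b)` of polynomials, representing the symbols `(z a, z b)`. -/
def FlowSymbol (_ : ℝ) : Type := ℝ[X] × ℝ[X]

namespace FlowSymbol

variable {h : ℝ}

instance : AddCommGroup (FlowSymbol h) := inferInstanceAs (AddCommGroup (ℝ[X] × ℝ[X]))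
instance : Module ℝ (FlowSymbol h) := inferInstanceAs (Module ℝ (ℝ[X] × ℝ[X]))

/-- The commutator of the symbols `(z a, z b)`, divided by `z`. The spacing `h` is a parameter of
the type because the bracket depends on it. -/
instance : Bracket (FlowSymbol h) (FlowSymbol h) := ⟨fun x y =>
  ((1 + C h * X) * (derivative (X * x.1) * y.2 - derivative (X * y.1) * x.2),
    (1 + C h * X) * X * (derivative x.2 * y.2 - derivative y.2 * x.2))⟩

lemma ext {x y : FlowSymbol h} (h1 : x.1 = y.1) (h2 : x.2 = y.2) : x = y := Prod.ext h1 h2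

@[simp] lemma add_fst (x y : FlowSymbol h) : (x + y).1 = x.1 + y.1 := rfl
@[simp] lemma add_snd (x y : FlowSymbol h) : (x + y).2 = x.2 + y.2 := rfl
@[simp] lemma smul_fst (c : ℝ) (x : FlowSymbol h) : (c • x).1 = c • x.1 := rfl
@[simp] lemma smul_snd (c : ℝ) (x : FlowSymbol h) : (c • x).2 = c • x.2 := rfl
@[simp] lemma zero_fst : (0 : FlowSymbol h).1 = 0 := rfl
@[simp] lemma zero_snd : (0 : FlowSymbol h).2 = 0 := rfl
lemma lie_fst (x y : FlowSymbol h) : ⁅x, y⁆.1 =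
    (1 + C h * X) * (derivative (X * x.1) * y.2 - derivative (X * y.1) * x.2) := rfl
lemma lie_snd (x y : FlowSymbol h) : ⁅x, y⁆.2 =
    (1 + C h * X) * X * (derivative x.2 * y.2 - derivative y.2 * x.2) := rfl

instance : LieRing (FlowSymbol h) where
  add_lie x y z := ext
    (by simp only [lie_fst, add_fst, add_snd, mul_add, map_add]; ring)
    (by simp only [lie_snd, add_snd, map_add]; ring)
  lie_add x y z := ext
    (by simp only [lie_fst, add_fst, add_snd, mul_add, map_add]; ring)
    (by simp only [lie_snd, add_snd, map_add]; ring)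
  lie_self x := ext (by simp [lie_fst]) (by simp [lie_snd])
  leibniz_lie x y z := ext
    (by
      simp only [lie_fst, lie_snd, add_fst, Polynomial.derivative_mul, map_add, map_sub,
        Polynomial.derivative_X, Polynomial.derivative_C, Polynomial.derivative_one]
      ring)
    (by
      simp only [lie_snd, add_snd, Polynomial.derivative_mul, map_add, map_sub,
        Polynomial.derivative_X, Polynomial.derivative_C, Polynomial.derivative_one]
      ring)

instance : LieAlgebra ℝ (FlowSymbol h) where
  lie_smul c x y := ext
    (by
      simp only [lie_fst, smul_fst, smul_snd, Polynomial.smul_eq_C_mul, Polynomial.derivative_mul,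
        Polynomial.derivative_C]
      ring)
    (by
      simp only [lie_snd, smul_snd, Polynomial.smul_eq_C_mul, Polynomial.derivative_mul,
        Polynomial.derivative_C]
      ring)

variable (h)

/-- The isospectral flow with symbol `(z a, 0)`. -/
def isospectral : ℝ[X] →ₗ[ℝ] Functional :=
  Polynomial.lsum fun i => LinearMap.toSpanSingleton ℝ Functional (flowK h (i + 1))

/-- The nonisospectral flow with symbol `(0, z b)`. -/
def nonisospectral : ℝ[X] →ₗ[ℝ] Functional :=
  Polynomial.lsum fun i => LinearMap.toSpanSingleton ℝ Functional (flowSigma h (i + 2))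

/-- The flow with a given symbol. -/
def toFunctional : FlowSymbol h →ₗ[ℝ] Functional where
  toFun x := isospectral h x.1 + nonisospectral h x.2
  map_add' x y := by rw [add_fst, add_snd, map_add, map_add]; abel
  map_smul' c x := by rw [smul_fst, smul_snd, map_smul, map_smul, RingHom.id_apply, smul_add]

variable {h}

lemma toFunctional_apply (x : FlowSymbol h) :
    toFunctional h x = isospectral h x.1 + nonisospectral h x.2 := rfl

lemma isospectral_apply (a : ℝ[X]) :
    isospectral h a = a.sum fun i c => c • flowK h (i + 1) := rfl

lemma nonisospectral_apply (b : ℝ[X]) :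
    nonisospectral h b = b.sum fun i c => c • flowSigma h (i + 2) := rfl

lemma isospectral_monomial (i : ℕ) (c : ℝ) :
    isospectral h (Polynomial.monomial i c) = c • flowK h (i + 1) := by
  rw [isospectral_apply, Polynomial.sum_monomial_index _ _ (by simp)]

lemma nonisospectral_monomial (i : ℕ) (c : ℝ) :
    nonisospectral h (Polynomial.monomial i c) = c • flowSigma h (i + 2) := by
  rw [nonisospectral_apply, Polynomial.sum_monomial_index _ _ (by simp)]

lemma hasSymbol_isospectral (hh : h ≠ 0) (a : ℝ[X]) :
    HasSymbol h (isospectral h a) (X * a) 0 := by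
  induction a using Polynomial.induction_on' with
  | add a b ha hb =>
    have := ha.add hb
    rwa [← map_add, ← mul_add, add_zero] at this
  | monomial i c =>
    rw [isospectral_monomial]
    convert (hasSymbol_flowK hh (Nat.le_add_left 1 i)).smul c using 1
    · rw [← Polynomial.C_mul_X_pow_eq_monomial, Polynomial.smul_eq_C_mul]; ring
    · simp

lemma hasSymbol_nonisospectral (hh : h ≠ 0) (b : ℝ[X]) :
    HasSymbol h (nonisospectral h b) 0 (X * b) := by
  induction b using Polynomial.induction_on' with
  | add a b ha hb =>
    have := ha.add hb
    rwa [← map_add, ← mul_add, add_zero] at this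
  | monomial i c =>
    rw [nonisospectral_monomial]
    convert (hasSymbol_flowSigma hh (Nat.le_add_left 2 i)).smul c using 1
    · simp
    · rw [← Polynomial.C_mul_X_pow_eq_monomial, Polynomial.smul_eq_C_mul,
        show i + 2 - 1 = i + 1 by omega]
      ring

lemma hasSymbol (hh : h ≠ 0) (x : FlowSymbol h) :
    HasSymbol h (toFunctional h x) (X * x.1) (X * x.2) := by
  have := (hasSymbol_isospectral hh x.1).add (hasSymbol_nonisospectral hh x.2)
  rwa [add_zero, zero_add] at this

theorem lieProd_toFunctional (hh : h ≠ 0) (x y : FlowSymbol h) {v : Fn} (hv : Admissible h v) :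
    lieProd (toFunctional h x) (toFunctional h y) v = toFunctional h ⁅x, y⁆ v := by
  refine (hasSymbol hh x).lieProd_eq hh (hasSymbol hh y) ?_ hv
  convert hasSymbol hh ⁅x, y⁆ using 1
  · rw [lie_fst, sym, sym]; ring
  · simp only [lie_snd, sym, Polynomial.derivative_mul, Polynomial.derivative_X]; ring

end FlowSymbol

/-! ## The Lie algebra of symmetries -/

variable {h : ℝ}

lemma gateaux_zero (F : Functional) (v : Fn) : gateaux F v 0 = 0 := by
  funext n x
  simp [gateaux]

/-- The line `v + ε g` may leave the phase space, so vanishing there does not give the claim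
directly; the replacing family stays inside, and `F` is zero along it. -/
lemma HasSymbol.gateaux_eq_zero {F : Functional} {p q : ℝ[X]} (hF : HasSymbol h F p q)
    (h0 : ∀ v, Admissible h v → F v = 0) {v g : Fn} (hv : Admissible h v)
    (hg : RapidlyDecreasing univ g) : gateaux F v g = 0 := by
  funext n x
  obtain ⟨w, hw, -, -, hd⟩ := exists_family_hasDerivAt hv hg hF.isLocal n x
  refine (hd 0 ?_).deriv
  have : (fun s => F (fiber w s) n x) = fun _ => 0 := by
    funext s; rw [h0 _ (hw.admissible s)]; rfl
  rw [this]
  exact hasDerivAt_const _ _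

/-- The restriction to the phase space, as a linear map. -/
def restrictMap (h : ℝ) : Functional →ₗ[ℝ] ({v : Fn // Admissible h v} → Fn) where
  toFun := restrict h
  map_add' _ _ := rfl
  map_smul' _ _ := rfl

namespace FlowSymbol

/-- The symbols of flows that vanish on the phase space. -/
def trivialIdeal (hh : h ≠ 0) : LieIdeal ℝ (FlowSymbol h) where
  __ := LinearMap.ker (restrictMap h ∘ₗ toFunctional h)
  lie_mem := by
    intro x m hm
    have hm' : ∀ v, Admissible h v → toFunctional h m v = 0 := fun v hv =>
      congrFun (LinearMap.mem_ker.1 hm) ⟨v, hv⟩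
    refine LinearMap.mem_ker.2 (funext fun v => ?_)
    change toFunctional h ⁅x, m⁆ v.1 = 0
    -- In the Lie product of a flow with a flow that vanishes on the phase space, one term is a
    -- derivative in direction zero, the other a derivative of the vanishing flow.
    rw [← lieProd_toFunctional hh x m v.2, lieProd, hm' _ v.2, gateaux_zero,
      (hasSymbol hh m).gateaux_eq_zero hm' v.2 ((hasSymbol hh x).rapidlyDecreasing hh v.2),
      sub_zero]

end FlowSymbol

open FlowSymbol in
/-- A spanning set of the functionals with symbols spans a Lie algebra. -/
theorem composeLieAlgebra_of_span (hh : h ≠ 0) {G : Set Functional}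
    (hG : Submodule.span ℝ G = LinearMap.range (toFunctional h)) : ComposeLieAlgebra h G := by
  constructor
  · intro F₁ hF₁ F₂ hF₂ v hv
    rw [hG] at hF₁ hF₂
    obtain ⟨x, rfl⟩ := hF₁
    obtain ⟨y, rfl⟩ := hF₂
    exact (hasSymbol hh x).gateauxDiff hv ((hasSymbol hh y).rapidlyDecreasing hh hv)
  -- Passing to the quotient by the symbols of vanishing flows makes the map to functionals
  -- injective, whether or not the flows are independent.
  · let ρ : (FlowSymbol h ⧸ trivialIdeal hh) →ₗ[ℝ] ({v : Fn // Admissible h v} → Fn) :=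
      (trivialIdeal hh).toSubmodule.liftQ (restrictMap h ∘ₗ toFunctional h) le_rfl
    have hρ : Function.Injective ρ :=
      LinearMap.ker_eq_bot.1 (Submodule.ker_liftQ_eq_bot _ _ _ le_rfl)
    refine ⟨FlowSymbol h ⧸ trivialIdeal hh, inferInstance, inferInstance, ρ, hρ, ?_, ?_⟩
    · have h1 : LinearMap.range ρ = LinearMap.range (restrictMap h ∘ₗ toFunctional h) :=
        Submodule.range_liftQ _ _ _
      rw [h1, LinearMap.range_comp, ← hG, Submodule.map_span]
      rfl
    · intro F₁ hF₁ F₂ hF₂ a b ha hb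
      rw [hG] at hF₁ hF₂
      obtain ⟨x, rfl⟩ := hF₁
      obtain ⟨y, rfl⟩ := hF₂
      have ea : a = LieSubmodule.Quotient.mk x := hρ ha
      have eb : b = LieSubmodule.Quotient.mk y := hρ hb
      rw [ea, eb, ← LieSubmodule.Quotient.mk_bracket]
      funext v
      exact (lieProd_toFunctional hh x y v.2).symm

/-! ### Symmetries and bracket relations, read off from the symbols. -/

lemma hasSymbol_flowTau (hh : h ≠ 0) {k m : ℕ} (hk : 1 ≤ k) (hm : 2 ≤ m) (t : ℝ) :
    HasSymbol h (flowTau h k m t) (((k : ℝ) * t) • (h • X ^ (m + k - 1) + X ^ (m + k - 2)))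
      (X ^ (m - 1)) := by
  have := ((((hasSymbol_flowK hh (by omega : 1 ≤ m + k - 1)).smul h).add
    (hasSymbol_flowK hh (by omega : 1 ≤ m + k - 2))).smul ((k : ℝ) * t)).add
    (hasSymbol_flowSigma hh hm)
  rwa [add_zero, smul_zero, add_zero, smul_zero, zero_add] at this

-- Subtracting the isospectral terms from `flowTau` recovers `flowSigma`; in particular the span
-- does not depend on `t`.
open FlowSymbol in
lemma span_eq_range {k : ℕ} (hk : 1 ≤ k) (t : ℝ) :
    Submodule.span ℝ ({F | ∃ s : ℕ, 1 ≤ s ∧ F = flowK h s} ∪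
      {F | ∃ m : ℕ, 2 ≤ m ∧ F = flowTau h k m t}) = LinearMap.range (toFunctional h) := by
  have hKr : ∀ s, 1 ≤ s → flowK h s ∈ LinearMap.range (toFunctional h) := fun s hs => by
    refine ⟨(Polynomial.monomial (s - 1) 1, 0), ?_⟩
    change isospectral h (Polynomial.monomial (s - 1) 1) + nonisospectral h 0 = _
    rw [isospectral_monomial, map_zero, add_zero, one_smul, Nat.sub_add_cancel hs]
  have hSr : ∀ m, 2 ≤ m → flowSigma h m ∈ LinearMap.range (toFunctional h) := fun m hm => by
    refine ⟨(0, Polynomial.monomial (m - 2) 1), ?_⟩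
    change isospectral h 0 + nonisospectral h (Polynomial.monomial (m - 2) 1) = _
    rw [nonisospectral_monomial, map_zero, zero_add, one_smul, Nat.sub_add_cancel hm]
  set S := Submodule.span ℝ ({F | ∃ s : ℕ, 1 ≤ s ∧ F = flowK h s} ∪
    {F | ∃ m : ℕ, 2 ≤ m ∧ F = flowTau h k m t}) with hS
  have hKs : ∀ s, 1 ≤ s → flowK h s ∈ S := fun s hs => Submodule.subset_span (Or.inl ⟨s, hs, rfl⟩)
  have hSs : ∀ m, 2 ≤ m → flowSigma h m ∈ S := fun m hm => by
    have h1 : flowTau h k m t ∈ S := Submodule.subset_span (Or.inr ⟨m, hm, rfl⟩)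
    have h2 : ((k : ℝ) * t) • (h • flowK h (m + k - 1) + flowK h (m + k - 2)) ∈ S :=
      S.smul_mem _ (S.add_mem (S.smul_mem _ (hKs _ (by omega))) (hKs _ (by omega)))
    have := S.sub_mem h1 h2
    rwa [flowTau, add_sub_cancel_left] at this
  apply le_antisymm
  · rw [Submodule.span_le]
    rintro F (⟨s, hs, rfl⟩ | ⟨m, hm, rfl⟩)
    · exact hKr s hs
    · exact Submodule.add_mem _ (Submodule.smul_mem _ _ (Submodule.add_mem _
        (Submodule.smul_mem _ _ (hKr _ (by omega))) (hKr _ (by omega)))) (hSr m hm)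
  · rintro _ ⟨x, rfl⟩
    rw [toFunctional_apply, isospectral_apply, nonisospectral_apply]
    exact S.add_mem (S.sum_mem fun i _ => S.smul_mem _ (hKs _ (by omega)))
      (S.sum_mem fun i _ => S.smul_mem _ (hSs _ (by omega)))

lemma isSymmetry_flowK (hh : h ≠ 0) {k s : ℕ} (hk : 1 ≤ k) (hs : 1 ≤ s) :
    IsSymmetry h (flowK h k) fun _ => flowK h s := by
  -- The zero functional, written as a multiple of a flow so that its symbol is at hand.
  have h0 : HasSymbol h ((0 : ℝ) • flowK h 1) (derivative (X ^ k) * sym h 0) 0 := by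
    convert (hasSymbol_flowK hh le_rfl).smul 0 using 1
    · simp [sym]
    · simp
  have := isSymmetry_of_hasSymbol hh (hasSymbol_flowK hh hk) (hasSymbol_flowK hh hs) h0
  simpa using this

/-- The coefficient of `t` has symbol `k z^(k-1) (1 + hz) z^(m-1)`, the commutator of `(z^k, 0)`
with `(0, z^(m-1))`, as `isSymmetry_of_hasSymbol` demands. -/
lemma isSymmetry_flowTau (hh : h ≠ 0) {k m : ℕ} (hk : 1 ≤ k) (hm : 2 ≤ m) :
    IsSymmetry h (flowK h k) (flowTau h k m) := by
  have h1 : HasSymbol h ((k : ℝ) • (h • flowK h (m + k - 1) + flowK h (m + k - 2)))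
      (derivative (X ^ k) * sym h (X ^ (m - 1))) 0 := by
    convert (((hasSymbol_flowK hh (by omega : 1 ≤ m + k - 1)).smul h).add
      (hasSymbol_flowK hh (by omega : 1 ≤ m + k - 2))).smul (k : ℝ) using 1
    · obtain ⟨c, rfl⟩ := Nat.exists_eq_add_of_le hk
      obtain ⟨b, rfl⟩ := Nat.exists_eq_add_of_le hm
      rw [show 2 + b + (1 + c) - 1 = b + c + 2 by omega, show 2 + b + (1 + c) - 2 = b + c + 1 by omega,
        show 2 + b - 1 = b + 1 by omega, Polynomial.derivative_X_pow, add_tsub_cancel_left, sym]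
      simp only [Polynomial.smul_eq_C_mul, map_natCast]
      ring
    · simp
  have := isSymmetry_of_hasSymbol hh (hasSymbol_flowK hh hk) (hasSymbol_flowSigma hh hm) h1
  convert this using 2 with t
  rw [flowTau, smul_smul, mul_comm t]

lemma lieProd_flowK_flowK (hh : h ≠ 0) {s m : ℕ} (hs : 1 ≤ s) (hm : 1 ≤ m) {v : Fn}
    (hv : Admissible h v) : lieProd (flowK h s) (flowK h m) v = 0 := by
  rw [(hasSymbol_flowK hh hs).lieProd_eq (H := (0 : ℝ) • flowK h 1) hh (hasSymbol_flowK hh hm) ?_ hv,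
    zero_smul]
  · rfl
  · convert (hasSymbol_flowK hh le_rfl).smul 0 using 1
    · simp [sym]
    · simp [sym]

lemma lieProd_flowK_flowTau (hh : h ≠ 0) {k s m : ℕ} (hk : 1 ≤ k) (hs : 1 ≤ s) (hm : 2 ≤ m) (t : ℝ)
    {v : Fn} (hv : Admissible h v) : lieProd (flowK h s) (flowTau h k m t) v =
      (s : ℝ) • (h • flowK h (m + s - 1) v + flowK h (m + s - 2) v) := by
  refine (hasSymbol_flowK hh hs).lieProd_eq (H := (s : ℝ) • (h • flowK h (m + s - 1) +
    flowK h (m + s - 2))) hh (hasSymbol_flowTau hh hk hm t) ?_ hv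
  convert (((hasSymbol_flowK hh (by omega : 1 ≤ m + s - 1)).smul h).add
    (hasSymbol_flowK hh (by omega : 1 ≤ m + s - 2))).smul (s : ℝ) using 1
  · obtain ⟨a, rfl⟩ := Nat.exists_eq_add_of_le hs
    obtain ⟨b, rfl⟩ := Nat.exists_eq_add_of_le hm
    rw [show 2 + b + (1 + a) - 1 = b + a + 2 by omega, show 2 + b + (1 + a) - 2 = b + a + 1 by omega,
      show 2 + b - 1 = b + 1 by omega, Polynomial.derivative_X_pow, add_tsub_cancel_left]
    simp only [Polynomial.smul_eq_C_mul, map_natCast, sym]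
    ring
  · simp [sym]

/-- The symbol of `flowTau` is `(0, z^(m-1))` transported by the exponential of `t` times the
commutator with `(z^k, 0)`, a series that stops at the linear term. Hence the relation is that of
the vector fields `(1 + hz) z^(m-1) d/dz`; it is checked directly as an identity of polynomials. -/
lemma lieProd_flowTau_flowTau (hh : h ≠ 0) {k s m : ℕ} (hk : 1 ≤ k) (hs : 2 ≤ s) (hm : 2 ≤ m)
    (t : ℝ) {v : Fn} (hv : Admissible h v) : lieProd (flowTau h k s t) (flowTau h k m t) v =
      ((s : ℝ) - m) • (h • flowTau h k (m + s - 1) t v + flowTau h k (m + s - 2) t v) := by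
  refine (hasSymbol_flowTau hh hk hs t).lieProd_eq (H := ((s : ℝ) - m) •
    (h • flowTau h k (m + s - 1) t + flowTau h k (m + s - 2) t)) hh (hasSymbol_flowTau hh hk hm t)
    ?_ hv
  have key := (((hasSymbol_flowTau hh hk (by omega : 2 ≤ m + s - 1) t).smul h).add
    (hasSymbol_flowTau hh hk (by omega : 2 ≤ m + s - 2) t)).smul ((s : ℝ) - m)
  obtain ⟨c, rfl⟩ := Nat.exists_eq_add_of_le hk
  obtain ⟨a, rfl⟩ := Nat.exists_eq_add_of_le hs
  obtain ⟨b, rfl⟩ := Nat.exists_eq_add_of_le hm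
  convert key using 1
  · rw [show 2 + a + (1 + c) - 1 = (a + c + 1) + 1 by omega,
      show 2 + a + (1 + c) - 2 = a + c + 1 by omega,
      show 2 + b + (1 + c) - 1 = (b + c + 1) + 1 by omega,
      show 2 + b + (1 + c) - 2 = b + c + 1 by omega,
      show 2 + b + (2 + a) - 1 + (1 + c) - 1 = a + b + c + 3 by omega,
      show 2 + b + (2 + a) - 1 + (1 + c) - 2 = a + b + c + 2 by omega,
      show 2 + b + (2 + a) - 2 + (1 + c) - 1 = a + b + c + 2 by omega,
      show 2 + b + (2 + a) - 2 + (1 + c) - 2 = a + b + c + 1 by omega,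
      show 2 + b - 1 = b + 1 by omega, show 2 + a - 1 = a + 1 by omega]
    simp only [Polynomial.smul_eq_C_mul, Polynomial.derivative_mul, map_add, Polynomial.derivative_C,
      Polynomial.derivative_X_pow, add_tsub_cancel_right, map_mul, map_sub, map_natCast, sym,
      Nat.cast_add, Nat.cast_one, Nat.cast_ofNat, Polynomial.C_1, Polynomial.C_ofNat]
    ring
  · rw [show 2 + b + (2 + a) - 1 - 1 = a + b + 2 by omega,
      show 2 + b + (2 + a) - 2 - 1 = a + b + 1 by omega,
      show 2 + b - 1 = b + 1 by omega, show 2 + a - 1 = a + 1 by omega]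
    simp only [Polynomial.smul_eq_C_mul, map_add, Polynomial.derivative_X_pow,
      add_tsub_cancel_right, map_sub, map_natCast, sym, Nat.cast_add, Nat.cast_one, Nat.cast_ofNat,
      Polynomial.C_1, Polynomial.C_ofNat]
    ring

end DDmKP

end

theorem theorem4 (h : ℝ) (hh : h ≠ 0) :
    (∀ v : DDmKP.Fn, DDmKP.Admissible h v → DDmKP.HierarchyWellDefined h v) ∧
    ∀ k : ℕ, 1 ≤ k →
      -- two sets of symmetries of the equation `v_{t_k} = K̄_k`
      (∀ s : ℕ, 1 ≤ s → DDmKP.IsSymmetry h (DDmKP.flowK h k) (fun _ => DDmKP.flowK h s)) ∧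
      (∀ m : ℕ, 2 ≤ m → DDmKP.IsSymmetry h (DDmKP.flowK h k) (DDmKP.flowTau h k m)) ∧
      -- they compose a Lie algebra
      ∀ t : ℝ,
        DDmKP.ComposeLieAlgebra h
          ({F | ∃ s : ℕ, 1 ≤ s ∧ F = DDmKP.flowK h s} ∪
            {F | ∃ m : ℕ, 2 ≤ m ∧ F = DDmKP.flowTau h k m t}) ∧
        ∀ v : DDmKP.Fn, DDmKP.Admissible h v →
          (∀ s m : ℕ, 1 ≤ s → 1 ≤ m →
            DDmKP.lieProd (DDmKP.flowK h s) (DDmKP.flowK h m) v = 0) ∧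
          (∀ s m : ℕ, 1 ≤ s → 2 ≤ m →
            DDmKP.lieProd (DDmKP.flowK h s) (DDmKP.flowTau h k m t) v =
              (s : ℝ) • (h • DDmKP.flowK h (m + s - 1) v + DDmKP.flowK h (m + s - 2) v)) ∧
          (∀ s m : ℕ, 2 ≤ s → 2 ≤ m →
            DDmKP.lieProd (DDmKP.flowTau h k s t) (DDmKP.flowTau h k m t) v =
              ((s : ℝ) - m) •
                (h • DDmKP.flowTau h k (m + s - 1) t v + DDmKP.flowTau h k (m + s - 2) t v)) := by
  refine ⟨fun v hv => DDmKP.hierarchyWellDefined hh hv, fun k hk =>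
    ⟨fun s hs => DDmKP.isSymmetry_flowK hh hk hs, fun m hm => DDmKP.isSymmetry_flowTau hh hk hm,
    fun t => ⟨DDmKP.composeLieAlgebra_of_span hh (DDmKP.span_eq_range hk t), fun v hv =>
      ⟨fun s m hs hm => DDmKP.lieProd_flowK_flowK hh hs hm hv,
      fun s m hs hm => DDmKP.lieProd_flowK_flowTau hh hk hs hm t hv,
      fun s m hs hm => DDmKP.lieProd_flowTau_flowTau hh hk hs hm t hv⟩⟩⟩⟩
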